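/- Let $T>0$, and call a function on $[0,T]$ (scalar, vector or matrix valued) *differentiable with a square-summable derivative* if each of its entries is absolutely continuous on $[0,T]$ and has its (almost everywhere existing) derivative in $L^2(0,T)$. Let $F$ and $G$ be, respectively, $r\times p$ and $p\times r$ complex matrix functions on $[0,T]$ which are differentiable with square-summable derivatives and satisfy $$F(x)G(x)=I_r\qquad(0\le x\le T).$$ Let $K$ and $A$ be the operators on $L^2_r(0,T)=L^2\big((0,T);\mathbb C^r\big)$ given by $$(Kf)(x)=F(x)\int_0^x G(t)f(t)\,dt,\qquad (Af)(x)=\int_0^x f(t)\,dt .$$ Then $K$ is similar to $A$. More precisely, there is a bounded linear operator $E$ on $L^2_r(0,T)$ with bounded inverse such that $K=EAE^{-1}$ and $$(Ef)(x)=\rho(x)\Big(f(x)+\int_0^x N(x,t)f(t)\,dt\Big)\qquad (f\in L^2_r(0,T),\ \text{a.e. } x\in(0,T)),$$ where $\rho$ is an absolutely continuous $r\times r$ matrix function on $[0,T]$ with $$\rho'(x)=F'(x)G(x)\rho(x)\ \text{ for a.e. } x\in(0,T),\qquad \rho(0)=I_r,$$ $\rho(x)$ is invertible for every $x\in[0,T]$,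 the $r\times r$ matrix functions $\rho$, $\rho^{-1}$ and $N$ are measurable, $\rho$ and $\rho^{-1}$ are bounded on $[0,T]$, and $N$ is bounded on $\{0\le t\le x\le T\}$. Moreover, both $E$ and $E^{-1}$ map functions that are differentiable with a square-summable derivative into functions that are differentiable with a square-summable derivative. -/

import Mathlib

open MeasureTheory Set
open scoped Matrix

noncomputable section

namespace Similarity

/-- The Hilbert space `L²_n(0,T)` of (classes of) square-summable functions on the interval
with values in `ℂⁿ`.  (The end point `T` is a null set; the half-open interval fits the
interval integral `∫ t in 0..x`.) -/
abbrev L2 (n : ℕ) (T : ℝ) : Type :=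
  Lp (EuclideanSpace ℂ (Fin n)) 2 (volume.restrict (Ioc 0 T))

/-- A scalar function is differentiable on `[0,T]` with a square-summable derivative: it is
absolutely continuous on `[0,T]` and its (almost everywhere existing) derivative is in
`L²(0,T)`. -/
structure HasL2Deriv (T : ℝ) (f : ℝ → ℂ) : Prop where
  absCont : AbsolutelyContinuousOnInterval f 0 T
  memLp : MemLp (deriv f) 2 (volume.restrict (Ioc 0 T))

/-- A matrix function is differentiable with a square-summable derivative
if all its entries are. -/
def MatHasL2Deriv {m n : ℕ} (T : ℝ) (Φ : ℝ → Matrix (Fin m) (Fin n) ℂ) : Prop :=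
  ∀ i j, HasL2Deriv T fun x => Φ x i j

/-- The entrywise derivative `Φ'` of a matrix function. -/
def matDeriv {m n : ℕ} (Φ : ℝ → Matrix (Fin m) (Fin n) ℂ) (x : ℝ) : Matrix (Fin m) (Fin n) ℂ :=
  Matrix.of fun i j => deriv (fun s => Φ s i j) x

/-- An element of `L²_n(0,T)` belongs to the class of differentiable functions with a
square-summable derivative if it has a representative in that class. -/
def MemH1 {n : ℕ} {T : ℝ} (f : L2 n T) : Prop :=
  ∃ φ : ℝ → EuclideanSpace ℂ (Fin n),
    (∀ i, HasL2Deriv T fun x => φ x i) ∧ f =ᵐ[volume.restrict (Ioc 0 T)] φ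

/-- A matrix acting on a column vector. -/
def act {m n : ℕ} (M : Matrix (Fin m) (Fin n) ℂ) (v : EuclideanSpace ℂ (Fin n)) :
    EuclideanSpace ℂ (Fin m) :=
  WithLp.toLp 2 (M *ᵥ v.ofLp)

/-! ### The integration operator -/

lemma integrableOn_of_L2 {n : ℕ} {T : ℝ} (f : L2 n T) : IntegrableOn f (Ioc 0 T) :=
  (Lp.memLp f).integrable (by norm_num)

lemma norm_integral_le {n : ℕ} {T : ℝ} (f : L2 n T) {x : ℝ} (hx : x ∈ Ioc 0 T) :
    ‖∫ t in (0 : ℝ)..x, f t‖ ≤ T ^ (2⁻¹ : ℝ) * ‖f‖ := by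
  have hT : 0 ≤ T := hx.1.le.trans hx.2
  have hf := integrableOn_of_L2 f
  have h1 : ‖∫ t in (0 : ℝ)..x, f t‖ ≤ ∫ t in Ioc 0 T, ‖f t‖ := by
    refine (intervalIntegral.norm_integral_le_integral_norm hx.1.le).trans ?_
    rw [intervalIntegral.integral_of_le hx.1.le]
    exact setIntegral_mono_set hf.norm (Filter.Eventually.of_forall fun _ => norm_nonneg _)
      (Ioc_subset_Ioc_right hx.2).eventuallyLE
  refine h1.trans ?_
  rw [integral_norm_eq_lintegral_enorm hf.1, ← eLpNorm_one_eq_lintegral_enorm, Lp.norm_def,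
    mul_comm]
  have h2 := eLpNorm_le_eLpNorm_mul_rpow_measure_univ (μ := volume.restrict (Ioc 0 T))
    (p := 1) (q := 2) (by norm_num) (Lp.aestronglyMeasurable f)
  have h4 : (1 / ENNReal.toReal 1 - 1 / ENNReal.toReal 2 : ℝ) = 2⁻¹ := by
    rw [ENNReal.toReal_one, ENNReal.toReal_ofNat]
    norm_num
  rw [h4] at h2
  have h3 := ENNReal.toReal_mono (ENNReal.mul_ne_top (Lp.eLpNorm_ne_top f)
    (ENNReal.rpow_ne_top_of_nonneg (by norm_num) (measure_ne_top _ _))) h2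
  refine h3.trans (le_of_eq ?_)
  rw [ENNReal.toReal_mul, ← ENNReal.toReal_rpow]
  rw [Measure.restrict_apply_univ, Real.volume_Ioc, sub_zero, ENNReal.toReal_ofReal hT]

lemma memLp_integral {n : ℕ} {T : ℝ} (f : L2 n T) :
    MemLp (fun x => ∫ t in (0 : ℝ)..x, f t) 2 (volume.restrict (Ioc 0 T)) := by
  rcases le_or_gt T 0 with hT | hT
  · simp [Ioc_eq_empty_of_le hT]
  refine MemLp.of_bound (C := T ^ (2⁻¹ : ℝ) * ‖f‖) ?_
    ((ae_restrict_iff' measurableSet_Ioc).2 (Filter.Eventually.of_forall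
      fun x hx => norm_integral_le f hx))
  have hc : ContinuousOn (fun x => ∫ t in (0 : ℝ)..x, f t) (Icc 0 T) := by
    have := intervalIntegral.continuousOn_primitive_interval (μ := volume) (a := 0) (b := T)
      (f := f) (by
        rw [uIcc_of_le hT.le]
        exact (integrableOn_Icc_iff_integrableOn_Ioc (by simp)).2 (integrableOn_of_L2 f))
    rwa [uIcc_of_le hT.le] at this
  exact (hc.mono Ioc_subset_Icc_self).aestronglyMeasurable measurableSet_Ioc

/-- The operator of integration `(A f)(x) = ∫₀ˣ f(t) dt` on `L²_n(0,T)`. -/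
def intOp (n : ℕ) (T : ℝ) : L2 n T →L[ℂ] L2 n T :=
  LinearMap.mkContinuousOfExistsBound
    { toFun := fun f => (memLp_integral f).toLp _
      map_add' := by
        intro f g
        rw [← MemLp.toLp_add]
        refine MemLp.toLp_congr _ _ ((ae_restrict_iff' measurableSet_Ioc).2
          (Filter.Eventually.of_forall fun x hx => ?_))
        have hs : Ioc 0 x ⊆ Ioc 0 T := Ioc_subset_Ioc_right hx.2
        simp only [Pi.add_apply]
        rw [intervalIntegral.integral_of_le hx.1.le, intervalIntegral.integral_of_le hx.1.le,
          intervalIntegral.integral_of_le hx.1.le,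
          ← integral_add ((integrableOn_of_L2 f).mono_set hs)
            ((integrableOn_of_L2 g).mono_set hs)]
        exact integral_congr_ae (ae_mono (Measure.restrict_mono hs le_rfl) (Lp.coeFn_add f g))
      map_smul' := by
        intro c f
        simp only [RingHom.id_apply]
        rw [← MemLp.toLp_const_smul]
        refine MemLp.toLp_congr _ _ ((ae_restrict_iff' measurableSet_Ioc).2
          (Filter.Eventually.of_forall fun x hx => ?_))
        have hs : Ioc 0 x ⊆ Ioc 0 T := Ioc_subset_Ioc_right hx.2
        simp only [Pi.smul_apply]
        rw [intervalIntegral.integral_of_le hx.1.le, intervalIntegral.integral_of_le hx.1.le,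
          ← integral_smul]
        exact integral_congr_ae
          (ae_mono (Measure.restrict_mono hs le_rfl) (Lp.coeFn_smul c f)) }
    ⟨_, fun f => by
      rcases le_or_gt T 0 with hT | hT
      · have h0 : ∀ a : L2 n T, ‖a‖ = 0 := fun a => by
          rw [Lp.norm_def]
          simp [Ioc_eq_empty_of_le hT]
        rw [h0, h0, mul_zero]
      have := Lp.norm_le_of_ae_bound (μ := volume.restrict (Ioc 0 T))
        (f := (memLp_integral f).toLp _) (C := T ^ (2⁻¹ : ℝ) * ‖f‖) (by positivity) (by
          filter_upwards [(memLp_integral f).coeFn_toLp, ae_restrict_mem measurableSet_Ioc]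
            with x h1 hx
          rw [h1]
          exact norm_integral_le f hx)
      rw [← mul_assoc] at this
      exact this⟩

lemma intOp_ae {n : ℕ} {T : ℝ} (f : L2 n T) :
    intOp n T f =ᵐ[volume.restrict (Ioc 0 T)] fun x => ∫ t in (0 : ℝ)..x, f t :=
  (memLp_integral f).coeFn_toLp

/-! ### Multiplication by a continuous matrix function, and the operator `K` -/

lemma continuous_actCLM {m n : ℕ} :
    Continuous fun M : Matrix (Fin m) (Fin n) ℂ =>
      LinearMap.toContinuousLinearMap (Matrix.toLpLin 2 2 M) :=
  LinearMap.continuous_of_finiteDimensional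
    ((LinearMap.toContinuousLinearMap :
      (EuclideanSpace ℂ (Fin n) →ₗ[ℂ] EuclideanSpace ℂ (Fin m)) ≃ₗ[ℂ] _).toLinearMap ∘ₗ
        (Matrix.toLpLin 2 2 : Matrix (Fin m) (Fin n) ℂ ≃ₗ[ℂ] _).toLinearMap)

lemma exists_norm_act_le {m n : ℕ} {T : ℝ} {Φ : ℝ → Matrix (Fin m) (Fin n) ℂ}
    (hΦ : ContinuousOn Φ (Icc 0 T)) :
    ∃ C : ℝ, ∀ x ∈ Ioc 0 T, ∀ v, ‖act (Φ x) v‖ ≤ C * ‖v‖ := by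
  obtain ⟨C, hC⟩ := isCompact_Icc.exists_bound_of_continuousOn
    (continuous_actCLM.comp_continuousOn hΦ)
  refine ⟨C, fun x hx v => ?_⟩
  exact (LinearMap.toContinuousLinearMap (Matrix.toLpLin 2 2 (Φ x))).le_of_opNorm_le
    (hC x (Ioc_subset_Icc_self hx)) v

lemma memLp_act {m n : ℕ} {T : ℝ} {Φ : ℝ → Matrix (Fin m) (Fin n) ℂ}
    (hΦ : ContinuousOn Φ (Icc 0 T)) (f : L2 n T) :
    MemLp (fun x => act (Φ x) (f x)) 2 (volume.restrict (Ioc 0 T)) := by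
  obtain ⟨C, hC⟩ := exists_norm_act_le hΦ
  refine MemLp.of_le_mul (c := C) (Lp.memLp f) ?_
    ((ae_restrict_iff' measurableSet_Ioc).2 (Filter.Eventually.of_forall
      fun x hx => hC x hx (f x)))
  have h1 : AEStronglyMeasurable
      (fun x => LinearMap.toContinuousLinearMap (Matrix.toLpLin 2 2 (Φ x)))
      (volume.restrict (Ioc 0 T)) :=
    ((continuous_actCLM.comp_continuousOn hΦ).mono Ioc_subset_Icc_self).aestronglyMeasurable
      measurableSet_Ioc
  exact isBoundedBilinearMap_apply.continuous.comp_aestronglyMeasurable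
    (h1.prodMk (Lp.aestronglyMeasurable f))

/-- The operator `f(x) ↦ Φ(x) f(x)` from `L²_n(0,T)` to `L²_m(0,T)`, for an `m × n` matrix
function `Φ` continuous on `[0,T]`. -/
def mulOp {m n : ℕ} {T : ℝ} (Φ : ℝ → Matrix (Fin m) (Fin n) ℂ)
    (hΦ : ContinuousOn Φ (Icc 0 T)) : L2 n T →L[ℂ] L2 m T :=
  LinearMap.mkContinuousOfExistsBound
    { toFun := fun f => (memLp_act hΦ f).toLp _
      map_add' := by
        intro f g
        rw [← MemLp.toLp_add]
        refine MemLp.toLp_congr _ _ ?_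
        filter_upwards [Lp.coeFn_add f g] with x hx
        rw [hx]
        simp only [act, Pi.add_apply, WithLp.ofLp_add, Matrix.mulVec_add, WithLp.toLp_add]
      map_smul' := by
        intro c f
        simp only [RingHom.id_apply]
        rw [← MemLp.toLp_const_smul]
        refine MemLp.toLp_congr _ _ ?_
        filter_upwards [Lp.coeFn_smul c f] with x hx
        rw [hx]
        simp only [act, Pi.smul_apply, WithLp.ofLp_smul, Matrix.mulVec_smul, WithLp.toLp_smul] }
    (by
      obtain ⟨C, hC⟩ := exists_norm_act_le hΦ
      refine ⟨C, fun f => Lp.norm_le_mul_norm_of_ae_le_mul ?_⟩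
      filter_upwards [(memLp_act hΦ f).coeFn_toLp, ae_restrict_mem measurableSet_Ioc]
        with x h1 hx
      exact (congrArg norm h1).trans_le (hC x hx (f x)))

lemma mulOp_ae {m n : ℕ} {T : ℝ} (Φ : ℝ → Matrix (Fin m) (Fin n) ℂ)
    (hΦ : ContinuousOn Φ (Icc 0 T)) (f : L2 n T) :
    mulOp Φ hΦ f =ᵐ[volume.restrict (Ioc 0 T)] fun x => act (Φ x) (f x) :=
  (memLp_act hΦ f).coeFn_toLp

lemma MatHasL2Deriv.continuousOn {m n : ℕ} {T : ℝ} (hT : 0 < T)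
    {Φ : ℝ → Matrix (Fin m) (Fin n) ℂ} (hΦ : MatHasL2Deriv T Φ) :
    ContinuousOn Φ (Icc 0 T) := by
  refine continuousOn_pi.2 fun i => continuousOn_pi.2 fun j => ?_
  have := (hΦ i j).absCont.continuousOn
  rwa [uIcc_of_le hT.le] at this

/-- The semi-separable operator `(K f)(x) = F(x) ∫₀ˣ G(t) f(t) dt` on `L²_r(0,T)`. -/
def kOp {r p : ℕ} {T : ℝ} (F : ℝ → Matrix (Fin r) (Fin p) ℂ)
    (G : ℝ → Matrix (Fin p) (Fin r) ℂ) (hF : ContinuousOn F (Icc 0 T))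
    (hG : ContinuousOn G (Icc 0 T)) : L2 r T →L[ℂ] L2 r T :=
  mulOp F hF ∘L intOp p T ∘L mulOp G hG

lemma kOp_ae {r p : ℕ} {T : ℝ} (F : ℝ → Matrix (Fin r) (Fin p) ℂ)
    (G : ℝ → Matrix (Fin p) (Fin r) ℂ) (hF : ContinuousOn F (Icc 0 T))
    (hG : ContinuousOn G (Icc 0 T)) (f : L2 r T) :
    kOp F G hF hG f =ᵐ[volume.restrict (Ioc 0 T)]
      fun x => act (F x) (∫ t in (0 : ℝ)..x, act (G t) (f t)) := by
  filter_upwards [mulOp_ae F hF (intOp p T (mulOp G hG f)), intOp_ae (mulOp G hG f),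
    ae_restrict_mem measurableSet_Ioc] with x h1 h2 hx
  refine h1.trans ?_
  rw [h2, intervalIntegral.integral_of_le hx.1.le, intervalIntegral.integral_of_le hx.1.le]
  congr 1
  exact integral_congr_ae (ae_mono
    (Measure.restrict_mono (Ioc_subset_Ioc_right hx.2) le_rfl) (mulOp_ae G hG f))

end Similarity

end

open Similarity

namespace Similarity

open Filter Topology

/-! The similarity is built in two stages. Let `ρ' = F'Gρ`, `ρ(0) = 1`, and write `σ = ρ⁻¹`, `P =
σF`, `Q = Gρ`. Then `PQ = 1`, and `ρ` is chosen exactly so that `P'Q = 0`. For `u = ∫Qf` and `g =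
σKρf = Pu` this gives `g' = f + P'u`, while `z = u - Qg` satisfies `P'z = P'u` and `z' = -QP'z -
Q'g`. Solving the last equation with the fundamental solution `Φ' = -QP'Φ` yields `g' + α∫γg = f`,
`g(0) = 0`, where `α = P'Φ` and `γ = Φ⁻¹Q'` are square-summable. So `σKρ` inverts `d/dx + α∫γ` under
zero initial data (`isPrimitive_semiSeparable`, `exists_normalization`).

The second stage removes `α∫γ` by a transmutation `1 + N` with `(d/dx + α∫γ)(1 + N)h = (1 + N)h'`.
Formally the kernel solves `(∂ₓ + ∂ₜ)N = -α(x)(γ(t) + ∫ₜˣ γ(s)N(s,t) ds)` with `N(x,0) = 0`, and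
integration along the lines `x - t = const` makes this a fixed-point equation. Although `α` and `γ`
are only square-summable, `α(x)γ(t)` is integrable along every characteristic with a uniform bound,
and a weight `exp(μt)` makes the linear part a contraction (`exists_exp_weight`, `exists_kernel`).
Hence `N` is bounded. No derivative of `N` is ever taken: the equation is used in integrated form,
obtained from Fubini's theorem (`integral_charIntegral_primitive`, `integral_kernelDeriv_apply`,
`exists_transmutation`).

For `f` in `L²`, both `(1 + N)Af` and `σKρ(1 + N)f` solve the same initial value problem, so they
agree (`IsPrimitive.unique`). With `E = ρ(1 + N)` this reads `KE = EA`. The factor `1 + N` is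
bijective as a Volterra perturbation of the identity with bounded kernel. The transmutation property
shows that `E` preserves square-summable derivatives, and uniqueness gives the same for `E⁻¹`. -/

/-! ### Weighted contractions -/

section Contraction

variable {ι E : Type*} [NormedAddCommGroup E]

/-- A map that halves weighted distances has at most one fixed point with bounded weighted norm. -/
lemma eq_zero_of_halving {w : ι → ℝ} {S : Set ι} {d : ι → E} {C : ℝ}
    (h0 : ∀ i ∈ S, ‖d i‖ ≤ C * w i)
    (h : ∀ D : ℝ, (∀ i ∈ S, ‖d i‖ ≤ D * w i) → ∀ i ∈ S, ‖d i‖ ≤ D / 2 * w i) :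
    ∀ i ∈ S, d i = 0 := by
  intro i hi
  have key : ∀ n : ℕ, ∀ i ∈ S, ‖d i‖ ≤ C * (1 / 2) ^ n * w i := by
    intro n
    induction n with
    | zero => simpa using h0
    | succ n ih =>
      intro i hi
      refine (h _ ih i hi).trans (le_of_eq ?_)
      rw [pow_succ]
      ring
  have hlim : Tendsto (fun n : ℕ => C * (1 / 2 : ℝ) ^ n * w i) atTop (𝓝 (C * 0 * w i)) :=
    ((tendsto_pow_atTop_nhds_zero_of_lt_one (by norm_num) (by norm_num)).const_mul C).mul_const _
  have := ge_of_tendsto' hlim fun n => key n i hi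
  simpa using this

/-- A map that halves weighted distances between strongly measurable functions has a strongly
measurable fixed point. -/
lemma exists_fixedPoint_of_halving [CompleteSpace E] [MeasurableSpace ι] {w : ι → ℝ}
    {Ψ : (ι → E) → ι → E}
    (hmeas : ∀ f C, StronglyMeasurable f → (∀ i, ‖f i‖ ≤ C * w i) → StronglyMeasurable (Ψ f))
    (hhalf : ∀ f g C, StronglyMeasurable f → StronglyMeasurable g → (∀ i, ‖f i‖ ≤ C * w i) →
      (∀ i, ‖g i‖ ≤ C * w i) → ∀ D, (∀ i, ‖f i - g i‖ ≤ D * w i) →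
      ∀ i, ‖Ψ f i - Ψ g i‖ ≤ D / 2 * w i)
    {C : ℝ} (hC : ∀ i, ‖Ψ 0 i‖ ≤ C * w i) (hw : ∀ i, 0 ≤ w i) :
    ∃ f : ι → E, StronglyMeasurable f ∧ (∃ C, ∀ i, ‖f i‖ ≤ C * w i) ∧ ∀ i, Ψ f i = f i := by
  have up : ∀ {f : ι → E} {A B : ℝ}, A ≤ B → (∀ i, ‖f i‖ ≤ A * w i) → ∀ i, ‖f i‖ ≤ B * w i :=
    fun hAB h i => (h i).trans (mul_le_mul_of_nonneg_right hAB (hw i))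
  set S : ℕ → ι → E := fun n => Ψ^[n] 0 with hS
  have hS1 : ∀ n, S (n + 1) = Ψ (S n) := fun n => Function.iterate_succ_apply' _ _ _
  have key : ∀ n, StronglyMeasurable (S n) ∧ (∃ A, ∀ i, ‖S n i‖ ≤ A * w i) ∧
      ∀ i, ‖S (n + 1) i - S n i‖ ≤ C * (1 / 2) ^ n * w i := by
    intro n
    induction n with
    | zero =>
      refine ⟨stronglyMeasurable_zero, ⟨0, fun i => by simp [hS]⟩, fun i => ?_⟩
      simpa [hS] using hC i
    | succ n ih =>
      obtain ⟨h1, ⟨A, h2⟩, h3⟩ := ih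
      have h1' : StronglyMeasurable (S (n + 1)) := by
        rw [hS1]; exact hmeas _ _ h1 h2
      have h2' : ∀ i, ‖S (n + 1) i‖ ≤ (C * (1 / 2) ^ n + A) * w i := fun i => by
        have := norm_add_le (S (n + 1) i - S n i) (S n i)
        rw [sub_add_cancel] at this
        have := h3 i
        have := h2 i
        rw [add_mul]
        linarith
      refine ⟨h1', ⟨_, h2'⟩, fun i => ?_⟩
      -- The a priori constant must serve both iterates, hence the maximum; the halving itself acts
      -- on the bound for their difference.
      have := hhalf (S (n + 1)) (S n) (max (C * (1 / 2) ^ n + A) A) h1' h1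
        (up (le_max_left _ _) h2') (up (le_max_right _ _) h2) _ h3 i
      rw [← hS1, ← hS1] at this
      refine this.trans (le_of_eq ?_)
      rw [pow_succ]
      ring
  have hd : ∀ i n, dist (S n i) (S (n + 1) i) ≤ 2 * C * w i / 2 / 2 ^ n := fun i n => by
    rw [dist_comm, dist_eq_norm]
    refine ((key n).2.2 i).trans (le_of_eq ?_)
    rw [one_div, inv_pow]
    ring
  choose f hf using fun i => cauchySeq_tendsto_of_complete (cauchySeq_of_le_geometric_two (hd i))
  have hfm : StronglyMeasurable f :=
    stronglyMeasurable_of_tendsto atTop (fun n => (key n).1) (tendsto_pi_nhds.2 hf)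
  have hfd : ∀ n i, ‖f i - S n i‖ ≤ 2 * C / 2 ^ n * w i := fun n i => by
    have := dist_le_of_le_geometric_two_of_tendsto (hd i) (hf i) n
    rw [dist_comm, dist_eq_norm] at this
    refine this.trans (le_of_eq (by ring))
  have hfb : ∀ i, ‖f i‖ ≤ 2 * C * w i := fun i => by
    have := hfd 0 i
    simpa [hS] using this
  refine ⟨f, hfm, ⟨_, hfb⟩, fun i => ?_⟩
  have h1 : Tendsto (fun n => S (n + 1) i) atTop (𝓝 (Ψ f i)) := by
    rw [tendsto_iff_norm_sub_tendsto_zero]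
    have hlim : Tendsto (fun n : ℕ => C * w i * (1 / 2 : ℝ) ^ n) atTop (𝓝 (C * w i * 0)) :=
      (tendsto_pow_atTop_nhds_zero_of_lt_one (by norm_num) (by norm_num)).const_mul _
    rw [mul_zero] at hlim
    refine squeeze_zero (fun _ => norm_nonneg _) (fun n => ?_) hlim
    obtain ⟨A, hA⟩ := (key n).2.1
    have := hhalf f (S n) (max (2 * C) A) hfm (key n).1 (up (le_max_left _ _) hfb)
      (up (le_max_right _ _) hA) _ (hfd n) i
    rw [hS1, norm_sub_rev]
    refine this.trans (le_of_eq ?_)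
    rw [one_div, inv_pow]
    ring
  exact tendsto_nhds_unique h1 ((tendsto_add_atTop_iff_nat 1).2 (hf i))

end Contraction

/-! ### Exponential weights -/

/-- Convolving a square-integrable function with a steep exponential gives a small factor. -/
lemma exists_exp_weight {a : ℝ → ℝ} (ha : StronglyMeasurable a)
    (ha2 : Integrable fun x => a x ^ 2) {ε : ℝ} (hε : 0 < ε) :
    ∃ μ : ℝ, 0 < μ ∧ ∀ y t : ℝ,
      IntegrableOn (fun u => |a (y + u)| * Real.exp (μ * u)) (Iic t) ∧
      ∫ u in Iic t, |a (y + u)| * Real.exp (μ * u) ≤ ε * Real.exp (μ * t) := by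
  set A := ∫ x, a x ^ 2 with hA
  have hA0 : 0 ≤ A := integral_nonneg fun x => sq_nonneg _
  -- Young's inequality with parameter `δ` will bound the integral by `exp(μt) (δA/2 + 1/(4δμ))`.
  -- With this `δ` the first term is at most `ε/2`, and `μ = 1/(2δε)` makes the second equal to
  -- `ε/2`; `A + 1` covers `A = 0`.
  set δ := ε / (A + 1) with hδ
  have hδ0 : 0 < δ := by positivity
  refine ⟨1 / (2 * δ * ε), by positivity, fun y t => ?_⟩
  set μ := 1 / (2 * δ * ε) with hμ
  have hμ0 : 0 < μ := by positivity
  set g : ℝ → ℝ := fun u => Real.exp (μ * t) * (δ / 2) * a (y + u) ^ 2 +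
    Real.exp (-(μ * t)) / (2 * δ) * Real.exp (2 * μ * u) with hg
  have hle : ∀ u, |a (y + u)| * Real.exp (μ * u) ≤ g u := fun u => by
    have e1 : Real.exp (2 * μ * u) = Real.exp (μ * u) ^ 2 := by
      rw [← Real.exp_nat_mul]; congr 1; push_cast; ring
    have e2 : Real.exp (μ * t) * Real.exp (-(μ * t)) = 1 := by
      rw [← Real.exp_add]; simp
    have hp := Real.exp_pos (μ * t)
    have hm := Real.exp_pos (-(μ * t))
    have key := sq_nonneg (Real.exp (μ * t) * δ * |a (y + u)| - Real.exp (μ * u))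
    have e3 : g u = Real.exp (-(μ * t)) / (2 * δ) *
        ((Real.exp (μ * t) * δ * |a (y + u)|) ^ 2 + Real.exp (μ * u) ^ 2) := by
      simp only [hg, e1, mul_pow, sq_abs, mul_add]
      field_simp
      linear_combination (-(δ ^ 2 * Real.exp (μ * t) * a (y + u) ^ 2)) * e2
    have e4 : |a (y + u)| * Real.exp (μ * u) = Real.exp (-(μ * t)) / (2 * δ) *
        (2 * (Real.exp (μ * t) * δ * |a (y + u)|) * Real.exp (μ * u)) := by
      field_simp
      linear_combination (-(|a (y + u)|)) * e2
    rw [e3, e4]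
    refine mul_le_mul_of_nonneg_left ?_ (by positivity)
    nlinarith [key]
  have hi1 : Integrable (fun u => Real.exp (μ * t) * (δ / 2) * a (y + u) ^ 2) :=
    (ha2.comp_add_left y).const_mul _
  have hi2 : IntegrableOn (fun u => Real.exp (-(μ * t)) / (2 * δ) * Real.exp (2 * μ * u))
      (Iic t) := (integrableOn_exp_mul_Iic (by positivity) t).const_mul _
  have hgi : IntegrableOn g (Iic t) := hi1.integrableOn.add hi2
  have hint : IntegrableOn (fun u => |a (y + u)| * Real.exp (μ * u)) (Iic t) := by
    refine Integrable.mono' hgi ?_ (Eventually.of_forall fun u => ?_)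
    · have h1 : StronglyMeasurable fun u => a (y + u) := ha.comp_measurable (by fun_prop)
      exact (h1.norm.mul (by fun_prop : Measurable fun u =>
        Real.exp (μ * u)).stronglyMeasurable).aestronglyMeasurable
    · rw [Real.norm_of_nonneg (by positivity)]
      exact hle u
  refine ⟨hint, (setIntegral_mono hint hgi hle).trans ?_⟩
  rw [hg, integral_add hi1.integrableOn hi2, integral_const_mul, integral_const_mul,
    integral_exp_mul_Iic (by positivity)]
  -- Translation invariance removes the shift, so one `μ` serves all `y`, that is, all
  -- characteristics.
  have h1 : ∫ u in Iic t, a (y + u) ^ 2 ≤ A := by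
    refine (setIntegral_le_integral (ha2.comp_add_left y)
      (Eventually.of_forall fun u => sq_nonneg _)).trans (le_of_eq ?_)
    exact integral_add_left_eq_self (fun x => a x ^ 2) y
  have e1 : Real.exp (2 * μ * t) = Real.exp (μ * t) ^ 2 := by
    rw [← Real.exp_nat_mul]; congr 1; push_cast; ring
  have e2 : Real.exp (-(μ * t)) * Real.exp (μ * t) = 1 := by
    rw [← Real.exp_add]; simp
  have hp := Real.exp_pos (μ * t)
  have h2 : Real.exp (-(μ * t)) / (2 * δ) * (Real.exp (2 * μ * t) / (2 * μ)) =
      ε / 2 * Real.exp (μ * t) := by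
    have : Real.exp (-(μ * t)) / (2 * δ) * (Real.exp (2 * μ * t) / (2 * μ)) =
      1 / (4 * δ * μ) * Real.exp (μ * t) * (Real.exp (-(μ * t)) * Real.exp (μ * t)) := by
      rw [e1]; field_simp; ring
    rw [this, e2, hμ]; field_simp; ring
  rw [h2]
  have h3 : Real.exp (μ * t) * (δ / 2) * ∫ u in Iic t, a (y + u) ^ 2 ≤
      Real.exp (μ * t) * (ε / 2) := by
    rw [mul_assoc]
    refine mul_le_mul_of_nonneg_left ?_ hp.le
    have : δ * A ≤ ε := by
      rw [hδ, div_mul_eq_mul_div, div_le_iff₀ (by positivity)]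
      nlinarith
    nlinarith
  linarith

/-! ### Absolutely continuous functions with values in a Banach space -/

-- Absolute continuity only concerns sums of increments, so dominated increments suffice. This
-- reduces vector-valued questions to real functions.
open AbsolutelyContinuousOnInterval in
lemma absolutelyContinuousOnInterval_of_dist_le {E F : Type*} [PseudoMetricSpace E]
    [PseudoMetricSpace F] {a b : ℝ} {f : ℝ → E} {g : ℝ → F} {C : ℝ}
    (hg : AbsolutelyContinuousOnInterval g a b)
    (h : ∀ x ∈ uIcc a b, ∀ y ∈ uIcc a b, dist (f x) (f y) ≤ C * dist (g x) (g y)) :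
    AbsolutelyContinuousOnInterval f a b := by
  unfold AbsolutelyContinuousOnInterval at hg ⊢
  refine squeeze_zero' (Eventually.of_forall fun _ => Finset.sum_nonneg fun i _ => dist_nonneg)
    ?_ (by simpa using hg.const_mul C)
  rw [eventually_inf_principal]
  filter_upwards with E hE
  rw [Finset.mul_sum]
  exact Finset.sum_le_sum fun i hi => h _ (hE.1 i hi).1 _ (hE.1 i hi).2

section Absolute

variable {E F G : Type*} [NormedAddCommGroup E] [NormedSpace ℝ E] [NormedAddCommGroup F]
  [NormedSpace ℝ F] [NormedAddCommGroup G] [NormedSpace ℝ G] {a b : ℝ}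

-- The increment of a product splits into two, each with one factor bounded by its maximum on the
-- interval.
open AbsolutelyContinuousOnInterval in
lemma absolutelyContinuousOnInterval_bilin (B : E →L[ℝ] F →L[ℝ] G) {f : ℝ → E} {g : ℝ → F}
    (hf : AbsolutelyContinuousOnInterval f a b) (hg : AbsolutelyContinuousOnInterval g a b) :
    AbsolutelyContinuousOnInterval (fun x => B (f x) (g x)) a b := by
  obtain ⟨C, hC⟩ := hf.exists_bound
  obtain ⟨D, hD⟩ := hg.exists_bound
  unfold AbsolutelyContinuousOnInterval at hf hg ⊢
  refine squeeze_zero' (Eventually.of_forall fun _ => Finset.sum_nonneg fun i _ => dist_nonneg)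
    ?_ (by simpa using (hg.const_mul (‖B‖ * C)).add (hf.const_mul (‖B‖ * D)))
  rw [eventually_inf_principal]
  filter_upwards with E hE
  rw [Finset.mul_sum, Finset.mul_sum, ← Finset.sum_add_distrib]
  refine Finset.sum_le_sum fun i hi => ?_
  obtain ⟨h1, h2⟩ := hE.1 i hi
  refine (dist_triangle _ (B (f (E.2 i).1) (g (E.2 i).2)) _).trans (add_le_add ?_ ?_)
  · rw [dist_eq_norm, dist_eq_norm, ← map_sub]
    refine (B.le_opNorm₂ _ _).trans ?_
    gcongr
    exact hC _ h1
  · rw [dist_eq_norm, dist_eq_norm, ← sub_apply, ← map_sub]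
    refine (B.le_opNorm₂ _ _).trans (le_of_eq_of_le (mul_right_comm _ _ _) ?_)
    gcongr
    exact hD _ h2

/-- The increments are dominated by those of the real primitive of `‖f‖`. -/
lemma absolutelyContinuousOnInterval_primitive {f : ℝ → E}
    (h : IntervalIntegrable f volume a b) :
    AbsolutelyContinuousOnInterval (fun x => ∫ v in a..x, f v) a b := by
  have h1 := h.norm.absolutelyContinuousOnInterval_intervalIntegral (c := a) (by simp)
  refine absolutelyContinuousOnInterval_of_dist_le (C := 1) h1 fun x hx y hy => ?_
  have hax : IntervalIntegrable f volume a x := h.mono_set (uIcc_subset_uIcc_left hx)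
  have hay : IntervalIntegrable f volume a y := h.mono_set (uIcc_subset_uIcc_left hy)
  rw [dist_eq_norm, one_mul, Real.dist_eq, intervalIntegral.integral_interval_sub_left hax hay,
    intervalIntegral.integral_interval_sub_left hax.norm hay.norm]
  exact intervalIntegral.norm_integral_le_abs_integral_norm

/-- `X` is on `[0,T]` a primitive of the integrable function `X'`. -/
structure IsPrimitive (T : ℝ) (X X' : ℝ → E) : Prop where
  integrableOn : IntegrableOn X' (Ioc 0 T)
  eq : ∀ x ∈ Icc 0 T, X x = X 0 + ∫ t in (0 : ℝ)..x, X' t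

namespace IsPrimitive

variable {T : ℝ} {X X' : ℝ → E} {Y Y' : ℝ → F}

lemma intervalIntegrable (h : IsPrimitive T X X') (hT : 0 ≤ T) :
    IntervalIntegrable X' volume 0 T :=
  (intervalIntegrable_iff_integrableOn_Ioc_of_le hT).2 h.integrableOn

lemma absolutelyContinuous (h : IsPrimitive T X X') (hT : 0 ≤ T) :
    AbsolutelyContinuousOnInterval X 0 T := by
  refine absolutelyContinuousOnInterval_of_dist_le (C := 1)
    (absolutelyContinuousOnInterval_primitive (h.intervalIntegrable hT)) fun x hx y hy => ?_
  rw [uIcc_of_le hT] at hx hy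
  rw [h.eq x hx, h.eq y hy, dist_add_left, one_mul]

lemma continuousOn (h : IsPrimitive T X X') (hT : 0 ≤ T) : ContinuousOn X (Icc 0 T) := by
  simpa [uIcc_of_le hT] using (h.absolutelyContinuous hT).continuousOn

lemma hasDerivAt [CompleteSpace E] (h : IsPrimitive T X X') (hT : 0 ≤ T) :
    ∀ᵐ x, x ∈ Ioo 0 T → HasDerivAt X (X' x) x := by
  filter_upwards [(h.intervalIntegrable hT).ae_hasDerivAt_integral] with x hx hx0
  have hxT : x ∈ uIcc 0 T := by
    rw [uIcc_of_le hT]; exact Ioo_subset_Icc_self hx0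
  refine ((hx hxT 0 (by simp)).const_add (X 0)).congr_of_eventuallyEq ?_
  filter_upwards [Ioo_mem_nhds hx0.1 hx0.2] with y hy
  exact h.eq y (Ioo_subset_Icc_self hy)

/-- Subtracting the primitive of `X'` leaves an absolutely continuous function with derivative zero
almost everywhere, hence a constant. The end points, where nothing is assumed about the derivative,
form a null set. -/
lemma of_absolutelyContinuous [CompleteSpace E] (hT : 0 ≤ T)
    (hX : AbsolutelyContinuousOnInterval X 0 T) (hX' : IntegrableOn X' (Ioc 0 T))
    (hd : ∀ᵐ x, x ∈ Ioo 0 T → HasDerivAt X (X' x) x) : IsPrimitive T X X' := by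
  refine ⟨hX', fun x hx => ?_⟩
  have hii : IntervalIntegrable X' volume 0 T :=
    (intervalIntegrable_iff_integrableOn_Ioc_of_le hT).2 hX'
  have hne : ∀ c : ℝ, ∀ᵐ x : ℝ, x ≠ c := fun c => by simp [ae_iff, measure_singleton]
  obtain ⟨C, hC⟩ := (hX.fun_sub (absolutelyContinuousOnInterval_primitive hii)).const_of_ae_hasDerivAt_zero
    (by
      filter_upwards [hd, hii.ae_hasDerivAt_integral, hne 0, hne T] with y h1 h2 h3 h4 hy
      have hy' := hy
      rw [uIcc_of_le hT] at hy'
      have := (h1 ⟨lt_of_le_of_ne hy'.1 (Ne.symm h3), lt_of_le_of_ne hy'.2 h4⟩).sub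
        (h2 hy 0 (by simp))
      rw [sub_self] at this
      exact this)
  rw [uIcc_of_le hT] at hC
  have e0 := hC 0 ⟨le_rfl, hT⟩
  have ex := hC x hx
  rw [intervalIntegral.integral_same, sub_zero] at e0
  rw [e0, ← ex, sub_add_cancel]

lemma of_continuousOn_bilin_integrable (B : E →L[ℝ] F →L[ℝ] G) {f : ℝ → E} {g : ℝ → F}
    (hf : ContinuousOn f (Icc 0 T)) (hg : IntegrableOn g (Ioc 0 T)) :
    IntegrableOn (fun x => B (f x) (g x)) (Ioc 0 T) := by
  obtain ⟨C, hC⟩ := isCompact_Icc.exists_bound_of_continuousOn hf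
  refine Integrable.mono' (hg.norm.const_mul (‖B‖ * C)) ?_
    ((ae_restrict_iff' measurableSet_Ioc).2 (Eventually.of_forall fun x hx => ?_))
  · exact B.aestronglyMeasurable_comp₂
      ((hf.mono Ioc_subset_Icc_self).aestronglyMeasurable measurableSet_Ioc) hg.1
  · refine (B.le_opNorm₂ _ _).trans ?_
    gcongr
    exact hC x (Ioc_subset_Icc_self hx)

/-- The product rule for primitives: the product is absolutely continuous and the pointwise rule
holds almost everywhere. Compositions and applications of operators are instances. -/
lemma bilin [CompleteSpace E] [CompleteSpace F] [CompleteSpace G] (B : E →L[ℝ] F →L[ℝ] G)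
    (hT : 0 ≤ T) (hX : IsPrimitive T X X') (hY : IsPrimitive T Y Y') :
    IsPrimitive T (fun x => B (X x) (Y x)) (fun x => B (X' x) (Y x) + B (X x) (Y' x)) := by
  refine of_absolutelyContinuous hT
    (absolutelyContinuousOnInterval_bilin B (hX.absolutelyContinuous hT)
      (hY.absolutelyContinuous hT)) (Integrable.add ?_ ?_) ?_
  · exact of_continuousOn_bilin_integrable B.flip (hY.continuousOn hT) hX.integrableOn
  · exact of_continuousOn_bilin_integrable B (hX.continuousOn hT) hY.integrableOn
  · filter_upwards [hX.hasDerivAt hT, hY.hasDerivAt hT] with x h1 h2 hx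
    have := B.hasDerivAt_of_bilinear (fun _ => h1 hx) (fun _ => h2 hx)
    rwa [add_comm]

lemma congr (hX : IsPrimitive T X X') {Z Z' : ℝ → E} (h : ∀ x ∈ Icc 0 T, Z x = X x)
    (h' : ∀ x ∈ Ioc 0 T, Z' x = X' x) : IsPrimitive T Z Z' := by
  refine ⟨hX.integrableOn.congr_fun (fun x hx => (h' x hx).symm) measurableSet_Ioc,
    fun x hx => ?_⟩
  rw [h x hx, h 0 ⟨le_rfl, hx.1.trans hx.2⟩, hX.eq x hx]
  congr 1
  refine intervalIntegral.integral_congr_ae (Eventually.of_forall fun t ht => ?_)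
  rw [uIoc_of_le hx.1] at ht
  exact (h' t ⟨ht.1, ht.2.trans hx.2⟩).symm

lemma clm [CompleteSpace E] [CompleteSpace F] (L : E →L[ℝ] F) (hX : IsPrimitive T X X') :
    IsPrimitive T (fun x => L (X x)) (fun x => L (X' x)) := by
  refine ⟨L.integrable_comp hX.integrableOn, fun x hx => ?_⟩
  rw [hX.eq x hx, map_add, L.intervalIntegral_comp_comm]
  rw [intervalIntegrable_iff_integrableOn_Ioc_of_le hx.1]
  exact hX.integrableOn.mono_set (Ioc_subset_Ioc_right hx.2)

lemma intervalIntegrable_left (hX : IsPrimitive T X X') {x : ℝ} (hx : x ∈ Icc 0 T) :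
    IntervalIntegrable X' volume 0 x := by
  rw [intervalIntegrable_iff_integrableOn_Ioc_of_le hx.1]
  exact hX.integrableOn.mono_set (Ioc_subset_Ioc_right hx.2)

lemma sub {Z Z' : ℝ → E} (hX : IsPrimitive T X X') (hZ : IsPrimitive T Z Z') :
    IsPrimitive T (fun x => X x - Z x) (fun x => X' x - Z' x) := by
  refine ⟨hX.integrableOn.sub hZ.integrableOn, fun x hx => ?_⟩
  rw [hX.eq x hx, hZ.eq x hx, intervalIntegral.integral_sub (hX.intervalIntegrable_left hx)
    (hZ.intervalIntegrable_left hx)]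
  abel

lemma of_integrableOn (c : E) (h : IntegrableOn X' (Ioc 0 T)) :
    IsPrimitive T (fun x => c + ∫ t in (0 : ℝ)..x, X' t) X' :=
  ⟨h, fun x _ => by simp⟩

lemma eq_const (hX : IsPrimitive T X X') (h : ∀ x ∈ Ioc 0 T, X' x = 0) :
    ∀ x ∈ Icc 0 T, X x = X 0 := by
  intro x hx
  rw [hX.eq x hx, intervalIntegral.integral_of_le hx.1,
    setIntegral_congr_fun measurableSet_Ioc (g := fun _ => 0)
      (fun t ht => h t ⟨ht.1, ht.2.trans hx.2⟩)]
  simp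

end IsPrimitive

end Absolute

/-! ### Integrability of square-summable functions and measurability of integrals over moving sets
-/

lemma integrableOn_Ioc_of_sq {E : Type*} [NormedAddCommGroup E] {f : ℝ → E}
    (hf : StronglyMeasurable f) (hf2 : Integrable fun x => ‖f x‖ ^ 2) (a b : ℝ) :
    IntegrableOn f (Ioc a b) := by
  refine Integrable.mono' (g := fun x => 1 + ‖f x‖ ^ 2)
    (Integrable.add (integrable_const 1) hf2.integrableOn) hf.aestronglyMeasurable
    (Eventually.of_forall fun x => ?_)
  nlinarith [sq_nonneg (‖f x‖ - 1)]

/-- An indicator on the product space absorbs the moving domain of integration, leaving an ordinary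
parameter integral. -/
lemma stronglyMeasurable_setIntegral_section {α E : Type*} [MeasurableSpace α]
    [NormedAddCommGroup E] [NormedSpace ℝ E] {f : α → ℝ → E}
    (hf : StronglyMeasurable (Function.uncurry f)) {S : Set (α × ℝ)} (hS : MeasurableSet S) :
    StronglyMeasurable fun x => ∫ s in {s | (x, s) ∈ S}, f x s := by
  have h : ∀ x, ∫ s in {s | (x, s) ∈ S}, f x s =
      ∫ s, S.indicator (Function.uncurry f) (x, s) := fun x => by
    have hx : MeasurableSet {s | (x, s) ∈ S} := measurable_prodMk_left hS
    rw [← integral_indicator hx]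
    rfl
  simp_rw [h]
  exact StronglyMeasurable.integral_prod_right (f := fun x s =>
    S.indicator (Function.uncurry f) (x, s)) (hf.indicator hS)

lemma stronglyMeasurable_setIntegral_Ioc {E : Type*} [NormedAddCommGroup E] [NormedSpace ℝ E]
    {f : ℝ → E} (hf : StronglyMeasurable f) :
    StronglyMeasurable fun x => ∫ s in Ioc 0 x, f s :=
  stronglyMeasurable_setIntegral_section (f := fun _ s => f s)
    (hf.comp_measurable measurable_snd) (S := {p : ℝ × ℝ | p.2 ∈ Ioc 0 p.1})
    ((measurableSet_lt measurable_const measurable_snd).inter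
      (measurableSet_le measurable_snd measurable_fst))

lemma IsPrimitive.of_setIntegral {E : Type*} [NormedAddCommGroup E] [NormedSpace ℝ E]
    {X X' : ℝ → E} {T : ℝ} (h : IntegrableOn X' (Ioc 0 T)) {c : E}
    (hX : ∀ x, X x = c + ∫ s in Ioc 0 x, X' s) : IsPrimitive T X X' := by
  refine ⟨h, fun x hx => ?_⟩
  rw [hX x, hX 0, intervalIntegral.integral_of_le hx.1]
  simp

/-! ### Linear differential equations with square-integrable coefficients -/

section Linear

variable {E : Type*} [NormedAddCommGroup E] [NormedSpace ℝ E] [CompleteSpace E]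

/-- Picard iteration with an exponential weight: a square-integrable coefficient is enough for a
contraction on the whole line, without subdividing intervals. -/
lemma exists_linear_integral_equation {M : ℝ → E →L[ℝ] E} (hM : StronglyMeasurable M)
    (hM2 : Integrable fun x => ‖M x‖ ^ 2) (c : E) :
    ∃ X : ℝ → E, StronglyMeasurable X ∧
      (∀ T, IntegrableOn (fun s => M s (X s)) (Ioc 0 T)) ∧
      ∀ x, X x = c + ∫ s in Ioc 0 x, M s (X s) := by
  obtain ⟨μ, hμ, hw⟩ := exists_exp_weight hM.norm hM2 (ε := 1 / 2) (by norm_num)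
  -- The weight stays equal to one on the negative axis: there the iterates equal `c`, which a
  -- decaying exponential would not dominate.
  set w : ℝ → ℝ := fun x => Real.exp (μ * max x 0) with hwdef
  have hmeas : ∀ f : ℝ → E, StronglyMeasurable f → StronglyMeasurable fun s => M s (f s) :=
    fun f hf => isBoundedBilinearMap_apply.continuous.comp_stronglyMeasurable (hM.prodMk hf)
  have hint : ∀ (f : ℝ → E) (C : ℝ), StronglyMeasurable f → (∀ i, ‖f i‖ ≤ C * w i) → ∀ x,
      IntegrableOn (fun s => M s (f s)) (Ioc 0 x) := fun f C hf hC x => by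
    have h1 := ((hw 0 x).1.mono_set (Ioc_subset_Iic_self (a := 0))).const_mul C
    refine Integrable.mono' h1 (hmeas f hf).aestronglyMeasurable
      ((ae_restrict_iff' measurableSet_Ioc).2 (Eventually.of_forall fun s hs => ?_))
    refine ((M s).le_opNorm _).trans ?_
    have := hC s
    simp only [hwdef, max_eq_left hs.1.le] at this
    rw [zero_add, abs_norm, mul_left_comm]
    exact mul_le_mul_of_nonneg_left this (norm_nonneg _)
  obtain ⟨X, hX, ⟨C, hC⟩, hfix⟩ := exists_fixedPoint_of_halving (E := E) (w := w)
    (Ψ := fun f x => c + ∫ s in Ioc 0 x, M s (f s)) (C := ‖c‖)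
    (fun f C hf hC => stronglyMeasurable_const.add
      (stronglyMeasurable_setIntegral_Ioc (hmeas f hf)))
    (fun f g C hf hg hfC hgC D hD x => by
      simp only [add_sub_add_left_eq_sub]
      rw [← integral_sub (hint f C hf hfC x) (hint g C hg hgC x)]
      rcases le_or_gt x 0 with hx | hx
      · simp only [Ioc_eq_empty_of_le hx, Measure.restrict_empty, integral_zero_measure, norm_zero]
        have := (norm_nonneg _).trans (hD x)
        rw [div_mul_eq_mul_div]
        positivity
      have h1 : IntegrableOn (fun s => D * (|‖M (0 + s)‖| * Real.exp (μ * s))) (Iic x) :=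
        (hw 0 x).1.const_mul D
      calc ‖∫ s in Ioc 0 x, (M s (f s) - M s (g s))‖
          ≤ ∫ s in Ioc 0 x, D * (|‖M (0 + s)‖| * Real.exp (μ * s)) := by
            refine norm_integral_le_of_norm_le (h1.mono_set Ioc_subset_Iic_self)
              ((ae_restrict_iff' measurableSet_Ioc).2 (Eventually.of_forall fun s hs => ?_))
            rw [← map_sub]
            refine ((M s).le_opNorm _).trans ?_
            have := hD s
            simp only [hwdef, max_eq_left hs.1.le] at this
            rw [zero_add, abs_norm, mul_left_comm]
            exact mul_le_mul_of_nonneg_left this (norm_nonneg _)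
        _ ≤ ∫ s in Iic x, D * (|‖M (0 + s)‖| * Real.exp (μ * s)) := by
            have hD0 : 0 ≤ D := nonneg_of_mul_nonneg_left ((norm_nonneg _).trans (hD x))
              (Real.exp_pos _)
            exact setIntegral_mono_set h1 (Eventually.of_forall fun s => by
              simp only [Pi.zero_apply]; positivity) Ioc_subset_Iic_self.eventuallyLE
        _ ≤ D / 2 * w x := by
            have hD0 : 0 ≤ D := nonneg_of_mul_nonneg_left ((norm_nonneg _).trans (hD x))
              (Real.exp_pos _)
            rw [integral_const_mul]
            refine (mul_le_mul_of_nonneg_left (hw 0 x).2 hD0).trans (le_of_eq ?_)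
            simp only [hwdef, max_eq_left hx.le]
            ring)
    (fun x => by
      simp only [Pi.zero_apply, map_zero, integral_zero, add_zero]
      exact le_mul_of_one_le_right (norm_nonneg _) (Real.one_le_exp (by positivity)))
    (fun x => (Real.exp_pos _).le)
  exact ⟨X, hX, hint X C hX hC, fun x => (hfix x).symm⟩

end Linear

section FundamentalSolution

variable {𝔸 : Type*} [NormedRing 𝔸] [NormedAlgebra ℝ 𝔸] [CompleteSpace 𝔸]

/-- Fundamental solution of `X' = B X`, `X 0 = 1`, with its inverse. -/
lemma exists_fundamental_solution {B : ℝ → 𝔸} (hB : StronglyMeasurable B)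
    (hB2 : Integrable fun x => ‖B x‖ ^ 2) :
    ∃ X Y : ℝ → 𝔸, StronglyMeasurable X ∧ StronglyMeasurable Y ∧ X 0 = 1 ∧ Y 0 = 1 ∧
      (∀ x, Y x * X x = 1) ∧ (∀ T, IsPrimitive T X fun x => B x * X x) ∧
      ∀ T, IsPrimitive T Y fun x => -(Y x * B x) := by
  have hcont : Continuous fun b : 𝔸 => ContinuousLinearMap.mul ℝ 𝔸 b :=
    (ContinuousLinearMap.mul ℝ 𝔸).continuous
  -- Right multiplication by `-b`, the coefficient of the adjoint equation `Y' = -YB` for the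
  -- inverse.
  have hcont' : Continuous fun b : 𝔸 => -(ContinuousLinearMap.mul ℝ 𝔸).flip b :=
    (ContinuousLinearMap.mul ℝ 𝔸).flip.continuous.neg
  have hsq : ∀ {M : ℝ → 𝔸 →L[ℝ] 𝔸}, StronglyMeasurable M → (∀ x, ‖M x‖ ≤ ‖B x‖) →
      Integrable fun x => ‖M x‖ ^ 2 := fun hM h => by
    refine hB2.mono' (hM.norm.pow 2).aestronglyMeasurable (Eventually.of_forall fun x => ?_)
    rw [Real.norm_of_nonneg (by positivity)]
    exact pow_le_pow_left₀ (norm_nonneg _) (h x) 2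
  have hm1 := hcont.comp_stronglyMeasurable hB
  have hm2 := hcont'.comp_stronglyMeasurable hB
  obtain ⟨X, hX, hXi, hXe⟩ := exists_linear_integral_equation hm1
    (hsq hm1 fun x => ContinuousLinearMap.opNorm_mul_apply_le ℝ 𝔸 _) 1
  obtain ⟨Y, hY, hYi, hYe⟩ := exists_linear_integral_equation hm2
    (hsq hm2 fun x => by
      refine ContinuousLinearMap.opNorm_le_bound _ (norm_nonneg _) fun v => ?_
      simpa [mul_comm] using norm_mul_le v (B x)) 1
  have hX0 : X 0 = 1 := by rw [hXe]; simp
  have hY0 : Y 0 = 1 := by rw [hYe]; simp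
  have hXp : ∀ T, IsPrimitive T X fun x => B x * X x := fun T =>
    IsPrimitive.of_setIntegral (hXi T) hXe
  have hYp : ∀ T, IsPrimitive T Y fun x => -(Y x * B x) := fun T =>
    IsPrimitive.of_setIntegral (hYi T) hYe
  refine ⟨X, Y, hX, hY, hX0, hY0, fun x => ?_, hXp, hYp⟩
  rcases le_or_gt x 0 with hx | hx
  · rw [hXe, hYe]; simp [Ioc_eq_empty_of_le hx]
  -- The derivative of `YX` is `-YBX + YBX = 0`.
  have h := (hYp x).bilin (ContinuousLinearMap.mul ℝ 𝔸) hx.le (hXp x)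
  have := h.eq_const (fun s _ => by simp [mul_assoc]) x ⟨hx.le, le_rfl⟩
  simpa [hX0, hY0] using this

end FundamentalSolution

/-! ### Product rules for operator-valued functions -/

section Composition

variable {U V W : Type*} [NormedAddCommGroup U] [NormedSpace ℂ U] [NormedAddCommGroup V]
  [NormedSpace ℂ V] [CompleteSpace V] [NormedAddCommGroup W] [NormedSpace ℂ W] [CompleteSpace W]
  {T : ℝ}

lemma IsPrimitive.comp {X X' : ℝ → W →L[ℂ] V} {Y Y' : ℝ → U →L[ℂ] W} (hT : 0 ≤ T)
    (hX : IsPrimitive T X X') (hY : IsPrimitive T Y Y') :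
    IsPrimitive T (fun x => X x ∘L Y x) (fun x => X' x ∘L Y x + X x ∘L Y' x) :=
  hX.bilin ((ContinuousLinearMap.compL ℂ U W V).bilinearRestrictScalars ℝ) hT hY

lemma IsPrimitive.apply {X X' : ℝ → W →L[ℂ] V} {y y' : ℝ → W} (hT : 0 ≤ T)
    (hX : IsPrimitive T X X') (hy : IsPrimitive T y y') :
    IsPrimitive T (fun x => X x (y x)) (fun x => X' x (y x) + X x (y' x)) :=
  hX.bilin ((ContinuousLinearMap.id ℂ (W →L[ℂ] V)).bilinearRestrictScalars ℝ) hT hy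

end Composition

/-! ### The transmutation kernel -/

section Kernel

variable {V W : Type*} [NormedAddCommGroup V] [NormedSpace ℂ V]
  [NormedAddCommGroup W] [NormedSpace ℂ W]

lemma stronglyMeasurable_comp {X U V W : Type*} [MeasurableSpace X] [NormedAddCommGroup U]
    [NormedSpace ℂ U] [NormedAddCommGroup V] [NormedSpace ℂ V] [NormedAddCommGroup W]
    [NormedSpace ℂ W] {f : X → V →L[ℂ] W} {g : X → U →L[ℂ] V}
    (hf : StronglyMeasurable f) (hg : StronglyMeasurable g) :
    StronglyMeasurable fun x => f x ∘L g x :=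
  (isBoundedBilinearMap_comp (𝕜 := ℂ) (E := U) (F := V) (G := W)).continuous.comp_stronglyMeasurable
    (hf.prodMk hg)

lemma stronglyMeasurable_apply {X : Type*} [MeasurableSpace X] {f : X → V →L[ℂ] W} {g : X → V}
    (hf : StronglyMeasurable f) (hg : StronglyMeasurable g) :
    StronglyMeasurable fun x => f x (g x) :=
  (isBoundedBilinearMap_apply (𝕜 := ℂ) (E := V) (F := W)).continuous.comp_stronglyMeasurable
    (hf.prodMk hg)

/-- The value of `∂ₓN + ∂ₜN` at a point, for the transmutation kernel `N`. -/
noncomputable def kernelDeriv (α : ℝ → W →L[ℂ] V) (γ : ℝ → V →L[ℂ] W) (N : ℝ × ℝ → V →L[ℂ] V)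
    (q : ℝ × ℝ) : V →L[ℂ] V :=
  {q : ℝ × ℝ | 0 < q.2 ∧ q.2 ≤ q.1}.indicator
    (fun q => -(α q.1 ∘L (γ q.2 + ∫ s in Ioc q.2 q.1, γ s ∘L N (s, q.2)))) q

/-- Integration along the characteristics `x - t = const`. -/
noncomputable def charIntegral (L : ℝ × ℝ → V →L[ℂ] V) (q : ℝ × ℝ) : V →L[ℂ] V :=
  ∫ u in Iic q.2, L (q.1 - q.2 + u, u)

variable {α : ℝ → W →L[ℂ] V} {γ : ℝ → V →L[ℂ] W} {N : ℝ × ℝ → V →L[ℂ] V}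

lemma measurableSet_triangle : MeasurableSet {q : ℝ × ℝ | 0 < q.2 ∧ q.2 ≤ q.1} :=
  (measurableSet_lt measurable_const measurable_snd).inter
    (measurableSet_le measurable_snd measurable_fst)

lemma stronglyMeasurable_kernelDeriv (hα : StronglyMeasurable α) (hγ : StronglyMeasurable γ)
    (hN : StronglyMeasurable N) : StronglyMeasurable (kernelDeriv α γ N) := by
  refine StronglyMeasurable.indicator ?_ measurableSet_triangle
  refine (stronglyMeasurable_comp (hα.comp_measurable measurable_fst)
    ((hγ.comp_measurable measurable_snd).add ?_)).neg
  refine stronglyMeasurable_setIntegral_section (f := fun (q : ℝ × ℝ) s => γ s ∘L N (s, q.2)) ?_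
    (S := {p : (ℝ × ℝ) × ℝ | p.2 ∈ Ioc p.1.2 p.1.1})
    ((measurableSet_lt (measurable_snd.comp measurable_fst) measurable_snd).inter
      (measurableSet_le measurable_snd (measurable_fst.comp measurable_fst)))
  exact stronglyMeasurable_comp (hγ.comp_measurable measurable_snd)
    (hN.comp_measurable (by fun_prop : Measurable fun p : (ℝ × ℝ) × ℝ => (p.2, p.1.2)))

lemma stronglyMeasurable_charIntegral {L : ℝ × ℝ → V →L[ℂ] V} (hL : StronglyMeasurable L) :
    StronglyMeasurable (charIntegral L) :=
  stronglyMeasurable_setIntegral_section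
    (f := fun (q : ℝ × ℝ) u => L (q.1 - q.2 + u, u))
    (hL.comp_measurable
      (by fun_prop : Measurable fun p : (ℝ × ℝ) × ℝ => (p.1.1 - p.1.2 + p.2, p.2)))
    (S := {p : (ℝ × ℝ) × ℝ | p.2 ≤ p.1.2}) (measurableSet_le (by fun_prop) (by fun_prop))

/-- Moving down a characteristic keeps `x - t` and lowers `t`, so a characteristic segment ending
off the triangle never meets it. Hence the kernel inherits the support of its directional
derivative. -/
lemma charIntegral_eq_zero {L : ℝ × ℝ → V →L[ℂ] V}
    (hL : ∀ q, ¬(0 < q.2 ∧ q.2 ≤ q.1) → L q = 0) {q : ℝ × ℝ} (hq : ¬(0 < q.2 ∧ q.2 ≤ q.1)) :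
    charIntegral L q = 0 := by
  unfold charIntegral
  rw [setIntegral_congr_fun (g := fun _ => 0) measurableSet_Iic (fun u hu => hL _ fun h => hq ?_)]
  · simp
  · have : u ≤ q.2 := hu
    simp only at h
    exact ⟨by linarith [h.1], by linarith [h.2]⟩

lemma kernelDeriv_eq_zero {q : ℝ × ℝ} (hq : ¬(0 < q.2 ∧ q.2 ≤ q.1)) :
    kernelDeriv α γ N q = 0 :=
  indicator_of_notMem (s := {q : ℝ × ℝ | 0 < q.2 ∧ q.2 ≤ q.1}) hq _

lemma integrable_of_sq_of_support {E : Type*} [NormedAddCommGroup E] {f : ℝ → E} {T : ℝ}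
    (hf : StronglyMeasurable f) (hf2 : Integrable fun x => ‖f x‖ ^ 2)
    (h0 : ∀ x ∉ Ioc 0 T, f x = 0) : Integrable f := by
  have := (integrableOn_Ioc_of_sq hf hf2 0 T).integrable_indicator measurableSet_Ioc
  rwa [indicator_eq_self.2 fun x hx => by_contra fun h => hx (h0 x h)] at this

lemma integrable_comp_bounded_left (hγ : Integrable γ) {s : Set ℝ} {M : ℝ → V →L[ℂ] V}
    (hM : StronglyMeasurable M) {C : ℝ} (hC : ∀ x, ‖M x‖ ≤ C) :
    IntegrableOn (fun x => γ x ∘L M x) s := by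
  refine Integrable.mono' (hγ.norm.mul_const C).integrableOn ?_ (Eventually.of_forall fun x => ?_)
  · exact ((isBoundedBilinearMap_comp (𝕜 := ℂ)).continuous.comp_aestronglyMeasurable
      (hγ.1.restrict.prodMk hM.aestronglyMeasurable))
  · exact (ContinuousLinearMap.opNorm_comp_le _ _).trans
      (mul_le_mul_of_nonneg_left (hC x) (norm_nonneg _))

/-- The inner integral runs over the first argument of `N` with `t` fixed. A weight depending on `t`
alone therefore factors out and only the `L¹` norm of `γ` remains. -/
lemma norm_kernelDeriv_le (hγ : Integrable γ) {w : ℝ → ℝ} (hw : ∀ x, 0 ≤ w x)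
    (hC : ∀ q, ‖N q‖ ≤ w q.2) (q : ℝ × ℝ) :
    ‖kernelDeriv α γ N q‖ ≤ ‖α q.1‖ * (‖γ q.2‖ + (∫ s, ‖γ s‖) * w q.2) := by
  have hI : 0 ≤ ∫ s, ‖γ s‖ := integral_nonneg fun _ => norm_nonneg _
  refine (norm_indicator_le_norm_self _ _).trans ?_
  rw [norm_neg]
  refine (ContinuousLinearMap.opNorm_comp_le _ _).trans ?_
  refine mul_le_mul_of_nonneg_left ((norm_add_le _ _).trans ?_) (norm_nonneg _)
  gcongr
  rw [← integral_mul_const]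
  refine (norm_integral_le_of_norm_le (hγ.norm.mul_const (w q.2)).integrableOn
    (Eventually.of_forall fun s => (ContinuousLinearMap.opNorm_comp_le _ _).trans
      (mul_le_mul_of_nonneg_left (hC (s, q.2)) (norm_nonneg _)))).trans ?_
  exact setIntegral_le_integral (hγ.norm.mul_const (w q.2))
    (Eventually.of_forall fun s => mul_nonneg (norm_nonneg _) (hw _))

/-- The inhomogeneous term `α(x)γ(t)` cancels in the difference. The weight `w` only secures
integrability, while `v` carries the estimate. -/
lemma norm_kernelDeriv_sub_le (hγ : Integrable γ) {N₁ N₂ : ℝ × ℝ → V →L[ℂ] V}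
    (h₁ : StronglyMeasurable N₁) (h₂ : StronglyMeasurable N₂) {w v : ℝ → ℝ}
    (hw₁ : ∀ q, ‖N₁ q‖ ≤ w q.2) (hw₂ : ∀ q, ‖N₂ q‖ ≤ w q.2) (hv : ∀ x, 0 ≤ v x)
    (hd : ∀ q, ‖N₁ q - N₂ q‖ ≤ v q.2) (q : ℝ × ℝ) :
    ‖kernelDeriv α γ N₁ q - kernelDeriv α γ N₂ q‖ ≤ ‖α q.1‖ * ((∫ s, ‖γ s‖) * v q.2) := by
  have hI : 0 ≤ ∫ s, ‖γ s‖ := integral_nonneg fun _ => norm_nonneg _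
  unfold kernelDeriv
  by_cases hq : q ∈ {q : ℝ × ℝ | 0 < q.2 ∧ q.2 ≤ q.1}
  swap
  · rw [indicator_of_notMem hq, indicator_of_notMem hq, sub_self, norm_zero]
    have := hv q.2
    positivity
  rw [indicator_of_mem hq, indicator_of_mem hq]
  have hi : ∀ {M : ℝ × ℝ → V →L[ℂ] V}, StronglyMeasurable M → (∀ q, ‖M q‖ ≤ w q.2) →
      IntegrableOn (fun s => γ s ∘L M (s, q.2)) (Ioc q.2 q.1) := fun hM hb =>
    integrable_comp_bounded_left hγ (C := w q.2) (hM.comp_measurable (by fun_prop)) fun s => hb (s, q.2)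
  have e : -(α q.1 ∘L (γ q.2 + ∫ s in Ioc q.2 q.1, γ s ∘L N₁ (s, q.2))) -
      -(α q.1 ∘L (γ q.2 + ∫ s in Ioc q.2 q.1, γ s ∘L N₂ (s, q.2))) =
      -(α q.1 ∘L ∫ s in Ioc q.2 q.1, γ s ∘L (N₁ (s, q.2) - N₂ (s, q.2))) := by
    simp only [ContinuousLinearMap.comp_sub, integral_sub (hi h₁ hw₁) (hi h₂ hw₂),
      ContinuousLinearMap.comp_add]
    abel
  rw [e, norm_neg]
  refine (ContinuousLinearMap.opNorm_comp_le _ _).trans ?_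
  refine mul_le_mul_of_nonneg_left ?_ (norm_nonneg _)
  rw [← integral_mul_const]
  refine (norm_integral_le_of_norm_le (hγ.norm.mul_const (v q.2)).integrableOn
    (Eventually.of_forall fun s => (ContinuousLinearMap.opNorm_comp_le _ _).trans
      (mul_le_mul_of_nonneg_left (hd (s, q.2)) (norm_nonneg _)))).trans ?_
  exact setIntegral_le_integral (hγ.norm.mul_const (v q.2))
    (Eventually.of_forall fun s => mul_nonneg (norm_nonneg _) (hv _))

/-- The bound does not depend on the characteristic, by translation invariance. It controls the
inhomogeneous term of the kernel equation and is where square-summability of both factors yields a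
bounded kernel. -/
lemma integrable_norm_mul_norm_of_sq (hα : StronglyMeasurable α)
    (hα2 : Integrable fun x => ‖α x‖ ^ 2) (hγ : StronglyMeasurable γ)
    (hγ2 : Integrable fun x => ‖γ x‖ ^ 2) (y : ℝ) :
    Integrable (fun u => ‖α (y + u)‖ * ‖γ u‖) ∧
      ∫ u, ‖α (y + u)‖ * ‖γ u‖ ≤ (∫ x, ‖α x‖ ^ 2) + ∫ x, ‖γ x‖ ^ 2 := by
  have hg : Integrable fun u => ‖α (y + u)‖ ^ 2 + ‖γ u‖ ^ 2 := (hα2.comp_add_left y).add hγ2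
  have hle : ∀ u, ‖α (y + u)‖ * ‖γ u‖ ≤ ‖α (y + u)‖ ^ 2 + ‖γ u‖ ^ 2 := fun u => by
    nlinarith [sq_nonneg (‖α (y + u)‖ - ‖γ u‖), sq_nonneg ‖α (y + u)‖, sq_nonneg ‖γ u‖]
  have hi : Integrable fun u => ‖α (y + u)‖ * ‖γ u‖ := by
    refine hg.mono' ?_ (Eventually.of_forall fun u => ?_)
    · exact ((hα.comp_measurable (by fun_prop : Measurable fun u => y + u)).norm.mul
        hγ.norm).aestronglyMeasurable
    · rw [Real.norm_of_nonneg (by positivity)]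
      exact hle u
  refine ⟨hi, (integral_mono hi hg hle).trans (le_of_eq ?_)⟩
  rw [integral_add (hα2.comp_add_left y) hγ2,
    integral_add_left_eq_self (fun x => ‖α x‖ ^ 2) y]

variable [CompleteSpace V]

/-- The transmutation kernel: existence, by successive approximations. -/
lemma exists_kernel (hα : StronglyMeasurable α) (hα2 : Integrable fun x => ‖α x‖ ^ 2)
    (hγ : StronglyMeasurable γ) (hγ2 : Integrable fun x => ‖γ x‖ ^ 2) (hγ1 : Integrable γ) :
    ∃ (N : ℝ × ℝ → V →L[ℂ] V) (μ C : ℝ), 0 < μ ∧ 0 ≤ C ∧ StronglyMeasurable N ∧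
      (∀ q, ‖N q‖ ≤ C * Real.exp (μ * q.2)) ∧
      (∀ y t, IntegrableOn (fun u => ‖α (y + u)‖ * Real.exp (μ * u)) (Iic t) ∧
        ∫ u in Iic t, ‖α (y + u)‖ * Real.exp (μ * u) ≤ Real.exp (μ * t)) ∧
      ∀ q, N q = charIntegral (kernelDeriv α γ N) q := by
  set I := ∫ s, ‖γ s‖ with hI
  have hI0 : 0 ≤ I := integral_nonneg fun _ => norm_nonneg _
  -- Chosen so that `I ε ≤ 1/2`, the contraction factor; `I + 1` covers `γ = 0`.
  have hε : 0 < 1 / (2 * (I + 1)) := by positivity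
  obtain ⟨μ, hμ, hw⟩ := exists_exp_weight hα.norm hα2 hε
  simp only [abs_norm] at hw
  have hint : ∀ M : ℝ × ℝ → V →L[ℂ] V, ∀ C, StronglyMeasurable M →
      (∀ q, ‖M q‖ ≤ C * Real.exp (μ * q.2)) → ∀ q : ℝ × ℝ,
      IntegrableOn (fun u => kernelDeriv α γ M (q.1 - q.2 + u, u)) (Iic q.2) := by
    intro M C hM hC q
    have hC0 : 0 ≤ C := nonneg_of_mul_nonneg_left ((norm_nonneg _).trans (hC q)) (Real.exp_pos _)
    have hdom : IntegrableOn (fun u => ‖α (q.1 - q.2 + u)‖ * ‖γ u‖ +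
        I * C * (‖α (q.1 - q.2 + u)‖ * Real.exp (μ * u))) (Iic q.2) :=
      (integrable_norm_mul_norm_of_sq hα hα2 hγ hγ2 _).1.integrableOn.add
        ((hw (q.1 - q.2) q.2).1.const_mul _)
    refine Integrable.mono' hdom ?_ (Eventually.of_forall fun u => ?_)
    · exact ((stronglyMeasurable_kernelDeriv hα hγ hM).comp_measurable
        (by fun_prop : Measurable fun u => (q.1 - q.2 + u, u))).aestronglyMeasurable
    · refine (norm_kernelDeriv_le hγ1 (w := fun t => C * Real.exp (μ * t))
        (fun t => by positivity) hC _).trans (le_of_eq ?_)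
      ring
  obtain ⟨N, hN, ⟨C, hC⟩, hfix⟩ := exists_fixedPoint_of_halving
    (w := fun q : ℝ × ℝ => Real.exp (μ * q.2))
    (Ψ := fun M : ℝ × ℝ → V →L[ℂ] V => charIntegral (kernelDeriv α γ M))
    -- The first iterate is the characteristic integral of `-α(x)γ(t)` over the triangle, where the
    -- weight is at least one.
    (C := (∫ x, ‖α x‖ ^ 2) + ∫ x, ‖γ x‖ ^ 2)
    (fun M C hM hC => stronglyMeasurable_charIntegral (stronglyMeasurable_kernelDeriv hα hγ hM))
    (fun M₁ M₂ C h₁ h₂ hC₁ hC₂ D hD q => by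
      have hD0 : 0 ≤ D := nonneg_of_mul_nonneg_left ((norm_nonneg _).trans (hD q))
        (Real.exp_pos _)
      unfold charIntegral
      rw [← integral_sub (hint M₁ C h₁ hC₁ q) (hint M₂ C h₂ hC₂ q)]
      refine (norm_integral_le_of_norm_le ((hw (q.1 - q.2) q.2).1.const_mul (I * D))
        (Eventually.of_forall fun u => ?_)).trans ?_
      · refine (norm_kernelDeriv_sub_le hγ1 h₁ h₂ (w := fun t => C * Real.exp (μ * t))
          (v := fun t => D * Real.exp (μ * t)) hC₁ hC₂ (fun t => by positivity) hD _).trans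
          (le_of_eq ?_)
        ring
      · rw [integral_const_mul]
        refine (mul_le_mul_of_nonneg_left (hw _ _).2 (by positivity)).trans ?_
        rw [← mul_assoc]
        refine mul_le_mul_of_nonneg_right ?_ (Real.exp_pos _).le
        have : I * (1 / (2 * (I + 1))) ≤ 1 / 2 := by
          rw [mul_one_div, div_le_div_iff₀ (by positivity) (by positivity)]
          linarith
        nlinarith)
    (fun q => by
      by_cases hq : 0 < q.2 ∧ q.2 ≤ q.1
      swap
      · rw [charIntegral_eq_zero (fun _ => kernelDeriv_eq_zero) hq, norm_zero]
        have : 0 ≤ (∫ x, ‖α x‖ ^ 2) + ∫ x, ‖γ x‖ ^ 2 :=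
          add_nonneg (integral_nonneg fun _ => by positivity)
            (integral_nonneg fun _ => by positivity)
        positivity
      obtain ⟨h1, h2⟩ := integrable_norm_mul_norm_of_sq hα hα2 hγ hγ2 (q.1 - q.2)
      have h3 : (∫ u in Iic q.2, ‖α (q.1 - q.2 + u)‖ * ‖γ u‖) ≤
          ∫ u, ‖α (q.1 - q.2 + u)‖ * ‖γ u‖ :=
        setIntegral_le_integral h1 (Eventually.of_forall fun u => by
          simp only [Pi.zero_apply]; positivity)
      refine ((norm_integral_le_of_norm_le h1.integrableOn
        (Eventually.of_forall fun u => ?_)).trans (h3.trans h2)).trans ?_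
      · refine (norm_kernelDeriv_le (N := 0) hγ1 (w := fun _ => 0) (fun _ => le_rfl)
          (fun _ => by simp) _).trans (le_of_eq ?_)
        simp
      · refine le_mul_of_one_le_right ?_ (Real.one_le_exp (mul_nonneg hμ.le hq.1.le))
        exact add_nonneg (integral_nonneg fun _ => by positivity)
            (integral_nonneg fun _ => by positivity))
    (fun q => (Real.exp_pos _).le)
  refine ⟨N, μ, C, hμ, ?_, hN, hC, fun y t => ⟨(hw y t).1, (hw y t).2.trans ?_⟩,
    fun q => (hfix q).symm⟩
  · exact nonneg_of_mul_nonneg_left ((norm_nonneg _).trans (hC 0)) (Real.exp_pos _)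
  · refine mul_le_of_le_one_left (Real.exp_pos _).le ?_
    rw [div_le_one (by positivity)]
    linarith

end Kernel

/-! ### The kernel equation in integrated form -/

section Transmutation

variable {V : Type*} [NormedAddCommGroup V] [NormedSpace ℂ V]

variable {L : ℝ × ℝ → V →L[ℂ] V} {f : ℝ → V}

/-- For each point of the plane, the integral over the third variable is at most `‖L‖ ‖f‖₁`. This
licenses the change of order in the threefold integral of the kernel identity. -/
lemma integrable_kernel_shift (hL : StronglyMeasurable L) (hLi : Integrable L)
    (hf : StronglyMeasurable f) (hfi : Integrable f) (x : ℝ) :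
    Integrable (fun p : (ℝ × ℝ) × ℝ =>
      {p : (ℝ × ℝ) × ℝ | p.1.2 ≤ p.2 ∧ p.2 ≤ x}.indicator
        (fun p => L (p.1.2, p.1.1) (f (p.2 + p.1.1 - p.1.2))) p) := by
  have hS : MeasurableSet {p : (ℝ × ℝ) × ℝ | p.1.2 ≤ p.2 ∧ p.2 ≤ x} :=
    (measurableSet_le (measurable_snd.comp measurable_fst) measurable_snd).inter
      (measurableSet_le measurable_snd measurable_const)
  have hm : StronglyMeasurable fun p : (ℝ × ℝ) × ℝ =>
      L (p.1.2, p.1.1) (f (p.2 + p.1.1 - p.1.2)) :=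
    stronglyMeasurable_apply (hL.comp_measurable (by fun_prop))
      (hf.comp_measurable (by fun_prop))
  refine Integrable.indicator ?_ hS
  rw [Measure.volume_eq_prod, integrable_prod_iff hm.aestronglyMeasurable]
  have hfs : ∀ q : ℝ × ℝ, Integrable fun s => f (s + q.1 - q.2) := fun q => by
    simp_rw [add_sub_assoc]
    exact hfi.comp_add_right (q.1 - q.2)
  refine ⟨Eventually.of_forall fun q => (L (q.2, q.1)).integrable_comp (hfs q), ?_⟩
  have hLs : Integrable fun q : ℝ × ℝ => L (q.2, q.1) := hLi.swap
  refine (hLs.norm.mul_const (∫ s, ‖f s‖)).mono'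
    hm.norm.integral_prod_right.aestronglyMeasurable (Eventually.of_forall fun q => ?_)
  rw [Real.norm_of_nonneg (integral_nonneg fun _ => norm_nonneg _)]
  have e : ∫ s, ‖f s‖ = ∫ s, ‖f (s + q.1 - q.2)‖ := by
    simp_rw [add_sub_assoc]
    exact (integral_add_right_eq_self (fun s => ‖f s‖) (q.1 - q.2)).symm
  rw [e, ← integral_const_mul]
  exact integral_mono ((L (q.2, q.1)).integrable_comp (hfs q)).norm ((hfs q).norm.const_mul _)
    fun s => (L (q.2, q.1)).le_opNorm _

lemma integral_Ioc_eq_integral_charIntegral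
    (hsupp : ∀ q, ¬(0 < q.2 ∧ q.2 ≤ q.1) → L q = 0) (g : ℝ → V) (x : ℝ) :
    ∫ t in Ioc 0 x, charIntegral L (x, t) (g t) = ∫ t, charIntegral L (x, t) (g t) := by
  refine setIntegral_eq_integral_of_forall_compl_eq_zero fun t ht => ?_
  rw [charIntegral_eq_zero (q := (x, t)) hsupp ht]
  rfl

/-- Fubini's theorem in the characteristic coordinates. -/
lemma integral_charIntegral_apply (hL : StronglyMeasurable L)
    (hsupp : ∀ q, ¬(0 < q.2 ∧ q.2 ≤ q.1) → L q = 0)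
    (hint : ∀ x t, IntegrableOn (fun u => L (x - t + u, u)) (Iic t)) {T M : ℝ}
    (hM : ∀ x t, t ≤ T → ∫ u in Iic t, ‖L (x - t + u, u)‖ ≤ M)
    {g : ℝ → V} (hg : StronglyMeasurable g) (hgi : Integrable g) {x : ℝ} (hx : x ≤ T) :
    ∫ t, charIntegral L (x, t) (g t) =
      ∫ u, ∫ y in Iic x, L (y, u) (g (x + u - y)) := by
  set K : ℝ → ℝ → V := fun t u =>
    {p : ℝ × ℝ | p.2 ≤ p.1}.indicator (fun p => L (x - p.1 + p.2, p.2) (g p.1)) (t, u) with hK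
  have hS : MeasurableSet {p : ℝ × ℝ | p.2 ≤ p.1} := measurableSet_le measurable_snd measurable_fst
  have hKm : StronglyMeasurable (Function.uncurry K) :=
    (stronglyMeasurable_apply (hL.comp_measurable
      (by fun_prop : Measurable fun p : ℝ × ℝ => (x - p.1 + p.2, p.2)))
      (hg.comp_measurable measurable_fst)).indicator hS
  have hKt : ∀ t, (fun u => K t u) = (Iic t).indicator fun u => L (x - t + u, u) (g t) :=
    fun t => rfl
  have hint' : ∀ t, IntegrableOn (fun u => L (x - t + u, u) (g t)) (Iic t) := fun t =>
    (ContinuousLinearMap.apply ℂ V (g t)).integrable_comp (hint x t)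
  have hKi : Integrable (Function.uncurry K) (volume.prod volume) := by
    rw [integrable_prod_iff hKm.aestronglyMeasurable]
    refine ⟨Eventually.of_forall fun t => ?_, ?_⟩
    · exact (integrable_indicator_iff measurableSet_Iic).2 (hint' t)
    · refine (hgi.norm.const_mul M).mono'
        hKm.norm.integral_prod_right.aestronglyMeasurable (Eventually.of_forall fun t => ?_)
      have h0 : 0 ≤ ∫ u, ‖Function.uncurry K (t, u)‖ := integral_nonneg fun _ => norm_nonneg _
      rw [Real.norm_of_nonneg h0]
      have e1 : ∫ u, ‖Function.uncurry K (t, u)‖ =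
          ∫ u in Iic t, ‖L (x - t + u, u) (g t)‖ := by
        rw [← integral_indicator measurableSet_Iic]
        congr 1
        ext u
        rw [← norm_indicator_eq_indicator_norm]
        rfl
      rw [e1]
      rcases le_or_gt t T with ht | ht
      · calc ∫ u in Iic t, ‖L (x - t + u, u) (g t)‖
            ≤ ∫ u in Iic t, ‖L (x - t + u, u)‖ * ‖g t‖ :=
              integral_mono (hint' t).norm ((hint x t).norm.mul_const _)
                fun u => (L (x - t + u, u)).le_opNorm _
          _ = (∫ u in Iic t, ‖L (x - t + u, u)‖) * ‖g t‖ := integral_mul_const _ _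
          _ ≤ M * ‖g t‖ := mul_le_mul_of_nonneg_right (hM x t ht) (norm_nonneg _)
      · have hz : ∀ u, L (x - t + u, u) = 0 := fun u => hsupp _ fun h => by
          have := h.2
          simp only at this
          -- For `t > T ≥ x` the whole characteristic lies above the diagonal, off the triangle.
          linarith
        have hM0 : 0 ≤ M := (integral_nonneg fun _ => norm_nonneg _).trans (hM x T le_rfl)
        simp only [hz, zero_apply, norm_zero, integral_zero]
        positivity
  have e1 : ∀ t, charIntegral L (x, t) (g t) = ∫ u, K t u := fun t => by
    rw [hKt, integral_indicator measurableSet_Iic]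
    exact ContinuousLinearMap.integral_apply (hint x t) (g t)
  simp_rw [e1]
  rw [integral_integral_swap hKi]
  congr 1
  ext u
  -- For fixed `u`, the substitution `y = x + u - t` replaces `t` by the first coordinate of the
  -- point on the characteristic.
  rw [← integral_indicator measurableSet_Iic,
    ← integral_sub_left_eq_self _ volume (x + u)]
  congr 1
  ext t
  simp only [hK, indicator, mem_ofPred_eq, mem_Iic]
  have e2 : (u ≤ x + u - t) = (t ≤ x) := propext ⟨fun h => by linarith, fun h => by linarith⟩
  have e3 : x - (x + u - t) + u = t := by ring
  simp only [e2, e3]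

variable [CompleteSpace V]

/-- The kernel identity behind `(∂ₓ + ∂ₜ) N = L`. -/
lemma integral_charIntegral_primitive (hL : StronglyMeasurable L) (hLi : Integrable L)
    (hsupp : ∀ q, ¬(0 < q.2 ∧ q.2 ≤ q.1) → L q = 0)
    (hint : ∀ x t, IntegrableOn (fun u => L (x - t + u, u)) (Iic t)) {T M : ℝ}
    (hM : ∀ x t, t ≤ T → ∫ u in Iic t, ‖L (x - t + u, u)‖ ≤ M)
    (hf : StronglyMeasurable f) (hfi : Integrable f) (c : V) {x : ℝ} (hx : x ≤ T) :
    ∫ t in Ioc 0 x, charIntegral L (x, t) (c + ∫ s in (0 : ℝ)..t, f s) =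
      (∫ s in Ioc 0 x, ∫ t in Ioc 0 s, charIntegral L (s, t) (f t)) +
      ∫ y in Ioc 0 x, ∫ u, L (y, u) (c + ∫ s in (0 : ℝ)..u, f s) := by
  set h : ℝ → V := fun t => c + ∫ s in (0 : ℝ)..t, f s with hh
  have hhc : Continuous h := continuous_const.add
    (intervalIntegral.continuous_primitive (fun a b => hfi.intervalIntegrable) 0)
  have hhm : StronglyMeasurable h := hhc.stronglyMeasurable
  have hhb : ∀ t, ‖h t‖ ≤ ‖c‖ + ∫ s, ‖f s‖ := fun t => by
    refine (norm_add_le _ _).trans (add_le_add le_rfl ?_)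
    refine intervalIntegral.norm_integral_le_integral_norm_uIoc.trans ?_
    exact setIntegral_le_integral hfi.norm (Eventually.of_forall fun _ => norm_nonneg _)
  -- The primitive need not be integrable on the line, so it is cut off; on the triangle only its
  -- values on `(0, T]` enter.
  set g : ℝ → V := (Ioc 0 T).indicator h with hg
  have hgm : StronglyMeasurable g := hhm.indicator measurableSet_Ioc
  have hgi : Integrable g := by
    refine (integrable_indicator_iff measurableSet_Ioc).2 ?_
    exact (hhc.integrableOn_Icc).mono_set Ioc_subset_Icc_self
  set J : ℝ → ℝ → V := fun u y => (Iic x).indicator (fun y => L (y, u) (h u)) y with hJ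
  set H : (ℝ × ℝ) × ℝ → V := fun p => {p : (ℝ × ℝ) × ℝ | p.1.2 ≤ p.2 ∧ p.2 ≤ x}.indicator
        (fun p => L (p.1.2, p.1.1) (f (p.2 + p.1.1 - p.1.2))) p with hH
  have hHi : Integrable H (volume.prod volume) := integrable_kernel_shift hL hLi hf hfi x
  have hLs : Integrable (fun q : ℝ × ℝ => L (q.2, q.1)) (volume.prod volume) := hLi.swap
  have hJi : Integrable (Function.uncurry J) (volume.prod volume) := by
    refine Integrable.mono' (hLs.norm.mul_const (‖c‖ + ∫ s, ‖f s‖)) ?_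
      (Eventually.of_forall fun q => ?_)
    · have hS : MeasurableSet {q : ℝ × ℝ | q.2 ≤ x} :=
        measurableSet_le measurable_snd measurable_const
      exact ((stronglyMeasurable_apply (hL.comp_measurable
        (by fun_prop : Measurable fun q : ℝ × ℝ => (q.2, q.1)))
        (hhm.comp_measurable measurable_fst)).indicator hS).aestronglyMeasurable
    · refine (norm_indicator_le_norm_self (fun y => L (y, q.1) (h q.1)) _).trans
        (((L (q.2, q.1)).le_opNorm _).trans ?_)
      exact mul_le_mul_of_nonneg_left (hhb _) (norm_nonneg _)
  -- On the triangle, `h(x + u - y) = h(u) + ∫ f(s + u - y) ds` over `y ≤ s ≤ x`: the first term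
  -- gives the contribution of `L`, the second that of `N` applied to `f`.
  have e1 : ∀ u y, (Iic x).indicator (fun y => L (y, u) (g (x + u - y))) y =
      J u y + ∫ s, H ((u, y), s) := by
    intro u y
    by_cases hyx : y ≤ x
    swap
    · have hH0 : ∀ s, H ((u, y), s) = 0 := fun s =>
        indicator_of_notMem (fun hs => hyx (hs.1.trans hs.2)) _
      rw [indicator_of_notMem (by simpa using hyx), hJ]
      simp only [hH0, integral_zero, add_zero]
      rw [indicator_of_notMem (by simpa using hyx)]
    have hHs : ∫ s, H ((u, y), s) = ∫ s in Icc y x, L (y, u) (f (s + u - y)) := by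
      rw [← integral_indicator measurableSet_Icc]
      rfl
    rw [indicator_of_mem (by simpa using hyx), hHs, hJ]
    simp only
    rw [indicator_of_mem (by simpa using hyx)]
    by_cases hq : 0 < u ∧ u ≤ y
    swap
    · simp [hsupp (y, u) hq]
    have hmem : x + u - y ∈ Ioc 0 T := ⟨by linarith [hq.1], by linarith [hq.2]⟩
    have hfs : Integrable fun s => f (s + u - y) := by
      simp_rw [add_sub_assoc]
      exact hfi.comp_add_right (u - y)
    rw [(L (y, u)).integral_comp_comm hfs.integrableOn, ← map_add, hg, indicator_of_mem hmem,
      integral_Icc_eq_integral_Ioc, ← intervalIntegral.integral_of_le hyx]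
    congr 1
    have e : ∫ s in y..x, f (s + u - y) = ∫ s in u..x + u - y, f s := by
      simp_rw [add_sub_assoc]
      rw [intervalIntegral.integral_comp_add_right]
      congr 1
      ring
    rw [e, hh]
    simp only
    rw [add_assoc, intervalIntegral.integral_add_adjacent_intervals hfi.intervalIntegrable
      hfi.intervalIntegrable]
  have e2 : ∫ t in Ioc 0 x, charIntegral L (x, t) (h t) =
      ∫ u, ∫ y, (J u y + ∫ s, H ((u, y), s)) := by
    rw [setIntegral_congr_fun (g := fun t => charIntegral L (x, t) (g t)) measurableSet_Ioc
      (fun t ht => by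
        simp only [hg]
        rw [indicator_of_mem (show t ∈ Ioc 0 T from ⟨ht.1, ht.2.trans hx⟩)]),
      integral_Ioc_eq_integral_charIntegral hsupp,
      integral_charIntegral_apply hL hsupp hint hM hgm hgi hx]
    congr 1
    ext u
    rw [← integral_indicator measurableSet_Iic]
    exact congrArg _ (funext (e1 u))
  have hHq : Integrable (fun q : ℝ × ℝ => ∫ s, H (q, s)) (volume.prod volume) :=
    hHi.integral_prod_left
  rw [e2, ← integral_prod (f := fun q : ℝ × ℝ => J q.1 q.2 + ∫ s, H (q, s)) (hJi.add hHq),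
    integral_add (f := fun q : ℝ × ℝ => J q.1 q.2) hJi hHq, add_comm]
  congr 1
  · refine (integral_prod H hHi).symm.trans ?_
    rw [integral_prod_symm _ hHi, ← integral_indicator measurableSet_Ioc]
    refine integral_congr_ae ?_
    -- For fixed `s` the double integral over `u, y` is the characteristic formula again, with upper
    -- end `s` and with `f` in place of the primitive.
    filter_upwards [hHi.swap.prod_right_ae] with s hs
    refine (integral_prod (fun q : ℝ × ℝ => H (q, s)) hs).trans ?_
    by_cases hs0 : s ∈ Ioc 0 x
    · rw [indicator_of_mem hs0, integral_Ioc_eq_integral_charIntegral hsupp,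
        integral_charIntegral_apply hL hsupp hint hM hf hfi (hs0.2.trans hx)]
      congr 1
      ext u
      rw [← integral_indicator measurableSet_Iic]
      congr 1
      ext y
      simp only [hH, indicator, mem_Iic, mem_ofPred_eq, hs0.2, and_true]
    · rw [indicator_of_notMem hs0]
      have hz : ∀ u y, H ((u, y), s) = 0 := fun u y => by
        simp only [hH, indicator, mem_ofPred_eq]
        split_ifs with hc
        · rw [hsupp _ fun hq => hs0 ⟨hq.1.trans_le (hq.2.trans hc.1), hc.2⟩]
          rfl
        · rfl
      simp [hz]
  · rw [integral_prod_symm (f := fun q : ℝ × ℝ => J q.1 q.2) hJi,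
      ← integral_indicator measurableSet_Ioc]
    congr 1
    ext y
    simp only [hJ, indicator, mem_Iic, mem_Ioc]
    by_cases hy : y ≤ x
    · by_cases hy0 : 0 < y
      · simp only [hy, hy0, and_self, if_true, hh]
      · have hz : ∀ u, L (y, u) = 0 := fun u => hsupp _ fun hq => hy0 (hq.1.trans_le hq.2)
        simp [hz]
    · simp [hy]

end Transmutation

/-! ### Volterra operators with bounded kernel -/

section Volterra

variable {V W : Type*} [NormedAddCommGroup V] [NormedSpace ℂ V]
  [NormedAddCommGroup W] [NormedSpace ℂ W]

/-- The Volterra operator with kernel `N`. -/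
noncomputable def volterra (N : ℝ × ℝ → V →L[ℂ] V) (f : ℝ → V) (x : ℝ) : V :=
  ∫ t in (0 : ℝ)..x, N (x, t) (f t)

variable {N : ℝ × ℝ → V →L[ℂ] V} {f g : ℝ → V} {T C : ℝ}

lemma integrableOn_kernel_apply (hN : StronglyMeasurable N)
    (hC : ∀ q : ℝ × ℝ, q.2 ≤ T → ‖N q‖ ≤ C) (hf : IntegrableOn f (Ioc 0 T)) (x : ℝ) :
    IntegrableOn (fun t => N (x, t) (f t)) (Ioc 0 T) := by
  refine Integrable.mono' (hf.norm.const_mul C) ?_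
    ((ae_restrict_iff' measurableSet_Ioc).2 (Eventually.of_forall fun t ht => ?_))
  · exact (isBoundedBilinearMap_apply (𝕜 := ℂ)).continuous.comp_aestronglyMeasurable
      ((hN.comp_measurable
        (by fun_prop : Measurable fun t : ℝ => (x, t))).aestronglyMeasurable.prodMk hf.1)
  · exact ((N (x, t)).le_opNorm _).trans (mul_le_mul_of_nonneg_right (hC _ ht.2) (norm_nonneg _))

lemma norm_volterra_le (hC : ∀ q : ℝ × ℝ, q.2 ≤ T → ‖N q‖ ≤ C)
    (hf : IntegrableOn f (Ioc 0 T)) {x : ℝ} (hx : x ∈ Icc 0 T) :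
    ‖volterra N f x‖ ≤ C * ∫ t in Ioc 0 T, ‖f t‖ := by
  have hC0 : 0 ≤ C := (norm_nonneg _).trans (hC (0, T) le_rfl)
  unfold volterra
  rw [intervalIntegral.integral_of_le hx.1, ← integral_const_mul]
  have hs : Ioc 0 x ⊆ Ioc 0 T := Ioc_subset_Ioc_right hx.2
  refine (norm_integral_le_of_norm_le ((hf.norm.const_mul C).mono_measure
    (Measure.restrict_mono hs le_rfl)) ((ae_restrict_iff' measurableSet_Ioc).2
      (Eventually.of_forall fun t ht => ?_))).trans ?_
  · exact ((N (x, t)).le_opNorm _).trans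
      (mul_le_mul_of_nonneg_right (hC _ (hs ht).2) (norm_nonneg _))
  · exact setIntegral_mono_set (hf.norm.const_mul C)
      (Eventually.of_forall fun t => mul_nonneg hC0 (norm_nonneg _)) hs.eventuallyLE

/-- For negative `x` the interval integral is oriented backwards; the cut-off leaves only the range
where it is a set integral. -/
lemma stronglyMeasurable_volterra (hN : StronglyMeasurable N) (hf : StronglyMeasurable f) :
    StronglyMeasurable ((Ici 0).indicator (volterra N f)) := by
  have h : (Ici 0).indicator (volterra N f) =
      (Ici 0).indicator fun x => ∫ t in Ioc 0 x, N (x, t) (f t) := by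
    refine indicator_congr fun x hx => ?_
    exact intervalIntegral.integral_of_le hx
  rw [h]
  refine (stronglyMeasurable_setIntegral_section (f := fun x t => N (x, t) (f t))
    (stronglyMeasurable_apply hN (hf.comp_measurable measurable_snd))
    (S := {p : ℝ × ℝ | p.2 ∈ Ioc 0 p.1})
    ((measurableSet_lt measurable_const measurable_snd).inter
      (measurableSet_le measurable_snd measurable_fst))).indicator measurableSet_Ici

lemma aestronglyMeasurable_volterra (hN : StronglyMeasurable N) (hf : StronglyMeasurable f) :
    AEStronglyMeasurable (volterra N f) (volume.restrict (Ioc 0 T)) := by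
  refine (stronglyMeasurable_volterra hN hf).aestronglyMeasurable.congr
    ((ae_restrict_iff' measurableSet_Ioc).2 (Eventually.of_forall fun x hx => ?_))
  exact indicator_of_mem (show x ∈ Ici 0 from hx.1.le) _

lemma volterra_congr (hfg : f =ᵐ[volume.restrict (Ioc 0 T)] g) {x : ℝ} (hx : x ∈ Icc 0 T) :
    volterra N f x = volterra N g x := by
  unfold volterra
  rw [intervalIntegral.integral_of_le hx.1, intervalIntegral.integral_of_le hx.1]
  refine integral_congr_ae ?_
  filter_upwards [ae_mono (Measure.restrict_mono (Ioc_subset_Ioc_right hx.2) le_rfl) hfg]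
    with t ht
  rw [ht]

lemma integrableOn_volterra (hN : StronglyMeasurable N)
    (hC : ∀ q : ℝ × ℝ, q.2 ≤ T → ‖N q‖ ≤ C) (hf : StronglyMeasurable f)
    (hfi : IntegrableOn f (Ioc 0 T)) : IntegrableOn (volterra N f) (Ioc 0 T) := by
  refine Integrable.mono' (integrable_const (C * ∫ t in Ioc 0 T, ‖f t‖))
    (aestronglyMeasurable_volterra hN hf)
    ((ae_restrict_iff' measurableSet_Ioc).2 (Eventually.of_forall fun x hx => ?_))
  exact norm_volterra_le hC hfi (Ioc_subset_Icc_self hx)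

lemma integrableOn_apply_of_bounded {γ : ℝ → V →L[ℂ] W} (hγ : IntegrableOn γ (Ioc 0 T))
    (hf : AEStronglyMeasurable f (volume.restrict (Ioc 0 T)))
    (hC : ∀ x ∈ Ioc 0 T, ‖f x‖ ≤ C) : IntegrableOn (fun x => γ x (f x)) (Ioc 0 T) := by
  refine Integrable.mono' (hγ.norm.mul_const C) ?_
    ((ae_restrict_iff' measurableSet_Ioc).2 (Eventually.of_forall fun x hx => ?_))
  · exact (isBoundedBilinearMap_apply (𝕜 := ℂ)).continuous.comp_aestronglyMeasurable
      (hγ.1.prodMk hf)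
  · exact ((γ x).le_opNorm _).trans (mul_le_mul_of_nonneg_left (hC x hx) (norm_nonneg _))

variable {α : ℝ → W →L[ℂ] V} {γ : ℝ → V →L[ℂ] W}

/-- Exchanging the order of integration on `0 < u ≤ s ≤ y` turns the double integral of
`γ(s)N(s,u)h(u)` into that of `γ` against `Nh`. Thus the right side of the kernel equation becomes
`-α∫γ` applied to `(1 + N)h`. -/
lemma integral_kernelDeriv_apply [CompleteSpace V] [CompleteSpace W] (hγ : Integrable γ)
    (hN : StronglyMeasurable N)
    (hC : ∀ q : ℝ × ℝ, q.2 ≤ T → ‖N q‖ ≤ C) {h : ℝ → V} (hh : ContinuousOn h (Icc 0 T))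
    (hhm : StronglyMeasurable h) {y : ℝ} (hy : y ∈ Ioc 0 T)
    (hz : ∀ q : ℝ × ℝ, ¬(0 < q.2 ∧ q.2 ≤ q.1) → N q = 0) :
    ∫ u, kernelDeriv α γ N (y, u) (h u) =
      -(α y (∫ t in (0 : ℝ)..y, γ t (h t + volterra N h t))) := by
  obtain ⟨D, hD⟩ := isCompact_Icc.exists_bound_of_continuousOn hh
  have hsub : Ioc 0 y ⊆ Ioc 0 T := Ioc_subset_Ioc_right hy.2
  have hhi : IntegrableOn h (Ioc 0 T) := hh.integrableOn_Icc.mono_set Ioc_subset_Icc_self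
  have hγh : IntegrableOn (fun t => γ t (h t)) (Ioc 0 y) :=
    (integrableOn_apply_of_bounded hγ.integrableOn hhm.aestronglyMeasurable
      fun x hx => hD x (Ioc_subset_Icc_self hx)).mono_set hsub
  have hγv : IntegrableOn (fun t => γ t (volterra N h t)) (Ioc 0 y) :=
    (integrableOn_apply_of_bounded hγ.integrableOn (aestronglyMeasurable_volterra hN hhm)
      fun x hx => norm_volterra_le hC hhi (Ioc_subset_Icc_self hx)).mono_set hsub
  have hD0 : 0 ≤ D := (norm_nonneg _).trans (hD y (Ioc_subset_Icc_self hy))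
  have hC0 : 0 ≤ C := (norm_nonneg _).trans (hC (0, T) le_rfl)
  -- the iterated integral over the triangle
  set Q : ℝ → ℝ → W := fun u s => γ s (N (s, u) (h u)) with hQ
  have hQi : Integrable (Function.uncurry Q)
      ((volume.restrict (Ioc 0 y)).prod (volume.restrict (Ioc 0 y))) := by
    have hdom : Integrable (fun q : ℝ × ℝ => (1 : ℝ) * (‖γ q.2‖ * (C * D)))
        ((volume.restrict (Ioc 0 y)).prod (volume.restrict (Ioc 0 y))) :=
      (integrable_const (1 : ℝ)).mul_prod ((hγ.norm.mul_const (C * D)).integrableOn)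
    refine hdom.mono' ?_ ?_
    · have h1 : AEStronglyMeasurable (fun q : ℝ × ℝ => γ q.2)
          ((volume.restrict (Ioc 0 y)).prod (volume.restrict (Ioc 0 y))) :=
        hγ.1.restrict.comp_snd
      have h2 : StronglyMeasurable fun q : ℝ × ℝ => N (q.2, q.1) (h q.1) :=
        stronglyMeasurable_apply (hN.comp_measurable (by fun_prop))
          (hhm.comp_measurable measurable_fst)
      exact (isBoundedBilinearMap_apply (𝕜 := ℂ)).continuous.comp_aestronglyMeasurable
        (h1.prodMk h2.aestronglyMeasurable)
    · rw [Measure.prod_restrict]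
      refine (ae_restrict_iff' (measurableSet_Ioc.prod measurableSet_Ioc)).2
        (Eventually.of_forall fun q hq => ?_)
      rw [one_mul]
      refine ((γ q.2).le_opNorm _).trans (mul_le_mul_of_nonneg_left ?_ (norm_nonneg _))
      refine ((N (q.2, q.1)).le_opNorm _).trans ?_
      exact mul_le_mul (hC _ (hsub hq.1).2) (hD _ (Ioc_subset_Icc_self (hsub hq.1)))
        (norm_nonneg _) hC0
  have hcomp : ∀ u, IntegrableOn (fun s => γ s ∘L N (s, u)) (Ioc u y) ∨ T < u := fun u => by
    rcases le_or_gt u T with hu | hu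
    · exact Or.inl (integrable_comp_bounded_left hγ
        (hN.comp_measurable (by fun_prop)) fun s => hC (s, u) hu)
    · exact Or.inr hu
  have e1 : ∫ u, kernelDeriv α γ N (y, u) (h u) =
      ∫ u in Ioc 0 y, -(α y (γ u (h u) + ∫ s in Ioc 0 y, Q u s)) := by
    rw [← integral_indicator measurableSet_Ioc]
    congr 1
    ext u
    unfold kernelDeriv
    by_cases hu : u ∈ Ioc 0 y
    swap
    · rw [indicator_of_notMem hu, indicator_of_notMem (s := {q : ℝ × ℝ | 0 < q.2 ∧ q.2 ≤ q.1})
        (a := (y, u)) hu]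
      rfl
    rw [indicator_of_mem hu, indicator_of_mem (s := {q : ℝ × ℝ | 0 < q.2 ∧ q.2 ≤ q.1})
      (a := (y, u)) hu]
    have hi : IntegrableOn (fun s => γ s ∘L N (s, u)) (Ioc u y) :=
      (hcomp u).resolve_right (not_lt.2 (hsub hu).2)
    simp only [neg_apply, ContinuousLinearMap.comp_apply,
      add_apply]
    congr 3
    rw [ContinuousLinearMap.integral_apply hi]
    simp only [hQ, ContinuousLinearMap.comp_apply]
    -- `N` need not vanish on the diagonal, so `s = u` is included before the domain is enlarged to
    -- `(0, y]` by points where `N = 0`.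
    rw [← integral_Icc_eq_integral_Ioc]
    refine setIntegral_eq_of_subset_of_forall_sdiff_eq_zero measurableSet_Ioc
      (fun s hs => ⟨hu.1.trans_le hs.1, hs.2⟩) (fun s hs => ?_) |>.symm
    rw [hz (s, u) fun h' => hs.2 ⟨h'.2, hs.1.2⟩]
    simp
  have hQu : Integrable (fun u => ∫ s in Ioc 0 y, Q u s) (volume.restrict (Ioc 0 y)) :=
    hQi.integral_prod_left
  rw [e1, integral_neg, (α y).integral_comp_comm (φ := fun u => γ u (h u) + ∫ s in Ioc 0 y, Q u s)
    (hγh.add hQu), integral_add hγh hQu,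
    integral_integral_swap hQi, intervalIntegral.integral_of_le hy.1.le]
  congr 2
  simp only [map_add]
  rw [integral_add hγh hγv]
  congr 1
  refine setIntegral_congr_fun measurableSet_Ioc fun s hs => ?_
  simp only [hQ]
  have hNs : IntegrableOn (fun t => N (s, t) (h t)) (Ioc 0 y) :=
    (integrableOn_kernel_apply hN hC hhi s).mono_set hsub
  rw [(γ s).integral_comp_comm hNs]
  unfold volterra
  rw [intervalIntegral.integral_of_le hs.1.le]
  congr 1
  refine setIntegral_eq_of_subset_of_forall_sdiff_eq_zero measurableSet_Ioc
    (Ioc_subset_Ioc_right hs.2) fun t ht => ?_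
  rw [hz (s, t) fun h' => ht.2 ⟨ht.1.1, h'.2⟩]
  simp

end Volterra

/-! ### The transmutation property -/

section Transmutation

variable {V W : Type*} [NormedAddCommGroup V] [NormedSpace ℂ V]
  [NormedAddCommGroup W] [NormedSpace ℂ W]

lemma integrableOn_comp_continuousOn {α : ℝ → W →L[ℂ] V} {z : ℝ → W} {T : ℝ}
    (hα : IntegrableOn α (Ioc 0 T)) (hz : ContinuousOn z (Icc 0 T)) :
    IntegrableOn (fun x => α x (z x)) (Ioc 0 T) := by
  obtain ⟨C, hC⟩ := isCompact_Icc.exists_bound_of_continuousOn hz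
  exact integrableOn_apply_of_bounded hα
    ((hz.mono Ioc_subset_Icc_self).aestronglyMeasurable measurableSet_Ioc)
    fun x hx => hC x (Ioc_subset_Icc_self hx)

variable [CompleteSpace V] [CompleteSpace W]

lemma continuousOn_integral {E : Type*} [NormedAddCommGroup E] [NormedSpace ℝ E] {g : ℝ → E}
    {T : ℝ} (hT : 0 ≤ T) (hg : IntegrableOn g (Ioc 0 T)) :
    ContinuousOn (fun x => ∫ t in (0 : ℝ)..x, g t) (Icc 0 T) := by
  simpa using (IsPrimitive.of_integrableOn 0 hg).continuousOn hT

/-- The transmutation operator `1 + N` intertwines `d/dx` and `d/dx + α ∫ γ`. -/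
theorem exists_transmutation {T : ℝ} (hT : 0 < T) {α : ℝ → W →L[ℂ] V} {γ : ℝ → V →L[ℂ] W}
    (hα : StronglyMeasurable α) (hα2 : Integrable fun x => ‖α x‖ ^ 2)
    (hα0 : ∀ x ∉ Ioc 0 T, α x = 0)
    (hγ : StronglyMeasurable γ) (hγ2 : Integrable fun x => ‖γ x‖ ^ 2)
    (hγ0 : ∀ x ∉ Ioc 0 T, γ x = 0) :
    ∃ N : ℝ × ℝ → V →L[ℂ] V, StronglyMeasurable N ∧
      (∃ C, ∀ q : ℝ × ℝ, q.2 ≤ T → ‖N q‖ ≤ C) ∧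
      ∀ f h : ℝ → V, StronglyMeasurable f → IsPrimitive T h f →
        IsPrimitive T (fun x => h x + volterra N h x) fun x => f x + volterra N f x -
          α x (∫ t in (0 : ℝ)..x, γ t (h t + volterra N h t)) := by
  have hα1 := integrable_of_sq_of_support hα hα2 hα0
  have hγ1 := integrable_of_sq_of_support hγ hγ2 hγ0
  obtain ⟨N, μ, C, hμ, hC0, hN, hNC, hw, hfix⟩ := exists_kernel hα hα2 hγ hγ2 hγ1
  set L := kernelDeriv α γ N with hLdef
  have hL : StronglyMeasurable L := stronglyMeasurable_kernelDeriv hα hγ hN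
  have hsupp : ∀ q : ℝ × ℝ, ¬(0 < q.2 ∧ q.2 ≤ q.1) → L q = 0 := fun q hq =>
    kernelDeriv_eq_zero hq
  have hNz : ∀ q : ℝ × ℝ, ¬(0 < q.2 ∧ q.2 ≤ q.1) → N q = 0 := fun q hq => by
    rw [hfix, charIntegral_eq_zero hsupp hq]
  have hNb : ∀ q : ℝ × ℝ, q.2 ≤ T → ‖N q‖ ≤ C * Real.exp (μ * T) := fun q hq => by
    refine (hNC q).trans ?_
    gcongr
  set I := ∫ s, ‖γ s‖ with hI
  have hI0 : 0 ≤ I := integral_nonneg fun _ => norm_nonneg _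
  have hLle : ∀ q : ℝ × ℝ, ‖L q‖ ≤ ‖α q.1‖ * (‖γ q.2‖ + I * (C * Real.exp (μ * q.2))) :=
    norm_kernelDeriv_le hγ1 (w := fun t => C * Real.exp (μ * t)) (fun t => by positivity) hNC
  have hdom : ∀ x t, IntegrableOn (fun u => ‖α (x - t + u)‖ * ‖γ u‖ +
      I * C * (‖α (x - t + u)‖ * Real.exp (μ * u))) (Iic t) := fun x t =>
    (integrable_norm_mul_norm_of_sq hα hα2 hγ hγ2 _).1.integrableOn.add
        ((hw (x - t) t).1.const_mul _)
  have hLle' : ∀ x t u, ‖L (x - t + u, u)‖ ≤ ‖α (x - t + u)‖ * ‖γ u‖ +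
      I * C * (‖α (x - t + u)‖ * Real.exp (μ * u)) := fun x t u =>
    (hLle (x - t + u, u)).trans (le_of_eq (by ring))
  have hint : ∀ x t, IntegrableOn (fun u => L (x - t + u, u)) (Iic t) := fun x t =>
    Integrable.mono' (hdom x t) ((hL.comp_measurable
      (by fun_prop : Measurable fun u => (x - t + u, u))).aestronglyMeasurable)
      (Eventually.of_forall (hLle' x t))
  -- The first summand bounds the inhomogeneous part along a characteristic, the second the part
  -- containing `N`.
  have hM : ∀ x t, t ≤ T → ∫ u in Iic t, ‖L (x - t + u, u)‖ ≤
      ((∫ x, ‖α x‖ ^ 2) + ∫ x, ‖γ x‖ ^ 2) + I * C * Real.exp (μ * T) := fun x t ht => by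
    refine (setIntegral_mono (hint x t).norm (hdom x t) (hLle' x t)).trans ?_
    obtain ⟨h1, h2⟩ := integrable_norm_mul_norm_of_sq hα hα2 hγ hγ2 (x - t)
    rw [integral_add h1.integrableOn ((hw (x - t) t).1.const_mul _), integral_const_mul]
    refine add_le_add ((setIntegral_le_integral h1 (Eventually.of_forall fun u => ?_)).trans h2) ?_
    · simp only [Pi.zero_apply]; positivity
    · refine mul_le_mul_of_nonneg_left ((hw _ _).2.trans ?_) (by positivity)
      gcongr
  -- Since `α` vanishes beyond `T`, `L` lives on `0 < t ≤ x ≤ T`, where it is dominated by a product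
  -- of two integrable functions of one variable.
  have hLi : Integrable L := by
    have hb : Integrable ((Ioc 0 T).indicator fun u => ‖γ u‖ + I * (C * Real.exp (μ * T))) :=
      (integrable_indicator_iff measurableSet_Ioc).2
        (Integrable.add hγ1.norm.integrableOn (integrable_const _))
    refine (hα1.norm.mul_prod hb).mono' hL.aestronglyMeasurable
      (Eventually.of_forall fun q => ?_)
    by_cases hq : 0 < q.2 ∧ q.2 ≤ q.1
    swap
    · rw [hsupp q hq, norm_zero]
      refine mul_nonneg (norm_nonneg _) (indicator_nonneg (fun u _ => ?_) _)
      positivity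
    refine (hLle q).trans ?_
    by_cases hqT : q.1 ≤ T
    · rw [indicator_of_mem (show q.2 ∈ Ioc 0 T from ⟨hq.1, hq.2.trans hqT⟩)]
      have : q.2 ≤ T := hq.2.trans hqT
      gcongr
    · rw [hα0 q.1 fun h => hqT h.2]
      simp
  refine ⟨N, hN, ⟨_, hNb⟩, fun f h hf hhf => ?_⟩
  -- The kernel identity needs a function integrable on the line. Cutting off `f` and taking its
  -- primitive again changes nothing on the interval.
  set f' := (Ioc 0 T).indicator f with hf'
  have hfm : StronglyMeasurable f' := hf.indicator measurableSet_Ioc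
  have hfi : Integrable f' := (integrable_indicator_iff measurableSet_Ioc).2 hhf.integrableOn
  set h' : ℝ → V := fun t => h 0 + ∫ s in (0 : ℝ)..t, f' s with hh'
  have hhc : Continuous h' := continuous_const.add
    (intervalIntegral.continuous_primitive (fun a b => hfi.intervalIntegrable) 0)
  have hff' : ∀ x ∈ Ioc 0 T, f' x = f x := fun x hx => indicator_of_mem hx f
  have hhh : ∀ x ∈ Icc 0 T, h' x = h x := fun x hx => by
    rw [hh', hhf.eq x hx]
    simp only
    rw [intervalIntegral.integral_of_le hx.1, intervalIntegral.integral_of_le hx.1]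
    congr 1
    exact setIntegral_congr_fun measurableSet_Ioc fun t ht => hff' t ⟨ht.1, ht.2.trans hx.2⟩
  have hvf : ∀ x ∈ Icc 0 T, volterra N f' x = volterra N f x := fun x hx =>
    volterra_congr ((ae_restrict_iff' measurableSet_Ioc).2 (Eventually.of_forall hff')) hx
  have hvh : ∀ x ∈ Icc 0 T, volterra N h' x = volterra N h x := fun x hx =>
    volterra_congr ((ae_restrict_iff' measurableSet_Ioc).2
      (Eventually.of_forall fun x hx => hhh x (Ioc_subset_Icc_self hx))) hx
  have hhi : IntegrableOn h' (Ioc 0 T) := hhc.integrableOn_Icc.mono_set Ioc_subset_Icc_self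
  have hvi : IntegrableOn (volterra N f') (Ioc 0 T) :=
    integrableOn_volterra hN hNb hfm hfi.integrableOn
  obtain ⟨D, hD⟩ := isCompact_Icc.exists_bound_of_continuousOn (s := Icc 0 T) hhc.continuousOn
  have hγe : IntegrableOn (fun t => γ t (h' t + volterra N h' t)) (Ioc 0 T) :=
    integrableOn_apply_of_bounded hγ1.integrableOn
      (hhc.aestronglyMeasurable.add (aestronglyMeasurable_volterra hN hhc.stronglyMeasurable))
      fun x hx => (norm_add_le _ _).trans (add_le_add (hD x (Ioc_subset_Icc_self hx))
        (norm_volterra_le hNb hhi (Ioc_subset_Icc_self hx)))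
  have hαi : IntegrableOn (fun x => α x (∫ t in (0 : ℝ)..x, γ t (h' t + volterra N h' t)))
      (Ioc 0 T) :=
    integrableOn_comp_continuousOn hα1.integrableOn (continuousOn_integral hT.le hγe)
  have hcharN : charIntegral L = N := funext fun q => (hfix q).symm
  have key : IsPrimitive T (fun x => h' x + volterra N h' x) fun x => f' x + volterra N f' x -
      α x (∫ t in (0 : ℝ)..x, γ t (h' t + volterra N h' t)) := by
    refine ⟨(hfi.integrableOn.add hvi).sub hαi, fun x hx => ?_⟩
    have hs : Ioc 0 x ⊆ Ioc 0 T := Ioc_subset_Ioc_right hx.2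
    have e0 : h' 0 + volterra N h' 0 = h 0 := by simp [hh', volterra]
    have e1 := integral_charIntegral_primitive hL hLi hsupp hint hM hfm hfi (h 0) hx.2
    rw [hcharN] at e1
    rw [e0, intervalIntegral.integral_of_le hx.1,
      integral_sub (f := fun x => f' x + volterra N f' x)
        ((hfi.integrableOn.add hvi).mono_set hs) (hαi.mono_set hs),
      integral_add hfi.integrableOn (hvi.mono_set hs)]
    -- This is `(Nh)' = Nf - α∫γ(1 + N)h` in integrated form.
    have e2 : volterra N h' x = (∫ s in Ioc 0 x, volterra N f' s) +
        -∫ y in Ioc 0 x, α y (∫ t in (0 : ℝ)..y, γ t (h' t + volterra N h' t)) := by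
      rw [← integral_neg]
      unfold volterra
      rw [intervalIntegral.integral_of_le hx.1, e1]
      congr 1
      · exact setIntegral_congr_fun measurableSet_Ioc fun s hs' =>
          (intervalIntegral.integral_of_le hs'.1.le).symm
      · exact setIntegral_congr_fun measurableSet_Ioc fun y hy =>
          integral_kernelDeriv_apply hγ1 hN hNb hhc.continuousOn hhc.stronglyMeasurable
            (hs hy) hNz
    rw [e2]
    simp only [hh']
    rw [intervalIntegral.integral_of_le hx.1]
    abel
  refine key.congr (fun x hx => by rw [hhh x hx, hvh x hx]) fun x hx => ?_
  have hx' := Ioc_subset_Icc_self hx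
  rw [hff' x hx, hvf x hx']
  congr 2
  refine intervalIntegral.integral_congr fun t ht => ?_
  rw [uIcc_of_le hx'.1] at ht
  have ht' : t ∈ Icc 0 T := ⟨ht.1, ht.2.trans hx'.2⟩
  simp only [hhh t ht', hvh t ht']

end Transmutation

/-! ### Inversion of `1 + N` -/

section VolterraInverse

variable {V : Type*} [NormedAddCommGroup V] [NormedSpace ℂ V] {N : ℝ × ℝ → V →L[ℂ] V} {T C : ℝ}

/-- Integrating `exp(μt)` gains a factor `1/μ`, and `μ = 2C + 1` makes `C/μ ≤ 1/2`. -/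
lemma exists_volterra_halving (hC : ∀ q : ℝ × ℝ, q.2 ≤ T → ‖N q‖ ≤ C) :
    ∃ μ : ℝ, 0 < μ ∧ ∀ (d : ℝ → V) (D : ℝ), 0 ≤ D →
      (∀ x ∈ Icc 0 T, ‖d x‖ ≤ D * Real.exp (μ * x)) →
      ∀ x ∈ Icc 0 T, ‖volterra N d x‖ ≤ D / 2 * Real.exp (μ * x) := by
  have hC0 : 0 ≤ C := (norm_nonneg _).trans (hC (0, T) le_rfl)
  refine ⟨2 * C + 1, by positivity, fun d D hD0 hD x hx => ?_⟩
  set μ := 2 * C + 1 with hμ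
  have hμ0 : 0 < μ := by positivity
  have hi : IntegrableOn (fun t => C * D * Real.exp (μ * t)) (Iic x) :=
    (integrableOn_exp_mul_Iic hμ0 x).const_mul _
  unfold volterra
  rw [intervalIntegral.integral_of_le hx.1]
  refine (norm_integral_le_of_norm_le (hi.mono_set Ioc_subset_Iic_self)
    ((ae_restrict_iff' measurableSet_Ioc).2 (Eventually.of_forall fun t ht => ?_))).trans
    ((setIntegral_mono_set hi (Eventually.of_forall fun t => ?_)
      Ioc_subset_Iic_self.eventuallyLE).trans ?_)
  · have htT : t ≤ T := ht.2.trans hx.2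
    rw [mul_assoc]
    exact ((N (x, t)).le_opNorm _).trans
      (mul_le_mul (hC _ htT) (hD t ⟨ht.1.le, htT⟩) (norm_nonneg _) hC0)
  · simp only [Pi.zero_apply]; positivity
  · rw [integral_const_mul, integral_exp_mul_Iic hμ0]
    have : C / μ ≤ 1 / 2 := by
      rw [div_le_div_iff₀ hμ0 (by norm_num)]
      linarith
    calc C * D * (Real.exp (μ * x) / μ) = C / μ * (D * Real.exp (μ * x)) := by ring
      _ ≤ 1 / 2 * (D * Real.exp (μ * x)) := by gcongr
      _ = D / 2 * Real.exp (μ * x) := by ring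

lemma eq_zero_of_eq_neg_volterra (hC : ∀ q : ℝ × ℝ, q.2 ≤ T → ‖N q‖ ≤ C) {d : ℝ → V}
    (hdi : IntegrableOn d (Ioc 0 T))
    (hd : ∀ᵐ x ∂volume.restrict (Ioc 0 T), d x = -volterra N d x) :
    ∀ᵐ x ∂volume.restrict (Ioc 0 T), d x = 0 := by
  obtain ⟨μ, hμ, h⟩ := exists_volterra_halving hC
  have hC0 : 0 ≤ C := (norm_nonneg _).trans (hC (0, T) le_rfl)
  -- An integrable `d` need not be bounded, and its equation holds only almost everywhere. Its
  -- representative `-Nd` is bounded and satisfies the equation at every point.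
  set d' : ℝ → V := fun x => -volterra N d x with hd'
  have hfix : ∀ x ∈ Icc 0 T, d' x = -volterra N d' x := fun x hx => by
    rw [← volterra_congr hd hx]
  have hz := eq_zero_of_halving (d := d') (w := fun x => Real.exp (μ * x)) (S := Icc 0 T)
    (C := C * ∫ t in Ioc 0 T, ‖d t‖)
    (fun x hx => by
      rw [hd', norm_neg]
      refine (norm_volterra_le hC hdi hx).trans (le_mul_of_one_le_right ?_ ?_)
      · exact mul_nonneg hC0 (integral_nonneg fun _ => norm_nonneg _)
      · exact Real.one_le_exp (mul_nonneg hμ.le hx.1))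
    (fun D hD x hx => by
      have hD0 : 0 ≤ D := nonneg_of_mul_nonneg_left ((norm_nonneg _).trans (hD x hx))
        (Real.exp_pos _)
      rw [hfix x hx, norm_neg]
      exact h d' D hD0 hD x hx)
  filter_upwards [hd, ae_restrict_mem measurableSet_Ioc] with x hx hxT
  rw [hx]
  exact hz x (Ioc_subset_Icc_self hxT)

lemma exists_volterra_solution [CompleteSpace V] (hN : StronglyMeasurable N)
    (hC : ∀ q : ℝ × ℝ, q.2 ≤ T → ‖N q‖ ≤ C) {b : ℝ → V} (hb : StronglyMeasurable b) {B : ℝ}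
    (hB : ∀ x ∈ Icc 0 T, ‖b x‖ ≤ B) :
    ∃ d : ℝ → V, StronglyMeasurable d ∧ (∃ D, ∀ x ∈ Icc 0 T, ‖d x‖ ≤ D) ∧
      ∀ x ∈ Icc 0 T, d x = b x - volterra N d x := by
  obtain ⟨μ, hμ, h⟩ := exists_volterra_halving hC
  have hint : ∀ (f : ℝ → V) (A : ℝ), StronglyMeasurable f →
      (∀ x, ‖f x‖ ≤ A * Real.exp (μ * x)) → IntegrableOn f (Ioc 0 T) := fun f A hf hA =>
    Integrable.mono' ((((integrableOn_exp_mul_Iic hμ T).mono_set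
      Ioc_subset_Iic_self).const_mul A)) hf.aestronglyMeasurable (Eventually.of_forall hA)
  -- The iteration is cut off outside `[0, T]`, the only range where the kernel estimate and the
  -- bound on `b` are available.
  obtain ⟨d, hd, ⟨A, hA⟩, hfix⟩ := exists_fixedPoint_of_halving
    (w := fun x => Real.exp (μ * x)) (C := max B 0)
    (Ψ := fun f : ℝ → V => (Icc 0 T).indicator fun x => b x - volterra N f x)
    (fun f A hf hA => by
      have : (Icc 0 T).indicator (fun x => b x - volterra N f x) =
          (Icc 0 T).indicator fun x => b x - (Ici 0).indicator (volterra N f) x :=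
        indicator_congr fun x hx => by rw [indicator_of_mem (show x ∈ Ici 0 from hx.1)]
      rw [this]
      exact (hb.sub (stronglyMeasurable_volterra hN hf)).indicator measurableSet_Icc)
    (fun f g A hf hg hfA hgA D hD x => by
      have hD0 : 0 ≤ D := nonneg_of_mul_nonneg_left ((norm_nonneg _).trans (hD x))
        (Real.exp_pos _)
      by_cases hx : x ∈ Icc 0 T
      swap
      · rw [indicator_of_notMem hx, indicator_of_notMem hx, sub_self, norm_zero]
        positivity
      rw [indicator_of_mem hx, indicator_of_mem hx, sub_sub_sub_cancel_left, norm_sub_rev]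
      have hs : Ioc 0 x ⊆ Ioc 0 T := Ioc_subset_Ioc_right hx.2
      have e : volterra N f x - volterra N g x = volterra N (fun t => f t - g t) x := by
        unfold volterra
        simp only [intervalIntegral.integral_of_le hx.1, map_sub]
        rw [integral_sub ((integrableOn_kernel_apply hN hC (hint f A hf hfA) x).mono_set hs)
          ((integrableOn_kernel_apply hN hC (hint g A hg hgA) x).mono_set hs)]
      rw [e]
      exact h _ D hD0 (fun t _ => hD t) x hx)
    (fun x => by
      by_cases hx : x ∈ Icc 0 T
      swap
      · rw [indicator_of_notMem hx, norm_zero]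
        positivity
      rw [indicator_of_mem hx]
      have : volterra N 0 x = 0 := by simp [volterra]
      rw [this, sub_zero]
      exact ((hB x hx).trans (le_max_left _ _)).trans (le_mul_of_one_le_right
        (le_max_right _ _) (Real.one_le_exp (mul_nonneg hμ.le hx.1))))
    (fun x => (Real.exp_pos _).le)
  refine ⟨d, hd, ⟨|A| * Real.exp (μ * T), fun x hx => (hA x).trans ?_⟩, fun x hx => ?_⟩
  · refine mul_le_mul (le_abs_self A) ?_ (Real.exp_pos _).le (abs_nonneg _)
    exact Real.exp_le_exp.2 (mul_le_mul_of_nonneg_left hx.2 hμ.le)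
  · rw [← hfix x, indicator_of_mem hx]

end VolterraInverse

/-! ### Uniqueness for the perturbed equation -/

section Uniqueness

variable {V W : Type*} [NormedAddCommGroup V] [NormedSpace ℂ V]
  [NormedAddCommGroup W] [NormedSpace ℂ W] {α : ℝ → W →L[ℂ] V} {γ : ℝ → V →L[ℂ] W} {T : ℝ}

/-- If `‖d(x)‖ ≤ D exp(μx)`, the inner integral is at most `I D exp(μs)`. Integrating against `α`
gains the small factor of `exists_exp_weight`, so `D` can be halved indefinitely. -/
lemma IsPrimitive.eq_zero_of_integral_equation (hα : StronglyMeasurable α)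
    (hα2 : Integrable fun x => ‖α x‖ ^ 2) (hγ1 : Integrable γ) {d : ℝ → V}
    (hT : 0 ≤ T) (hd : IsPrimitive T d fun x => -(α x (∫ t in (0 : ℝ)..x, γ t (d t))))
    (h0 : d 0 = 0) : ∀ x ∈ Icc 0 T, d x = 0 := by
  set I := ∫ s, ‖γ s‖ with hI
  have hI0 : 0 ≤ I := integral_nonneg fun _ => norm_nonneg _
  have hε : 0 < 1 / (2 * (I + 1)) := by positivity
  obtain ⟨μ, hμ, hw⟩ := exists_exp_weight hα.norm hα2 hε
  simp only [abs_norm] at hw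
  obtain ⟨B, hB⟩ := isCompact_Icc.exists_bound_of_continuousOn (hd.continuousOn hT)
  have hB0 : 0 ≤ B := (norm_nonneg _).trans (hB 0 ⟨le_rfl, hT⟩)
  refine eq_zero_of_halving (w := fun x => Real.exp (μ * x)) (C := B)
    (fun x hx => (hB x hx).trans (le_mul_of_one_le_right hB0
      (Real.one_le_exp (mul_nonneg hμ.le hx.1)))) fun D hD x hx => ?_
  have hD0 : 0 ≤ D := nonneg_of_mul_nonneg_left ((norm_nonneg _).trans (hD x hx))
    (Real.exp_pos _)
  have hin : ∀ s ∈ Icc 0 T, ‖∫ t in (0 : ℝ)..s, γ t (d t)‖ ≤ I * (D * Real.exp (μ * s)) :=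
    fun s hs => by
    have hi : Integrable fun t => ‖γ t‖ * (D * Real.exp (μ * s)) := hγ1.norm.mul_const _
    rw [intervalIntegral.integral_of_le hs.1, ← integral_mul_const]
    refine (norm_integral_le_of_norm_le hi.integrableOn
      ((ae_restrict_iff' measurableSet_Ioc).2 (Eventually.of_forall fun t ht => ?_))).trans
      (setIntegral_le_integral hi (Eventually.of_forall fun t => ?_))
    · refine ((γ t).le_opNorm _).trans (mul_le_mul_of_nonneg_left ?_ (norm_nonneg _))
      refine (hD t ⟨ht.1.le, ht.2.trans hs.2⟩).trans ?_
      have := ht.2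
      gcongr
    · simp only [Pi.zero_apply]; positivity
  have hi := (hw 0 x).1.const_mul (I * D)
  simp only [zero_add] at hi
  rw [hd.eq x hx, h0, zero_add, intervalIntegral.integral_of_le hx.1]
  refine (norm_integral_le_of_norm_le (IntegrableOn.mono_set hi Ioc_subset_Iic_self)
    ((ae_restrict_iff' measurableSet_Ioc).2 (Eventually.of_forall fun s hs => ?_))).trans
    ((setIntegral_mono_set hi (Eventually.of_forall fun t => ?_)
      Ioc_subset_Iic_self.eventuallyLE).trans ?_)
  · rw [norm_neg]
    refine ((α s).le_opNorm _).trans ((mul_le_mul_of_nonneg_left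
      (hin s ⟨hs.1.le, hs.2.trans hx.2⟩) (norm_nonneg _)).trans (le_of_eq (by ring)))
  · simp only [Pi.zero_apply]; positivity
  · have h2 := (hw 0 x).2
    simp only [zero_add] at h2
    rw [integral_const_mul]
    refine (mul_le_mul_of_nonneg_left h2 (by positivity)).trans ?_
    rw [← mul_assoc]
    refine mul_le_mul_of_nonneg_right ?_ (Real.exp_pos _).le
    have : I * (1 / (2 * (I + 1))) ≤ 1 / 2 := by
      rw [mul_one_div, div_le_div_iff₀ (by positivity) (by positivity)]
      linarith
    nlinarith

end Uniqueness

/-! ### Semi-separable operators as inverses -/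

section SemiSeparable

variable {V W : Type*} [NormedAddCommGroup V] [NormedSpace ℂ V] [CompleteSpace V]
  [NormedAddCommGroup W] [NormedSpace ℂ W] [CompleteSpace W] {T : ℝ}

/-- The semi-separable operator with `F G = 1`, `F' G = 0` inverts `d/dx + α ∫ γ`. -/
lemma isPrimitive_semiSeparable (hT : 0 ≤ T) {F F' : ℝ → W →L[ℂ] V} {G G' : ℝ → V →L[ℂ] W}
    {Φ Ψ : ℝ → W →L[ℂ] W} (hF : IsPrimitive T F F') (hG : IsPrimitive T G G')
    (hΨ : IsPrimitive T Ψ fun x => Ψ x ∘L (G x ∘L F' x))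
    (hFG : ∀ x ∈ Icc 0 T, F x ∘L G x = ContinuousLinearMap.id ℂ V)
    (hF'G : ∀ x ∈ Ioc 0 T, F' x ∘L G x = 0)
    (hΦΨ : ∀ x ∈ Ioc 0 T, Φ x ∘L Ψ x = ContinuousLinearMap.id ℂ W)
    {f : ℝ → V} (hf : IntegrableOn f (Ioc 0 T)) :
    IsPrimitive T (fun x => F x (∫ t in (0 : ℝ)..x, G t (f t))) fun x =>
      f x - (F' x ∘L Φ x) (∫ t in (0 : ℝ)..x, (Ψ t ∘L G' t)
        (F t (∫ s in (0 : ℝ)..t, G s (f s)))) := by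
  have hGf : IntegrableOn (fun t => G t (f t)) (Ioc 0 T) :=
    IsPrimitive.of_continuousOn_bilin_integrable
      ((ContinuousLinearMap.id ℂ (V →L[ℂ] W)).bilinearRestrictScalars ℝ) (hG.continuousOn hT) hf
  set u : ℝ → W := fun x => ∫ t in (0 : ℝ)..x, G t (f t) with hu
  have hup : IsPrimitive T u fun t => G t (f t) := ⟨hGf, fun x _ => by simp [hu]⟩
  have hg := hF.apply hT hup
  -- Here `g = Fu`. The derivative of `Ψ(u - Gg)` collapses to `-ΨG'g`: the terms `ΨGF'u` cancel,
  -- `F'G = 0` removes one more, and `FG = 1` cancels those with `f`.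
  have hz := (hΨ.apply hT (hup.sub (hG.apply hT hg)))
  have hFGv : ∀ x ∈ Icc 0 T, ∀ v, F x (G x v) = v := fun x hx v =>
    DFunLike.congr_fun (hFG x hx) v
  have hF'Gv : ∀ x ∈ Ioc 0 T, ∀ v, F' x (G x v) = 0 := fun x hx v =>
    DFunLike.congr_fun (hF'G x hx) v
  have hz' : ∀ x ∈ Icc 0 T, ∫ t in (0 : ℝ)..x, (Ψ t ∘L G' t) (F t (u t)) =
      -(Ψ x (u x - G x (F x (u x)))) := fun x hx => by
    have h1 := hz.eq x hx
    have hu0 : u 0 = 0 := by simp [hu]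
    rw [hu0] at h1
    simp only [map_zero, sub_zero, zero_add] at h1
    rw [h1, ← intervalIntegral.integral_neg]
    refine intervalIntegral.integral_congr_ae (Eventually.of_forall fun t ht => ?_)
    rw [uIoc_of_le hx.1] at ht
    have ht' : t ∈ Ioc 0 T := ⟨ht.1, ht.2.trans hx.2⟩
    simp only [ContinuousLinearMap.comp_apply, map_sub, map_add, hF'Gv t ht',
      hFGv t (Ioc_subset_Icc_self ht'), map_zero]
    abel
  refine hg.congr (fun x _ => rfl) fun x hx => ?_
  -- Applying `F'` annihilates `Gg`, so the claimed derivative reduces to `f + F'u`, which is the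
  -- product rule for `Fu`.
  have hΦv : Φ x (Ψ x (u x - G x (F x (u x)))) = u x - G x (F x (u x)) :=
    DFunLike.congr_fun (hΦΨ x hx) _
  rw [hz' x (Ioc_subset_Icc_self hx), ContinuousLinearMap.comp_apply, map_neg, hΦv,
    hFGv x (Ioc_subset_Icc_self hx), map_neg, map_sub, hF'Gv x hx]
  abel

end SemiSeparable

/-! ### Normalization to `PQ = 1`, `P'Q = 0` -/

section Normalization

/-- Constant extension past the end points gives a continuous function on the line, which is then
cut off. -/
lemma stronglyMeasurable_indicator_of_continuousOn {E : Type*} [NormedAddCommGroup E] {T : ℝ}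
    (hT : 0 ≤ T) {f : ℝ → E} (hf : ContinuousOn f (Icc 0 T)) :
    StronglyMeasurable ((Ioc 0 T).indicator f) := by
  have hc : Continuous (IccExtend hT ((Icc 0 T).domRestrict f)) :=
    (continuousOn_iff_continuous_domRestrict.1 hf).Icc_extend'
  have : (Ioc 0 T).indicator f = (Ioc 0 T).indicator (IccExtend hT ((Icc 0 T).domRestrict f)) :=
    indicator_congr fun x hx => by
      rw [IccExtend_of_mem _ _ (Ioc_subset_Icc_self hx)]
      rfl
  rw [this]
  exact hc.stronglyMeasurable.indicator measurableSet_Ioc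

lemma integrable_sq_of_norm_le {E F : Type*} [NormedAddCommGroup E] [NormedAddCommGroup F]
    {T C : ℝ} {X : ℝ → E} {Y : ℝ → F} (hX : StronglyMeasurable X)
    (hY : IntegrableOn (fun x => ‖Y x‖ ^ 2) (Ioc 0 T)) (hX0 : ∀ x ∉ Ioc 0 T, X x = 0)
    (h : ∀ x ∈ Ioc 0 T, ‖X x‖ ≤ C * ‖Y x‖) : Integrable fun x => ‖X x‖ ^ 2 := by
  have h0 : (fun x => ‖X x‖ ^ 2) = (Ioc 0 T).indicator fun x => ‖X x‖ ^ 2 :=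
    (indicator_eq_self.2 fun x hx => by_contra fun hxT => hx (by simp [hX0 x hxT])).symm
  rw [h0]
  refine (integrable_indicator_iff measurableSet_Ioc).2 (Integrable.mono'
    (hY.const_mul (C ^ 2)) (hX.norm.pow 2).aestronglyMeasurable
    ((ae_restrict_iff' measurableSet_Ioc).2 (Eventually.of_forall fun x hx => ?_)))
  rw [Real.norm_of_nonneg (by positivity), ← mul_pow]
  exact pow_le_pow_left₀ (norm_nonneg _) (h x hx) 2

lemma comp_eq_id_comm {V : Type*} [NormedAddCommGroup V] [NormedSpace ℂ V]
    [FiniteDimensional ℂ V] {a b : V →L[ℂ] V} (h : a ∘L b = ContinuousLinearMap.id ℂ V) :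
    b ∘L a = ContinuousLinearMap.id ℂ V := by
  have h1 : (a : V →ₗ[ℂ] V) * (b : V →ₗ[ℂ] V) = 1 := by
    ext v
    exact DFunLike.congr_fun h v
  have h2 := mul_eq_one_symm h1
  ext v
  exact DFunLike.congr_fun h2 v

variable {V W : Type*} [NormedAddCommGroup V] [NormedSpace ℂ V] [CompleteSpace V]
  [FiniteDimensional ℂ V] [NormedAddCommGroup W] [NormedSpace ℂ W] [CompleteSpace W]
  [FiniteDimensional ℂ W] {T : ℝ}

/-- After conjugation with the solution `ρ` of `ρ' = F' G ρ`, the semi-separable operator is the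
inverse of an operator `d/dx + α ∫ γ`. -/
theorem exists_normalization (hT : 0 < T) {F F' : ℝ → W →L[ℂ] V} {G G' : ℝ → V →L[ℂ] W}
    (hF : IsPrimitive T F F') (hF'm : StronglyMeasurable F')
    (hF'2 : IntegrableOn (fun x => ‖F' x‖ ^ 2) (Ioc 0 T))
    (hG : IsPrimitive T G G') (hG'm : StronglyMeasurable G')
    (hG'2 : IntegrableOn (fun x => ‖G' x‖ ^ 2) (Ioc 0 T))
    (hFG : ∀ x ∈ Icc 0 T, F x ∘L G x = ContinuousLinearMap.id ℂ V) :
    ∃ (ρ σ : ℝ → V →L[ℂ] V) (α : ℝ → W →L[ℂ] V) (γ : ℝ → V →L[ℂ] W),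
      StronglyMeasurable ρ ∧ StronglyMeasurable σ ∧ ρ 0 = ContinuousLinearMap.id ℂ V ∧
      (∀ x, σ x ∘L ρ x = ContinuousLinearMap.id ℂ V) ∧
      (∀ x, ρ x ∘L σ x = ContinuousLinearMap.id ℂ V) ∧
      IsPrimitive T ρ (fun x => F' x ∘L G x ∘L ρ x) ∧
      IsPrimitive T σ (fun x => -(σ x ∘L F' x ∘L G x)) ∧
      StronglyMeasurable α ∧ Integrable (fun x => ‖α x‖ ^ 2) ∧ (∀ x ∉ Ioc 0 T, α x = 0) ∧
      StronglyMeasurable γ ∧ Integrable (fun x => ‖γ x‖ ^ 2) ∧ (∀ x ∉ Ioc 0 T, γ x = 0) ∧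
      ∀ f : ℝ → V, IntegrableOn f (Ioc 0 T) →
        IsPrimitive T (fun x => σ x (F x (∫ t in (0 : ℝ)..x, G t (ρ t (f t))))) fun x =>
          f x - α x (∫ t in (0 : ℝ)..x,
            γ t (σ t (F t (∫ s in (0 : ℝ)..t, G s (ρ s (f s)))))) := by
  have hFc := hF.continuousOn hT.le
  have hGc := hG.continuousOn hT.le
  -- Nothing is known of `F` and `G` outside the interval, while the linear equation is solved with
  -- coefficients measurable and square-integrable on the whole line.
  set Fi := (Ioc 0 T).indicator F with hFi
  set Gi := (Ioc 0 T).indicator G with hGi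
  have hFim : StronglyMeasurable Fi := stronglyMeasurable_indicator_of_continuousOn hT.le hFc
  have hGim : StronglyMeasurable Gi := stronglyMeasurable_indicator_of_continuousOn hT.le hGc
  have hFie : ∀ x ∈ Ioc 0 T, Fi x = F x := fun x hx => indicator_of_mem hx F
  have hGie : ∀ x ∈ Ioc 0 T, Gi x = G x := fun x hx => indicator_of_mem hx G
  have hGi0 : ∀ x ∉ Ioc 0 T, Gi x = 0 := fun x hx => indicator_of_notMem hx G
  obtain ⟨CF, hCF⟩ := isCompact_Icc.exists_bound_of_continuousOn hFc
  obtain ⟨CG, hCG⟩ := isCompact_Icc.exists_bound_of_continuousOn hGc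
  have hT0 : (0 : ℝ) ∈ Icc 0 T := ⟨le_rfl, hT.le⟩
  have hCF0 : 0 ≤ CF := (norm_nonneg _).trans (hCF 0 hT0)
  have hCG0 : 0 ≤ CG := (norm_nonneg _).trans (hCG 0 hT0)
  -- the function `ρ`
  set B₁ : ℝ → V →L[ℂ] V := fun x => F' x ∘L Gi x with hB₁
  have hB₁m : StronglyMeasurable B₁ := stronglyMeasurable_comp hF'm hGim
  have hB₁2 : Integrable fun x => ‖B₁ x‖ ^ 2 :=
    integrable_sq_of_norm_le (C := CG) hB₁m hF'2 (fun x hx => by simp [hB₁, hGi0 x hx])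
      fun x hx => by
        have h1 := hCG x (Ioc_subset_Icc_self hx)
        simp only [hB₁, hGie x hx]
        refine (ContinuousLinearMap.opNorm_comp_le _ _).trans ?_
        rw [mul_comm]
        gcongr
  obtain ⟨ρ, σ, hρm, hσm, hρ0, hσ0, hσρ, hρp, hσp⟩ := exists_fundamental_solution hB₁m hB₁2
  have hρσ : ∀ x, ρ x ∘L σ x = ContinuousLinearMap.id ℂ V := fun x => comp_eq_id_comm (hσρ x)
  have hρp' : IsPrimitive T ρ (fun x => F' x ∘L G x ∘L ρ x) :=
    (hρp T).congr (fun x _ => rfl) fun x hx => by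
      simp only [hB₁, hGie x hx]
      rfl
  have hσp' : IsPrimitive T σ (fun x => -(σ x ∘L F' x ∘L G x)) :=
    (hσp T).congr (fun x _ => rfl) fun x hx => by
      simp only [hB₁, hGie x hx]
      rfl
  obtain ⟨Cρ, hCρ⟩ := isCompact_Icc.exists_bound_of_continuousOn (hρp'.continuousOn hT.le)
  obtain ⟨Cσ, hCσ⟩ := isCompact_Icc.exists_bound_of_continuousOn (hσp'.continuousOn hT.le)
  have hCρ0 : 0 ≤ Cρ := (norm_nonneg _).trans (hCρ 0 hT0)
  have hCσ0 : 0 ≤ Cσ := (norm_nonneg _).trans (hCσ 0 hT0)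
  -- the normalised pair
  set P' : ℝ → W →L[ℂ] V := (Ioc 0 T).indicator fun x =>
    σ x ∘L (F' x - (F' x ∘L Gi x) ∘L Fi x) with hP'
  have hP'm : StronglyMeasurable P' :=
    (stronglyMeasurable_comp hσm (hF'm.sub (stronglyMeasurable_comp
      (stronglyMeasurable_comp hF'm hGim) hFim))).indicator measurableSet_Ioc
  have hP'e : ∀ x ∈ Ioc 0 T, P' x = σ x ∘L (F' x - (F' x ∘L G x) ∘L F x) := fun x hx => by
    rw [hP', indicator_of_mem hx, hFie x hx, hGie x hx]
  have hP'0 : ∀ x ∉ Ioc 0 T, P' x = 0 := fun x hx => indicator_of_notMem hx _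
  set Q' : ℝ → V →L[ℂ] W := (Ioc 0 T).indicator fun x =>
    (G' x + Gi x ∘L (F' x ∘L Gi x)) ∘L ρ x with hQ'
  have hQ'm : StronglyMeasurable Q' :=
    (stronglyMeasurable_comp (hG'm.add (stronglyMeasurable_comp hGim
      (stronglyMeasurable_comp hF'm hGim))) hρm).indicator measurableSet_Ioc
  have hQ'e : ∀ x ∈ Ioc 0 T, Q' x = (G' x + G x ∘L (F' x ∘L G x)) ∘L ρ x := fun x hx => by
    rw [hQ', indicator_of_mem hx, hGie x hx]
  have hQ'0 : ∀ x ∉ Ioc 0 T, Q' x = 0 := fun x hx => indicator_of_notMem hx _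
  have hP : IsPrimitive T (fun x => σ x ∘L F x) P' :=
    (hσp'.comp hT.le hF).congr (fun x _ => rfl) fun x hx => by
      rw [hP'e x hx]
      ext v
      simp only [ContinuousLinearMap.comp_apply, sub_apply, add_apply, neg_apply, map_sub]
      abel
  have hQ : IsPrimitive T (fun x => G x ∘L ρ x) Q' :=
    (hG.comp hT.le hρp').congr (fun x _ => rfl) fun x hx => by
      rw [hQ'e x hx]
      ext v
      simp only [ContinuousLinearMap.comp_apply, add_apply]
  have hFGv : ∀ x ∈ Icc 0 T, ∀ v, F x (G x v) = v := fun x hx v =>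
    DFunLike.congr_fun (hFG x hx) v
  have hPQ : ∀ x ∈ Icc 0 T, (σ x ∘L F x) ∘L (G x ∘L ρ x) = ContinuousLinearMap.id ℂ V :=
    fun x hx => by
      ext v
      simp only [ContinuousLinearMap.comp_apply, hFGv x hx]
      exact DFunLike.congr_fun (hσρ x) v
  -- The purpose of `ρ`: `σ(F' - F'GF)Gρ = 0` because `FG = 1`.
  have hP'Q : ∀ x ∈ Ioc 0 T, P' x ∘L (G x ∘L ρ x) = 0 := fun x hx => by
    rw [hP'e x hx]
    ext v
    simp [hFGv x (Ioc_subset_Icc_self hx)]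
  -- the second linear equation
  set B₂ : ℝ → W →L[ℂ] W := fun x => -((Gi x ∘L ρ x) ∘L P' x) with hB₂
  have hB₂m : StronglyMeasurable B₂ :=
    (stronglyMeasurable_comp (stronglyMeasurable_comp hGim hρm) hP'm).neg
  have hP'2 : Integrable fun x => ‖P' x‖ ^ 2 :=
    integrable_sq_of_norm_le (C := Cσ * (1 + CG * CF)) hP'm hF'2 hP'0 fun x hx => by
      have hx' := Ioc_subset_Icc_self hx
      rw [hP'e x hx]
      calc ‖σ x ∘L (F' x - (F' x ∘L G x) ∘L F x)‖
          ≤ ‖σ x‖ * (‖F' x‖ + ‖F' x‖ * ‖G x‖ * ‖F x‖) := by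
            refine (ContinuousLinearMap.opNorm_comp_le _ _).trans ?_
            gcongr
            refine (norm_sub_le _ _).trans ?_
            gcongr
            refine (ContinuousLinearMap.opNorm_comp_le _ _).trans ?_
            gcongr
            exact ContinuousLinearMap.opNorm_comp_le _ _
        _ ≤ Cσ * (‖F' x‖ + ‖F' x‖ * CG * CF) := by
            have h1 := hCσ x hx'
            have h2 := hCG x hx'
            have h3 := hCF x hx'
            gcongr
        _ = Cσ * (1 + CG * CF) * ‖F' x‖ := by ring
  have hQ'2 : Integrable fun x => ‖Q' x‖ ^ 2 := by
    have hsum : IntegrableOn (fun x => ‖(‖G' x‖ + CG * CG * ‖F' x‖ : ℝ)‖ ^ 2) (Ioc 0 T) := by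
      refine Integrable.mono' (((hG'2.const_mul 2).add (hF'2.const_mul (2 * (CG * CG) ^ 2))))
        ?_ (Eventually.of_forall fun x => ?_)
      · exact ((hG'm.norm.add (hF'm.norm.const_mul _)).norm.pow 2).aestronglyMeasurable
      · rw [Real.norm_of_nonneg (by positivity), Real.norm_of_nonneg (by positivity)]
        simp only [Pi.add_apply]
        nlinarith [sq_nonneg (‖G' x‖ - CG * CG * ‖F' x‖)]
    refine integrable_sq_of_norm_le (C := Cρ) hQ'm hsum hQ'0 fun x hx => ?_
    have hx' := Ioc_subset_Icc_self hx
    rw [hQ'e x hx, Real.norm_of_nonneg (by positivity)]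
    calc ‖(G' x + G x ∘L (F' x ∘L G x)) ∘L ρ x‖
        ≤ (‖G' x‖ + ‖G x‖ * (‖F' x‖ * ‖G x‖)) * ‖ρ x‖ := by
          refine (ContinuousLinearMap.opNorm_comp_le _ _).trans ?_
          gcongr
          refine (norm_add_le _ _).trans ?_
          gcongr
          refine (ContinuousLinearMap.opNorm_comp_le _ _).trans ?_
          gcongr
          exact ContinuousLinearMap.opNorm_comp_le _ _
      _ ≤ (‖G' x‖ + CG * (‖F' x‖ * CG)) * Cρ := by
          have h1 := hCρ x hx'
          have h2 := hCG x hx'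
          gcongr
      _ = Cρ * (‖G' x‖ + CG * CG * ‖F' x‖) := by ring
  have hB₂2 : Integrable fun x => ‖B₂ x‖ ^ 2 :=
    integrable_sq_of_norm_le (C := CG * Cρ) hB₂m hP'2.integrableOn
      (fun x hx => by simp [hB₂, hGi0 x hx]) fun x hx => by
        have h1 := hCG x (Ioc_subset_Icc_self hx)
        have h2 := hCρ x (Ioc_subset_Icc_self hx)
        simp only [hB₂, hGie x hx, norm_neg]
        refine (ContinuousLinearMap.opNorm_comp_le _ _).trans ?_
        gcongr
        refine (ContinuousLinearMap.opNorm_comp_le _ _).trans ?_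
        gcongr
  obtain ⟨Φ, Ψ, hΦm, hΨm, hΦ0, hΨ0, hΨΦ, hΦp, hΨp⟩ := exists_fundamental_solution hB₂m hB₂2
  have hΦΨ : ∀ x ∈ Ioc 0 T, Φ x ∘L Ψ x = ContinuousLinearMap.id ℂ W := fun x _ =>
    comp_eq_id_comm (hΨΦ x)
  have hΨp' : IsPrimitive T Ψ fun x => Ψ x ∘L ((G x ∘L ρ x) ∘L P' x) :=
    (hΨp T).congr (fun x _ => rfl) fun x hx => by
      simp only [hB₂, hGie x hx, mul_neg, neg_neg]
      rfl
  obtain ⟨CΦ, hCΦ⟩ := isCompact_Icc.exists_bound_of_continuousOn ((hΦp T).continuousOn hT.le)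
  obtain ⟨CΨ, hCΨ⟩ := isCompact_Icc.exists_bound_of_continuousOn ((hΨp T).continuousOn hT.le)
  -- Variation of constants dictates `α = P'Φ` and `γ = ΨQ'`; both stay square-summable since `Φ`
  -- and `Ψ` are bounded on the interval.
  have hαm : StronglyMeasurable fun x => P' x ∘L Φ x := stronglyMeasurable_comp hP'm hΦm
  have hγm : StronglyMeasurable fun x => Ψ x ∘L Q' x := stronglyMeasurable_comp hΨm hQ'm
  refine ⟨ρ, σ, fun x => P' x ∘L Φ x, fun x => Ψ x ∘L Q' x, hρm, hσm, hρ0, hσρ, hρσ, hρp', hσp',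
    hαm, ?_, fun x hx => by simp [hP'0 x hx], hγm, ?_, fun x hx => by simp [hQ'0 x hx],
    fun f hf => ?_⟩
  · refine integrable_sq_of_norm_le (T := T) (C := CΦ) hαm hP'2.integrableOn
      (fun x hx => by simp [hP'0 x hx]) fun x hx => ?_
    have h1 := hCΦ x (Ioc_subset_Icc_self hx)
    refine (ContinuousLinearMap.opNorm_comp_le _ _).trans ?_
    rw [mul_comm]
    gcongr
  · refine integrable_sq_of_norm_le (T := T) (C := CΨ) hγm hQ'2.integrableOn
      (fun x hx => by simp [hQ'0 x hx]) fun x hx => ?_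
    have h1 := hCΨ x (Ioc_subset_Icc_self hx)
    refine (ContinuousLinearMap.opNorm_comp_le _ _).trans ?_
    gcongr
  · exact isPrimitive_semiSeparable hT.le hP hQ hΨp' hPQ hP'Q hΦΨ hf

end Normalization

/-! ### The class of functions with square-summable derivative -/

lemma ae_Ioo_of_ae_restrict_Ioc {T : ℝ} {P : ℝ → Prop} (h : ∀ᵐ x, x ∈ Ioo 0 T → P x) :
    ∀ᵐ x ∂volume.restrict (Ioc 0 T), P x := by
  have hne : ∀ᵐ x : ℝ, x ≠ T := by simp [ae_iff, measure_singleton]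
  rw [ae_restrict_iff' measurableSet_Ioc]
  filter_upwards [h, hne] with x h1 h2 hx
  exact h1 ⟨hx.1, lt_of_le_of_ne hx.2 h2⟩

/-- Real and imaginary parts have smaller increments, so the real theorem applies to each. -/
lemma ae_differentiableAt_of_absolutelyContinuous {f : ℝ → ℂ} {a b : ℝ}
    (hf : AbsolutelyContinuousOnInterval f a b) :
    ∀ᵐ x : ℝ, x ∈ uIcc a b → DifferentiableAt ℝ f x := by
  have hre : AbsolutelyContinuousOnInterval (fun x => (f x).re) a b :=
    absolutelyContinuousOnInterval_of_dist_le (C := 1) hf fun x _ y _ => by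
      rw [Real.dist_eq, dist_eq_norm, one_mul, ← Complex.sub_re]
      exact Complex.abs_re_le_norm _
  have him : AbsolutelyContinuousOnInterval (fun x => (f x).im) a b :=
    absolutelyContinuousOnInterval_of_dist_le (C := 1) hf fun x _ y _ => by
      rw [Real.dist_eq, dist_eq_norm, one_mul, ← Complex.sub_im]
      exact Complex.abs_im_le_norm _
  filter_upwards [hre.ae_differentiableAt, him.ae_differentiableAt] with x h1 h2 hx
  have e : f = fun x => ((f x).re : ℂ) + ((f x).im : ℂ) * Complex.I := by
    ext x
    exact (Complex.re_add_im (f x)).symm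
  rw [e]
  exact ((h1 hx).hasDerivAt.ofReal_comp.differentiableAt).add
    ((h2 hx).hasDerivAt.ofReal_comp.differentiableAt.mul_const _)

lemma HasL2Deriv.isPrimitive {T : ℝ} (hT : 0 ≤ T) {f : ℝ → ℂ} (hf : HasL2Deriv T f) :
    IsPrimitive T f (deriv f) := by
  refine .of_absolutelyContinuous hT hf.absCont (hf.memLp.integrable (by norm_num)) ?_
  filter_upwards [ae_differentiableAt_of_absolutelyContinuous hf.absCont] with x hx hx0
  exact (hx (by rw [uIcc_of_le hT]; exact Ioo_subset_Icc_self hx0)).hasDerivAt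

/-- Together with `HasL2Deriv.isPrimitive`, this identifies the two descriptions of the class, so
that all calculus can be done with primitives. -/
lemma IsPrimitive.hasL2Deriv {T : ℝ} (hT : 0 ≤ T) {f f' : ℝ → ℂ} (hf : IsPrimitive T f f')
    (hf' : MemLp f' 2 (volume.restrict (Ioc 0 T))) : HasL2Deriv T f := by
  refine ⟨hf.absolutelyContinuous hT, hf'.ae_eq ?_⟩
  filter_upwards [ae_Ioo_of_ae_restrict_Ioc (hf.hasDerivAt hT)] with x hx
  exact hx.deriv.symm

lemma isPrimitive_sum_smul {ι E : Type*} [Fintype ι] [NormedAddCommGroup E] [NormedSpace ℂ E]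
    [CompleteSpace E] {T : ℝ} {X X' : ι → ℝ → ℂ} (hX : ∀ i, IsPrimitive T (X i) (X' i))
    (e : ι → E) : IsPrimitive T (fun x => ∑ i, X i x • e i) fun x => ∑ i, X' i x • e i := by
  have h : ∀ i, IsPrimitive T (fun x => X i x • e i) fun x => X' i x • e i := fun i =>
    (hX i).clm ((ContinuousLinearMap.toSpanSingleton ℂ (e i)).restrictScalars ℝ)
  refine ⟨integrable_finsetSum _ fun i _ => (h i).integrableOn, fun x hx => ?_⟩
  rw [intervalIntegral.integral_finsetSum fun i _ => (h i).intervalIntegrable_left hx,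
    ← Finset.sum_add_distrib]
  exact Finset.sum_congr rfl fun i _ => (h i).eq x hx

lemma memLp_sum_smul {ι E : Type*} [Fintype ι] [NormedAddCommGroup E] [NormedSpace ℂ E]
    {μ : Measure ℝ} {X : ι → ℝ → ℂ} (hX : ∀ i, MemLp (X i) 2 μ) (e : ι → E) :
    MemLp (fun x => ∑ i, X i x • e i) 2 μ :=
  memLp_finsetSum _ fun i _ => (ContinuousLinearMap.toSpanSingleton ℂ (e i)).comp_memLp' (hX i)

lemma IsPrimitive.congr_ae {E : Type*} [NormedAddCommGroup E] [NormedSpace ℝ E] {T : ℝ}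
    {X X' Z' : ℝ → E} (hX : IsPrimitive T X X')
    (h : X' =ᵐ[volume.restrict (Ioc 0 T)] Z') : IsPrimitive T X Z' := by
  refine ⟨hX.integrableOn.congr h, fun x hx => ?_⟩
  rw [hX.eq x hx, intervalIntegral.integral_of_le hx.1, intervalIntegral.integral_of_le hx.1]
  congr 1
  exact integral_congr_ae (ae_mono (Measure.restrict_mono (Ioc_subset_Ioc_right hx.2) le_rfl) h)

/-! ### Vector functions -/

section Vector

variable {n : ℕ} {T : ℝ}

lemma exists_isPrimitive_of_hasL2Deriv (hT : 0 ≤ T) {φ : ℝ → EuclideanSpace ℂ (Fin n)}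
    (hφ : ∀ i, HasL2Deriv T fun x => φ x i) :
    ∃ φ' : ℝ → EuclideanSpace ℂ (Fin n), StronglyMeasurable φ' ∧
      MemLp φ' 2 (volume.restrict (Ioc 0 T)) ∧ IsPrimitive T φ φ' := by
  refine ⟨fun x => ∑ i, deriv (fun s => φ s i) x • EuclideanSpace.single i (1 : ℂ), ?_, ?_, ?_⟩
  · refine Finset.stronglyMeasurable_fun_sum _ fun i _ => ?_
    exact (measurable_deriv _).stronglyMeasurable.smul_const _
  · exact memLp_sum_smul (fun i => (hφ i).memLp) _
  · refine (isPrimitive_sum_smul (fun i => (hφ i).isPrimitive hT)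
      fun i => EuclideanSpace.single i (1 : ℂ)).congr (fun x _ => ?_) fun x _ => rfl
    ext j
    simp [Finset.sum_apply, Pi.single_apply]

lemma hasL2Deriv_of_isPrimitive (hT : 0 ≤ T) {φ φ' : ℝ → EuclideanSpace ℂ (Fin n)}
    (hφ : IsPrimitive T φ φ') (hφ' : MemLp φ' 2 (volume.restrict (Ioc 0 T))) (i : Fin n) :
    HasL2Deriv T fun x => φ x i :=
  (hφ.clm ((EuclideanSpace.proj (𝕜 := ℂ) i).restrictScalars ℝ)).hasL2Deriv hT
    ((EuclideanSpace.proj (𝕜 := ℂ) i).comp_memLp' hφ')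

end Vector

/-! ### Matrices as continuous linear maps -/

section Matrices

variable {l m n : ℕ}

/-- Matrices as continuous linear maps between Euclidean spaces. -/
noncomputable def matCLM : Matrix (Fin m) (Fin n) ℂ ≃ₗ[ℂ]
    (EuclideanSpace ℂ (Fin n) →L[ℂ] EuclideanSpace ℂ (Fin m)) :=
  (Matrix.toLpLin 2 2).trans LinearMap.toContinuousLinearMap

lemma matCLM_apply (M : Matrix (Fin m) (Fin n) ℂ) (v : EuclideanSpace ℂ (Fin n)) :
    matCLM M v = act M v := rfl

lemma act_symm_matCLM (A : EuclideanSpace ℂ (Fin n) →L[ℂ] EuclideanSpace ℂ (Fin m))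
    (v : EuclideanSpace ℂ (Fin n)) : act (matCLM.symm A) v = A v := by
  rw [← matCLM_apply, LinearEquiv.apply_symm_apply]

lemma matCLM_mul (A : Matrix (Fin l) (Fin m) ℂ) (B : Matrix (Fin m) (Fin n) ℂ) :
    matCLM (A * B) = matCLM A ∘L matCLM B := by
  ext v i
  simp [matCLM_apply, act, Matrix.mulVec_mulVec]

lemma matCLM_one : matCLM (1 : Matrix (Fin n) (Fin n) ℂ) = ContinuousLinearMap.id ℂ _ := by
  ext v i
  simp [matCLM_apply, act]

/-- The entry of the matrix of a continuous linear map. -/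
noncomputable def entryCLM (i : Fin m) (j : Fin n) :
    (EuclideanSpace ℂ (Fin n) →L[ℂ] EuclideanSpace ℂ (Fin m)) →L[ℂ] ℂ :=
  (EuclideanSpace.proj i) ∘L
    (ContinuousLinearMap.apply ℂ (EuclideanSpace ℂ (Fin m)) (EuclideanSpace.single j (1 : ℂ)))

lemma entryCLM_matCLM (M : Matrix (Fin m) (Fin n) ℂ) (i : Fin m) (j : Fin n) :
    entryCLM i j (matCLM M) = M i j := by
  simp [entryCLM, matCLM_apply, act]

lemma symm_matCLM_apply (A : EuclideanSpace ℂ (Fin n) →L[ℂ] EuclideanSpace ℂ (Fin m))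
    (i : Fin m) (j : Fin n) : matCLM.symm A i j = entryCLM i j A := by
  have h := entryCLM_matCLM (matCLM.symm A) i j
  rw [LinearEquiv.apply_symm_apply] at h
  exact h.symm

lemma norm_symm_matCLM_le (A : EuclideanSpace ℂ (Fin n) →L[ℂ] EuclideanSpace ℂ (Fin m))
    (i : Fin m) (j : Fin n) : ‖matCLM.symm A i j‖ ≤ ‖A‖ := by
  rw [symm_matCLM_apply]
  refine (PiLp.norm_apply_le (A (EuclideanSpace.single j (1 : ℂ))) i).trans ?_
  simpa using A.le_opNorm (EuclideanSpace.single j (1 : ℂ))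

/-- The expansion in matrix units transfers entrywise calculus to operator-valued functions. -/
lemma matCLM_eq_sum (M : Matrix (Fin m) (Fin n) ℂ) :
    matCLM M = ∑ q : Fin m × Fin n, M q.1 q.2 • matCLM (Matrix.single q.1 q.2 (1 : ℂ)) := by
  conv_lhs => rw [Matrix.matrix_eq_sum_single M]
  simp only [map_sum]
  rw [Fintype.sum_prod_type]
  refine Finset.sum_congr rfl fun i _ => Finset.sum_congr rfl fun j _ => ?_
  rw [← map_smul, Matrix.smul_single, smul_eq_mul, mul_one]

lemma measurable_symm_matCLM {X : Type*} [MeasurableSpace X]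
    {A : X → EuclideanSpace ℂ (Fin n) →L[ℂ] EuclideanSpace ℂ (Fin m)}
    (hA : StronglyMeasurable A) (i : Fin m) (j : Fin n) :
    Measurable fun x => matCLM.symm (A x) i j := by
  simp_rw [symm_matCLM_apply]
  exact ((entryCLM i j).continuous.comp_stronglyMeasurable hA).measurable

variable {T : ℝ} {Φ : ℝ → Matrix (Fin m) (Fin n) ℂ}

lemma MatHasL2Deriv.isPrimitive (hT : 0 ≤ T) (hΦ : MatHasL2Deriv T Φ) :
    IsPrimitive T (fun x => matCLM (Φ x)) fun x => matCLM (matDeriv Φ x) := by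
  refine (isPrimitive_sum_smul (fun q : Fin m × Fin n => (hΦ q.1 q.2).isPrimitive hT)
    fun q => matCLM (Matrix.single q.1 q.2 (1 : ℂ))).congr (fun x _ => ?_) fun x _ => ?_
  · rw [matCLM_eq_sum]
  · rw [matCLM_eq_sum]
    rfl

lemma stronglyMeasurable_matDeriv : StronglyMeasurable fun x => matCLM (matDeriv Φ x) := by
  rw [funext fun x => matCLM_eq_sum (matDeriv Φ x)]
  refine Finset.stronglyMeasurable_fun_sum _ fun q _ => ?_
  exact (measurable_deriv _).stronglyMeasurable.smul_const _

lemma MatHasL2Deriv.memLp (hΦ : MatHasL2Deriv T Φ) :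
    MemLp (fun x => matCLM (matDeriv Φ x)) 2 (volume.restrict (Ioc 0 T)) := by
  rw [funext fun x => matCLM_eq_sum (matDeriv Φ x)]
  have h : ∀ q : Fin m × Fin n,
      MemLp (fun x => matDeriv Φ x q.1 q.2) 2 (volume.restrict (Ioc 0 T)) := fun q =>
    (hΦ q.1 q.2).memLp
  exact memLp_sum_smul (X := fun (q : Fin m × Fin n) x => matDeriv Φ x q.1 q.2) h
    fun q => matCLM (Matrix.single q.1 q.2 (1 : ℂ))

lemma continuousOn_symm_matCLM {s : Set ℝ}
    {A : ℝ → EuclideanSpace ℂ (Fin n) →L[ℂ] EuclideanSpace ℂ (Fin m)} (hA : ContinuousOn A s) :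
    ContinuousOn (fun x => matCLM.symm (A x)) s := by
  refine continuousOn_pi.2 fun i => continuousOn_pi.2 fun j => ?_
  simp_rw [symm_matCLM_apply]
  exact (entryCLM i j).continuous.comp_continuousOn hA

end Matrices

/-! ### Uniqueness and square-integrability -/

section Auxiliary

variable {V W : Type*} [NormedAddCommGroup V] [NormedSpace ℂ V]
  [NormedAddCommGroup W] [NormedSpace ℂ W] {α : ℝ → W →L[ℂ] V} {γ : ℝ → V →L[ℂ] W} {T : ℝ}

/-- The difference solves the homogeneous equation with zero initial value. -/
lemma IsPrimitive.unique (hT : 0 ≤ T) (hα : StronglyMeasurable α)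
    (hα2 : Integrable fun x => ‖α x‖ ^ 2) (hγ1 : Integrable γ) {X Y φ : ℝ → V}
    (hX : IsPrimitive T X fun x => φ x - α x (∫ t in (0 : ℝ)..x, γ t (X t)))
    (hY : IsPrimitive T Y fun x => φ x - α x (∫ t in (0 : ℝ)..x, γ t (Y t)))
    (h0 : X 0 = Y 0) : ∀ x ∈ Icc 0 T, X x = Y x := by
  have hi : ∀ {Z : ℝ → V}, ContinuousOn Z (Icc 0 T) → ∀ x ∈ Icc 0 T,
      IntervalIntegrable (fun t => γ t (Z t)) volume 0 x := fun hZ x hx => by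
    rw [intervalIntegrable_iff_integrableOn_Ioc_of_le hx.1]
    exact (integrableOn_comp_continuousOn hγ1.integrableOn hZ).mono_set
      (Ioc_subset_Ioc_right hx.2)
  have h := ((hX.sub hY).congr (Z' := fun x => -(α x (∫ t in (0 : ℝ)..x, γ t (X t - Y t))))
    (fun x _ => rfl) fun x hx => by
      have hx' := Ioc_subset_Icc_self hx
      simp only [map_sub]
      rw [intervalIntegral.integral_sub (hi (hX.continuousOn hT) x hx')
        (hi (hY.continuousOn hT) x hx'), map_sub]
      abel).eq_zero_of_integral_equation hα hα2 hγ1 hT (sub_eq_zero.2 h0)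
  exact fun x hx => sub_eq_zero.1 (h x hx)

lemma memLp_two_of_integrable_sq (hα : StronglyMeasurable α)
    (hα2 : Integrable fun x => ‖α x‖ ^ 2) : MemLp α 2 (volume.restrict (Ioc 0 T)) :=
  ((memLp_two_iff_integrable_sq_norm hα.aestronglyMeasurable).2 hα2).restrict _

lemma memLp_apply_continuousOn (hα : MemLp α 2 (volume.restrict (Ioc 0 T))) {z : ℝ → W}
    (hz : ContinuousOn z (Icc 0 T)) :
    MemLp (fun x => α x (z x)) 2 (volume.restrict (Ioc 0 T)) := by
  obtain ⟨C, hC⟩ := isCompact_Icc.exists_bound_of_continuousOn hz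
  refine MemLp.of_le_mul (c := C) hα ?_ ((ae_restrict_iff' measurableSet_Ioc).2
    (Eventually.of_forall fun x hx => ?_))
  · exact (isBoundedBilinearMap_apply (𝕜 := ℂ)).continuous.comp_aestronglyMeasurable
      (hα.1.prodMk ((hz.mono Ioc_subset_Icc_self).aestronglyMeasurable measurableSet_Ioc))
  · rw [mul_comm]
    exact ((α x).le_opNorm _).trans
      (mul_le_mul_of_nonneg_left (hC x (Ioc_subset_Icc_self hx)) (norm_nonneg _))

lemma memLp_continuousOn_apply {z : ℝ → W} (hα : ContinuousOn α (Icc 0 T))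
    (hz : MemLp z 2 (volume.restrict (Ioc 0 T))) :
    MemLp (fun x => α x (z x)) 2 (volume.restrict (Ioc 0 T)) := by
  obtain ⟨C, hC⟩ := isCompact_Icc.exists_bound_of_continuousOn hα
  refine MemLp.of_le_mul (c := C) hz ?_ ((ae_restrict_iff' measurableSet_Ioc).2
    (Eventually.of_forall fun x hx => ?_))
  · exact (isBoundedBilinearMap_apply (𝕜 := ℂ)).continuous.comp_aestronglyMeasurable
      (((hα.mono Ioc_subset_Icc_self).aestronglyMeasurable measurableSet_Ioc).prodMk hz.1)
  · exact (α x).le_of_opNorm_le (hC x (Ioc_subset_Icc_self hx)) _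

lemma memLp_volterra {N : ℝ × ℝ → V →L[ℂ] V} {C : ℝ} (hN : StronglyMeasurable N)
    (hC : ∀ q : ℝ × ℝ, q.2 ≤ T → ‖N q‖ ≤ C) {f : ℝ → V} (hf : StronglyMeasurable f)
    (hfi : IntegrableOn f (Ioc 0 T)) :
    MemLp (volterra N f) 2 (volume.restrict (Ioc 0 T)) :=
  MemLp.of_bound (aestronglyMeasurable_volterra hN hf) (C * ∫ t in Ioc 0 T, ‖f t‖)
    ((ae_restrict_iff' measurableSet_Ioc).2 (Eventually.of_forall fun _ hx =>
      norm_volterra_le hC hfi (Ioc_subset_Icc_self hx)))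

end Auxiliary

/-! ### The transmutation operator on `L²` -/

section Operator

variable {n : ℕ} {T C : ℝ}
  {N : ℝ × ℝ → EuclideanSpace ℂ (Fin n) →L[ℂ] EuclideanSpace ℂ (Fin n)}

lemma volterra_add (hN : StronglyMeasurable N) (hC : ∀ q : ℝ × ℝ, q.2 ≤ T → ‖N q‖ ≤ C)
    {f g : ℝ → EuclideanSpace ℂ (Fin n)} (hf : IntegrableOn f (Ioc 0 T))
    (hg : IntegrableOn g (Ioc 0 T)) {x : ℝ} (hx : x ∈ Icc 0 T) :
    volterra N (fun t => f t + g t) x = volterra N f x + volterra N g x := by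
  have hs : Ioc 0 x ⊆ Ioc 0 T := Ioc_subset_Ioc_right hx.2
  unfold volterra
  simp only [intervalIntegral.integral_of_le hx.1, map_add]
  exact integral_add ((integrableOn_kernel_apply hN hC hf x).mono_set hs)
    ((integrableOn_kernel_apply hN hC hg x).mono_set hs)

lemma stronglyMeasurable_L2 (f : L2 n T) : StronglyMeasurable f := Lp.stronglyMeasurable f

lemma memLp_volterra_L2 (hN : StronglyMeasurable N) (hC : ∀ q : ℝ × ℝ, q.2 ≤ T → ‖N q‖ ≤ C)
    (f : L2 n T) : MemLp (volterra N f) 2 (volume.restrict (Ioc 0 T)) :=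
  memLp_volterra hN hC (stronglyMeasurable_L2 f) (integrableOn_of_L2 f)

lemma integral_norm_L2_le :
    ∃ D : ℝ, 0 ≤ D ∧ ∀ f : L2 n T, ∫ t in Ioc 0 T, ‖f t‖ ≤ D * ‖f‖ := by
  refine ⟨(volume.restrict (Ioc 0 T) univ ^ (2⁻¹ : ℝ)).toReal, ENNReal.toReal_nonneg,
    fun f => ?_⟩
  rw [integral_norm_eq_lintegral_enorm (integrableOn_of_L2 f).1, ← eLpNorm_one_eq_lintegral_enorm,
    Lp.norm_def, mul_comm, ← ENNReal.toReal_mul]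
  refine ENNReal.toReal_mono (ENNReal.mul_ne_top (Lp.eLpNorm_ne_top f)
    (ENNReal.rpow_ne_top_of_nonneg (by norm_num) (measure_ne_top _ _))) ?_
  have h := eLpNorm_le_eLpNorm_mul_rpow_measure_univ (μ := volume.restrict (Ioc 0 T))
    (p := 1) (q := 2) (by norm_num) (Lp.aestronglyMeasurable f)
  have h4 : (1 / ENNReal.toReal 1 - 1 / ENNReal.toReal 2 : ℝ) = 2⁻¹ := by
    rw [ENNReal.toReal_one, ENNReal.toReal_ofNat]
    norm_num
  rwa [h4] at h

/-- A Volterra operator with bounded kernel, on `L²`. -/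
noncomputable def volterraOp (hN : StronglyMeasurable N)
    (hC : ∀ q : ℝ × ℝ, q.2 ≤ T → ‖N q‖ ≤ C) : L2 n T →L[ℂ] L2 n T :=
  LinearMap.mkContinuousOfExistsBound
    { toFun := fun f => (memLp_volterra_L2 hN hC f).toLp _
      map_add' := by
        intro f g
        rw [← MemLp.toLp_add]
        refine MemLp.toLp_congr _ _ ((ae_restrict_iff' measurableSet_Ioc).2
          (Eventually.of_forall fun x hx => ?_))
        have hx' := Ioc_subset_Icc_self hx
        rw [volterra_congr (Lp.coeFn_add f g) hx']
        exact volterra_add hN hC (integrableOn_of_L2 f) (integrableOn_of_L2 g) hx'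
      map_smul' := by
        intro c f
        simp only [RingHom.id_apply]
        rw [← MemLp.toLp_const_smul]
        refine MemLp.toLp_congr _ _ ((ae_restrict_iff' measurableSet_Ioc).2
          (Eventually.of_forall fun x hx => ?_))
        rw [volterra_congr (Lp.coeFn_smul c f) (Ioc_subset_Icc_self hx)]
        simp only [volterra, Pi.smul_apply, map_smul]
        exact intervalIntegral.integral_smul c _ }
    (by
      have hC0 : 0 ≤ C := (norm_nonneg _).trans (hC (0, T) le_rfl)
      obtain ⟨D, hD0, hD⟩ := integral_norm_L2_le (n := n) (T := T)
      refine ⟨(volume.restrict (Ioc 0 T)).real univ ^ (ENNReal.toReal 2)⁻¹ * (C * D), fun f => ?_⟩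
      rw [mul_assoc]
      refine Lp.norm_le_of_ae_bound (by positivity) ?_
      filter_upwards [(memLp_volterra_L2 hN hC f).coeFn_toLp, ae_restrict_mem measurableSet_Ioc]
        with x h1 hx
      refine (congrArg norm h1).trans_le ((norm_volterra_le hC (integrableOn_of_L2 f)
        (Ioc_subset_Icc_self hx)).trans ?_)
      rw [mul_assoc]
      exact mul_le_mul_of_nonneg_left (hD f) hC0)

lemma volterraOp_ae (hN : StronglyMeasurable N) (hC : ∀ q : ℝ × ℝ, q.2 ≤ T → ‖N q‖ ≤ C)
    (f : L2 n T) : volterraOp hN hC f =ᵐ[volume.restrict (Ioc 0 T)] volterra N f :=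
  (memLp_volterra_L2 hN hC f).coeFn_toLp

lemma one_add_volterraOp_ae (hN : StronglyMeasurable N)
    (hC : ∀ q : ℝ × ℝ, q.2 ≤ T → ‖N q‖ ≤ C) (f : L2 n T) :
    (1 + volterraOp hN hC) f =ᵐ[volume.restrict (Ioc 0 T)] fun x => f x + volterra N f x := by
  have h : (1 + volterraOp hN hC) f = f + volterraOp hN hC f := rfl
  rw [h]
  filter_upwards [Lp.coeFn_add f (volterraOp hN hC f), volterraOp_ae hN hC f] with x h1 h2
  rw [h1, Pi.add_apply, h2]

lemma bijective_one_add_volterraOp (hN : StronglyMeasurable N)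
    (hC : ∀ q : ℝ × ℝ, q.2 ≤ T → ‖N q‖ ≤ C) :
    Function.Bijective (1 + volterraOp hN hC : L2 n T →L[ℂ] L2 n T) := by
  constructor
  · refine (injective_iff_map_eq_zero _).2 fun f hf => ?_
    rw [Lp.eq_zero_iff_ae_eq_zero]
    refine eq_zero_of_eq_neg_volterra hC (integrableOn_of_L2 f) ?_
    filter_upwards [one_add_volterraOp_ae hN hC f, (Lp.eq_zero_iff_ae_eq_zero).1 hf] with x h1 h2
    rw [h2] at h1
    exact eq_neg_of_add_eq_zero_left h1.symm
  · intro u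
    have hu := stronglyMeasurable_L2 u
    have hui := integrableOn_of_L2 u
    -- The preimage is sought as `u + d`, so that `d = -Nu - Nd`. The inhomogeneity `-Nu` is bounded
    -- although `u` is only in `L²`.
    obtain ⟨d, hd, ⟨D, hD⟩, hdu⟩ := exists_volterra_solution hN hC
      (stronglyMeasurable_volterra hN hu).neg
      (B := C * ∫ t in Ioc 0 T, ‖u t‖) (fun x hx => by
        rw [Pi.neg_apply, norm_neg, indicator_of_mem (show x ∈ Ici 0 from hx.1)]
        exact norm_volterra_le hC hui hx)
    have hdL : MemLp d 2 (volume.restrict (Ioc 0 T)) :=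
      MemLp.of_bound hd.aestronglyMeasurable D ((ae_restrict_iff' measurableSet_Ioc).2
        (Eventually.of_forall fun x hx => hD x (Ioc_subset_Icc_self hx)))
    have hdi : IntegrableOn d (Ioc 0 T) := hdL.integrable (by norm_num)
    have hae : (u + hdL.toLp d : L2 n T) =ᵐ[volume.restrict (Ioc 0 T)] fun x => u x + d x := by
      filter_upwards [Lp.coeFn_add u (hdL.toLp d), hdL.coeFn_toLp] with x h1 h2
      rw [h1, Pi.add_apply, h2]
    refine ⟨u + hdL.toLp d, Lp.ext ?_⟩
    filter_upwards [one_add_volterraOp_ae hN hC (u + hdL.toLp d), hae,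
      ae_restrict_mem measurableSet_Ioc] with x h1 h2 hx
    have hx' := Ioc_subset_Icc_self hx
    rw [h1, h2, volterra_congr hae hx', volterra_add hN hC hui hdi hx', hdu x hx', Pi.neg_apply,
      indicator_of_mem (show x ∈ Ici 0 from hx'.1)]
    abel

end Operator

/-! ### Inversion of the multiplication operator -/

section Multiplication

variable {n : ℕ} {T : ℝ}

lemma bijective_mulOp {R S : ℝ → Matrix (Fin n) (Fin n) ℂ} (hR : ContinuousOn R (Icc 0 T))
    (hS : ContinuousOn S (Icc 0 T)) (hRS : ∀ x, R x * S x = 1) (hSR : ∀ x, S x * R x = 1) :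
    Function.Bijective (mulOp R hR : L2 n T →L[ℂ] L2 n T) := by
  have key : ∀ {A B : ℝ → Matrix (Fin n) (Fin n) ℂ} (hA : ContinuousOn A (Icc 0 T))
      (hB : ContinuousOn B (Icc 0 T)), (∀ x, A x * B x = 1) → ∀ f : L2 n T,
      mulOp A hA (mulOp B hB f) = f := fun hA hB h f => by
    refine Lp.ext ?_
    filter_upwards [mulOp_ae _ hA (mulOp _ hB f), mulOp_ae _ hB f] with x h1 h2
    rw [h1, h2, ← matCLM_apply, ← matCLM_apply, ← ContinuousLinearMap.comp_apply, ← matCLM_mul,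
      h x, matCLM_one]
    rfl
  exact ⟨Function.LeftInverse.injective (key hS hR hSR),
    Function.RightInverse.surjective (key hR hS hRS)⟩

end Multiplication

/-! ### Properties of the transmutation operator -/

section Transmutation

variable {n : ℕ} {W : Type*} [NormedAddCommGroup W] [NormedSpace ℂ W]
  {T C : ℝ} {N : ℝ × ℝ → EuclideanSpace ℂ (Fin n) →L[ℂ] EuclideanSpace ℂ (Fin n)}
  {α : ℝ → W →L[ℂ] EuclideanSpace ℂ (Fin n)} {γ : ℝ → EuclideanSpace ℂ (Fin n) →L[ℂ] W}

/-- The operator `1 + N` intertwines `d/dx` and `d/dx + α ∫ γ`. -/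
def IsTransmutation (T : ℝ)
    (N : ℝ × ℝ → EuclideanSpace ℂ (Fin n) →L[ℂ] EuclideanSpace ℂ (Fin n))
    (α : ℝ → W →L[ℂ] EuclideanSpace ℂ (Fin n))
    (γ : ℝ → EuclideanSpace ℂ (Fin n) →L[ℂ] W) : Prop :=
  ∀ f h : ℝ → EuclideanSpace ℂ (Fin n), StronglyMeasurable f → IsPrimitive T h f →
    IsPrimitive T (fun x => h x + volterra N h x) fun x => f x + volterra N f x -
      α x (∫ t in (0 : ℝ)..x, γ t (h t + volterra N h t))

lemma memLp_apply_integral (hT : 0 ≤ T) (hα : StronglyMeasurable α)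
    (hα2 : Integrable fun x => ‖α x‖ ^ 2) (hγ1 : Integrable γ)
    {z : ℝ → EuclideanSpace ℂ (Fin n)} (hz : ContinuousOn z (Icc 0 T)) :
    MemLp (fun x => α x (∫ t in (0 : ℝ)..x, γ t (z t))) 2 (volume.restrict (Ioc 0 T)) :=
  memLp_apply_continuousOn (memLp_two_of_integrable_sq hα hα2)
    (continuousOn_integral hT (integrableOn_comp_continuousOn hγ1.integrableOn hz))

lemma IsTransmutation.exists_isPrimitive [CompleteSpace W] (hT : 0 ≤ T) (hα : StronglyMeasurable α)
    (hα2 : Integrable fun x => ‖α x‖ ^ 2) (hγ1 : Integrable γ) (hN : StronglyMeasurable N)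
    (hC : ∀ q : ℝ × ℝ, q.2 ≤ T → ‖N q‖ ≤ C) (h : IsTransmutation T N α γ)
    {φ φ' : ℝ → EuclideanSpace ℂ (Fin n)} (hφ'm : StronglyMeasurable φ')
    (hφ' : MemLp φ' 2 (volume.restrict (Ioc 0 T))) (hφ : IsPrimitive T φ φ') :
    ∃ e' : ℝ → EuclideanSpace ℂ (Fin n), MemLp e' 2 (volume.restrict (Ioc 0 T)) ∧
      IsPrimitive T (fun x => φ x + volterra N φ x) e' :=
  have hp := h φ' φ hφ'm hφ
  ⟨_, (hφ'.add (memLp_volterra hN hC hφ'm hφ.integrableOn)).sub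
    (memLp_apply_integral hT hα hα2 hγ1 (hp.continuousOn hT)), hp⟩

/-- Solve `(1 + N)f = y' + α∫γy` in `L²` and put `φ = y(0) + ∫f`. Then `(1 + N)φ` and `y` satisfy
the same equation with the same initial value. This gives regularity of `(1 + N)⁻¹` without studying
its kernel. -/
lemma IsTransmutation.exists_preimage [CompleteSpace W] (hT : 0 ≤ T) (hα : StronglyMeasurable α)
    (hα2 : Integrable fun x => ‖α x‖ ^ 2) (hγ1 : Integrable γ) (hN : StronglyMeasurable N)
    (hC : ∀ q : ℝ × ℝ, q.2 ≤ T → ‖N q‖ ≤ C) (h : IsTransmutation T N α γ)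
    {y y' : ℝ → EuclideanSpace ℂ (Fin n)}
    (hy' : MemLp y' 2 (volume.restrict (Ioc 0 T))) (hy : IsPrimitive T y y') :
    ∃ φ φ' : ℝ → EuclideanSpace ℂ (Fin n), MemLp φ' 2 (volume.restrict (Ioc 0 T)) ∧
      IsPrimitive T φ φ' ∧ ∀ x ∈ Icc 0 T, φ x + volterra N φ x = y x := by
  have hu := hy'.add (memLp_apply_integral hT hα hα2 hγ1 (hy.continuousOn hT))
  obtain ⟨f, hf⟩ := (bijective_one_add_volterraOp hN hC).2 (hu.toLp _)
  have hp := IsPrimitive.of_integrableOn (y 0) (integrableOn_of_L2 f)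
  refine ⟨_, f, Lp.memLp f, hp, ?_⟩
  refine IsPrimitive.unique hT hα hα2 hγ1 (h f _ (stronglyMeasurable_L2 f) hp)
    (hy.congr_ae ?_) (by simp [volterra])
  have h1 := one_add_volterraOp_ae hN hC f
  rw [hf] at h1
  filter_upwards [h1, hu.coeFn_toLp] with x h1 h2
  rw [← h1, h2]
  simp

/-- Both sides solve one initial value problem. With `g = σKρ(1 + N)f` this is the intertwining
relation `(1 + N)A = σKρ(1 + N)`. -/
lemma IsTransmutation.integral_add_volterra (hT : 0 ≤ T) (hα : StronglyMeasurable α)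
    (hα2 : Integrable fun x => ‖α x‖ ^ 2) (hγ1 : Integrable γ) (h : IsTransmutation T N α γ)
    (f : L2 n T) {g : ℝ → EuclideanSpace ℂ (Fin n)} (hg0 : g 0 = 0)
    (hg : IsPrimitive T g fun x =>
      f x + volterra N f x - α x (∫ t in (0 : ℝ)..x, γ t (g t))) :
    ∀ x ∈ Icc 0 T, (∫ t in (0 : ℝ)..x, f t) +
      volterra N (fun s => ∫ t in (0 : ℝ)..s, f t) x = g x := by
  have hp := IsPrimitive.of_integrableOn (0 : EuclideanSpace ℂ (Fin n)) (integrableOn_of_L2 f)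
  simp only [zero_add] at hp
  exact IsPrimitive.unique hT hα hα2 hγ1 (h f _ (stronglyMeasurable_L2 f) hp) hg
    (by simp [volterra, hg0])

end Transmutation

/-! ### The class `MemH1` -/

section MemH1

variable {n : ℕ} {T : ℝ}

lemma memH1_of_isPrimitive (hT : 0 ≤ T) {f : L2 n T} {φ φ' : ℝ → EuclideanSpace ℂ (Fin n)}
    (hφ : IsPrimitive T φ φ') (hφ' : MemLp φ' 2 (volume.restrict (Ioc 0 T)))
    (hf : f =ᵐ[volume.restrict (Ioc 0 T)] φ) : MemH1 f :=
  ⟨φ, hasL2Deriv_of_isPrimitive hT hφ hφ', hf⟩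

variable {ρ ρ' : ℝ → EuclideanSpace ℂ (Fin n) →L[ℂ] EuclideanSpace ℂ (Fin n)}

lemma memLp_deriv_apply (hT : 0 ≤ T) (hρ : IsPrimitive T ρ ρ')
    (hρ' : MemLp ρ' 2 (volume.restrict (Ioc 0 T))) {φ φ' : ℝ → EuclideanSpace ℂ (Fin n)}
    (hφ : IsPrimitive T φ φ') (hφ' : MemLp φ' 2 (volume.restrict (Ioc 0 T))) :
    MemLp (fun x => ρ' x (φ x) + ρ x (φ' x)) 2 (volume.restrict (Ioc 0 T)) :=
  (memLp_apply_continuousOn hρ' (hφ.continuousOn hT)).add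
    (memLp_continuousOn_apply (hρ.continuousOn hT) hφ')

end MemH1

section Composition

variable {U V W : Type*} [NormedAddCommGroup U] [NormedSpace ℂ U] [NormedAddCommGroup V]
  [NormedSpace ℂ V] [NormedAddCommGroup W] [NormedSpace ℂ W] {T : ℝ}

lemma memLp_comp_continuousOn {A : ℝ → V →L[ℂ] W} {B : ℝ → U →L[ℂ] V}
    (hA : MemLp A 2 (volume.restrict (Ioc 0 T))) (hB : ContinuousOn B (Icc 0 T)) :
    MemLp (fun x => A x ∘L B x) 2 (volume.restrict (Ioc 0 T)) :=
  memLp_continuousOn_apply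
    (α := fun x => (ContinuousLinearMap.compL ℂ U V W).flip (B x))
    ((ContinuousLinearMap.compL ℂ U V W).flip.continuous.comp_continuousOn hB) hA

lemma memLp_continuousOn_comp {A : ℝ → V →L[ℂ] W} {B : ℝ → U →L[ℂ] V}
    (hA : ContinuousOn A (Icc 0 T)) (hB : MemLp B 2 (volume.restrict (Ioc 0 T))) :
    MemLp (fun x => A x ∘L B x) 2 (volume.restrict (Ioc 0 T)) :=
  memLp_continuousOn_apply
    (α := fun x => ContinuousLinearMap.compL ℂ U V W (A x))
    ((ContinuousLinearMap.compL ℂ U V W).continuous.comp_continuousOn hA) hB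

end Composition

end Similarity

/-! ### The similarity -/

theorem proposition2p1 (r p : ℕ) (T : ℝ) (hT : 0 < T)
    (F : ℝ → Matrix (Fin r) (Fin p) ℂ) (G : ℝ → Matrix (Fin p) (Fin r) ℂ)
    (hF : MatHasL2Deriv T F) (hG : MatHasL2Deriv T G)
    (hFG : ∀ x ∈ Icc (0 : ℝ) T, F x * G x = 1) :
    ∃ (E : L2 r T ≃L[ℂ] L2 r T) (ρ : ℝ → Matrix (Fin r) (Fin r) ℂ)
      (N : ℝ → ℝ → Matrix (Fin r) (Fin r) ℂ),
      -- `K = E A E⁻¹`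
      kOp F G (hF.continuousOn hT) (hG.continuousOn hT) =
        (E : L2 r T →L[ℂ] L2 r T) ∘L intOp r T ∘L (E.symm : L2 r T →L[ℂ] L2 r T) ∧
      -- `(E f)(x) = ρ(x) (f(x) + ∫₀ˣ N(x,t) f(t) dt)`
      (∀ f : L2 r T, E f =ᵐ[volume.restrict (Ioc 0 T)] fun x =>
        act (ρ x) (f x + ∫ t in (0 : ℝ)..x, act (N x t) (f t))) ∧
      -- `ρ' = F' G ρ` almost everywhere, `ρ` absolutely continuous, `ρ(0) = I`
      (∀ i j, AbsolutelyContinuousOnInterval (fun x => ρ x i j) 0 T) ∧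
      (∀ᵐ x ∂(volume.restrict (Ioc 0 T)), ∀ i j,
        HasDerivAt (fun s => ρ s i j) ((matDeriv F x * G x * ρ x) i j) x) ∧
      ρ 0 = 1 ∧
      -- `ρ(x)` is invertible, and `ρ`, `ρ⁻¹`, `N` are measurable
      (∀ x ∈ Icc (0 : ℝ) T, IsUnit (ρ x)) ∧
      (∀ i j, Measurable fun x => ρ x i j) ∧
      (∀ i j, Measurable fun x => (ρ x)⁻¹ i j) ∧
      (∀ i j, Measurable fun q : ℝ × ℝ => N q.1 q.2 i j) ∧
      -- `ρ`, `ρ⁻¹` are uniformly bounded on `[0,T]` and `N` on `0 ≤ t ≤ x ≤ T`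
      (∃ C : ℝ, (∀ x ∈ Icc (0 : ℝ) T, ∀ i j, ‖ρ x i j‖ ≤ C ∧ ‖(ρ x)⁻¹ i j‖ ≤ C) ∧
        ∀ x t : ℝ, 0 ≤ t → t ≤ x → x ≤ T → ∀ i j, ‖N x t i j‖ ≤ C) ∧
      -- `E` and `E⁻¹` preserve the class of functions with square-summable derivative
      (∀ f : L2 r T, MemH1 f → MemH1 (E f)) ∧
      (∀ f : L2 r T, MemH1 f → MemH1 (E.symm f)) := by
  have hFp := hF.isPrimitive hT.le
  have hGp := hG.isPrimitive hT.le
  have hGc := hGp.continuousOn hT.le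
  obtain ⟨ρ, σ, α, γ, hρm, hσm, hρ0, hσρ, hρσ, hρp, hσp, hαm, hα2, hα0, hγm, hγ2, hγ0, hnorm⟩ :=
    exists_normalization hT hFp stronglyMeasurable_matDeriv
      ((memLp_two_iff_integrable_sq_norm hF.memLp.1).1 hF.memLp) hGp stronglyMeasurable_matDeriv
      ((memLp_two_iff_integrable_sq_norm hG.memLp.1).1 hG.memLp) fun x hx => by
        rw [← matCLM_mul, hFG x hx, matCLM_one]
  obtain ⟨N, hN, ⟨C, hC⟩, hNt⟩ := exists_transmutation hT hαm hα2 hα0 hγm hγ2 hγ0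
  replace hNt : IsTransmutation T N α γ := hNt
  have hγ1 := integrable_of_sq_of_support hγm hγ2 hγ0
  have hρc := hρp.continuousOn hT.le
  have hσc := hσp.continuousOn hT.le
  have hρ' : MemLp (fun x => matCLM (matDeriv F x) ∘L matCLM (G x) ∘L ρ x) 2
      (volume.restrict (Ioc 0 T)) :=
    memLp_comp_continuousOn hF.memLp (hGc.clm_comp hρc)
  have hσ' : MemLp (fun x => -(σ x ∘L matCLM (matDeriv F x) ∘L matCLM (G x))) 2
      (volume.restrict (Ioc 0 T)) :=
    (memLp_continuousOn_comp hσc (memLp_comp_continuousOn hF.memLp hGc)).neg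
  set R : ℝ → Matrix (Fin r) (Fin r) ℂ := fun x => matCLM.symm (ρ x) with hRdef
  set S : ℝ → Matrix (Fin r) (Fin r) ℂ := fun x => matCLM.symm (σ x) with hSdef
  have hRc : ContinuousOn R (Icc 0 T) := continuousOn_symm_matCLM hρc
  have hSc : ContinuousOn S (Icc 0 T) := continuousOn_symm_matCLM hσc
  have hSR : ∀ x, S x * R x = 1 := fun x => matCLM.injective (by
    rw [matCLM_mul, matCLM_one, ← hσρ x, hRdef, hSdef, LinearEquiv.apply_symm_apply,
      LinearEquiv.apply_symm_apply])
  have hRS : ∀ x, R x * S x = 1 := fun x => mul_eq_one_comm.1 (hSR x)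
  have hRinv : ∀ x, (R x)⁻¹ = S x := fun x => Matrix.inv_eq_left_inv (hSR x)
  have hbij : Function.Bijective (mulOp R hRc ∘L (1 + volterraOp hN hC)) :=
    (bijective_mulOp hRc hSc hRS hSR).comp (bijective_one_add_volterraOp hN hC)
  -- `E = ρ(1 + N)`; bijectivity and the open mapping theorem give the bounded inverse.
  set E : L2 r T ≃L[ℂ] L2 r T := ContinuousLinearEquiv.ofBijective
    (mulOp R hRc ∘L (1 + volterraOp hN hC)) (LinearMap.ker_eq_bot.2 hbij.1)
    (LinearMap.range_eq_top.2 hbij.2) with hEdef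
  have hE : ∀ f : L2 r T, E f =ᵐ[volume.restrict (Ioc 0 T)] fun x =>
      ρ x (f x + volterra N f x) := fun f => by
    filter_upwards [mulOp_ae R hRc ((1 + volterraOp hN hC) f), one_add_volterraOp_ae hN hC f]
      with x h1 h2
    rw [← h2, ← act_symm_matCLM]
    exact h1
  have hEc : ∀ (f : L2 r T) {φ}, f =ᵐ[volume.restrict (Ioc 0 T)] φ →
      E f =ᵐ[volume.restrict (Ioc 0 T)] fun x => ρ x (φ x + volterra N φ x) := fun f φ hf => by
    filter_upwards [hE f, hf, ae_restrict_mem measurableSet_Ioc] with x h1 h2 hx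
    rw [h1, h2, volterra_congr hf (Ioc_subset_Icc_self hx)]
  have hσρ' : ∀ x v, σ x (ρ x v) = v := fun x v => DFunLike.congr_fun (hσρ x) v
  have hρσ' : ∀ x v, ρ x (σ x v) = v := fun x v => DFunLike.congr_fun (hρσ x) v
  have hKE : ∀ f : L2 r T, kOp F G (hF.continuousOn hT) (hG.continuousOn hT) (E f) =
      E (intOp r T f) := fun f => by
    have hfi := integrableOn_of_L2 f
    -- The normalized operator is applied to `(1 + N)f`; its output is identified below with `(1 +
    -- N)Af`, and `ρ` restores `K` and `E`.
    have hg := hnorm (fun x => f x + volterra N f x)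
      (hfi.add (integrableOn_volterra hN hC (stronglyMeasurable_L2 f) hfi))
    have hfix := hNt.integral_add_volterra hT.le hαm hα2 hγ1 f (by simp) hg
    refine Lp.ext ?_
    filter_upwards [kOp_ae F G (hF.continuousOn hT) (hG.continuousOn hT) (E f),
      hEc _ (intOp_ae f), ae_restrict_mem measurableSet_Ioc] with x h1 h2 hx
    rw [h1, h2, hfix x (Ioc_subset_Icc_self hx), hρσ', matCLM_apply]
    congr 1
    rw [intervalIntegral.integral_of_le hx.1.le, intervalIntegral.integral_of_le hx.1.le]
    refine integral_congr_ae ?_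
    filter_upwards [ae_mono (Measure.restrict_mono (Ioc_subset_Ioc_right hx.2) le_rfl) (hE f)]
      with t ht
    rw [ht, matCLM_apply]
  refine ⟨E, R, fun x t => matCLM.symm (N (x, t)), ?_, fun f => ?_, fun i j => ?_, ?_, ?_,
    fun x _ => IsUnit.of_mul_eq_one _ (hRS x), measurable_symm_matCLM hρm, fun i j => ?_,
    measurable_symm_matCLM hN, ?_, ?_, ?_⟩
  · ext1 y
    have h := hKE (E.symm y)
    rw [ContinuousLinearEquiv.apply_symm_apply] at h
    exact h
  · simp only [act_symm_matCLM, hRdef]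
    exact hE f
  · simp only [hRdef, symm_matCLM_apply]
    exact (hρp.clm ((entryCLM i j).restrictScalars ℝ)).absolutelyContinuous hT.le
  · filter_upwards [ae_Ioo_of_ae_restrict_Ioc (hρp.hasDerivAt hT.le)] with x hx i j
    have h := ((entryCLM i j).restrictScalars ℝ).hasFDerivAt.comp_hasDerivAt x hx
    have e : entryCLM i j (matCLM (matDeriv F x) ∘L matCLM (G x) ∘L ρ x) =
        (matDeriv F x * G x * R x) i j := by
      rw [← entryCLM_matCLM (matDeriv F x * G x * R x), matCLM_mul, matCLM_mul, hRdef, LinearEquiv.apply_symm_apply]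
      rfl
    rw [← e]
    simp only [hRdef, symm_matCLM_apply]
    exact h
  · rw [hRdef]
    simp only [hρ0]
    rw [← matCLM_one, LinearEquiv.symm_apply_apply]
  · simp only [hRinv]
    exact measurable_symm_matCLM hσm i j
  · obtain ⟨C₁, hC₁⟩ := isCompact_Icc.exists_bound_of_continuousOn hρc
    obtain ⟨C₂, hC₂⟩ := isCompact_Icc.exists_bound_of_continuousOn hσc
    refine ⟨max C (max C₁ C₂), fun x hx i j => ⟨?_, ?_⟩, fun x t _ htx hxT i j => ?_⟩
    · exact (norm_symm_matCLM_le _ i j).trans ((hC₁ x hx).trans (by simp))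
    · rw [hRinv]
      exact (norm_symm_matCLM_le _ i j).trans ((hC₂ x hx).trans (by simp))
    · exact (norm_symm_matCLM_le _ i j).trans ((hC (x, t) (htx.trans hxT)).trans (by simp))
  · rintro f ⟨φ, hφ, hfφ⟩
    obtain ⟨φ', hφ'm, hφ', hφp⟩ := exists_isPrimitive_of_hasL2Deriv hT.le hφ
    obtain ⟨e', he', hep⟩ := hNt.exists_isPrimitive hT.le hαm hα2 hγ1 hN hC hφ'm hφ' hφp
    exact memH1_of_isPrimitive hT.le (hρp.apply hT.le hep)
      (memLp_deriv_apply hT.le hρp hρ' hep he') (hEc f hfφ)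
  · rintro y ⟨ψ, hψ, hyψ⟩
    obtain ⟨ψ', -, hψ', hψp⟩ := exists_isPrimitive_of_hasL2Deriv hT.le hψ
    -- Undo the factors in turn: `σψ` has a square-summable derivative, and so has its preimage
    -- under `1 + N`.
    obtain ⟨φ, φ', hφ', hφp, hφ⟩ := hNt.exists_preimage hT.le hαm hα2 hγ1 hN hC
      (memLp_deriv_apply hT.le hσp hσ' hψp hψ') (hσp.apply hT.le hψp)
    have hφc := hφp.continuousOn hT.le
    obtain ⟨D, hD⟩ := isCompact_Icc.exists_bound_of_continuousOn hφc
    have hφL : MemLp φ 2 (volume.restrict (Ioc 0 T)) :=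
      MemLp.of_bound ((hφc.mono Ioc_subset_Icc_self).aestronglyMeasurable measurableSet_Ioc) D
        ((ae_restrict_iff' measurableSet_Ioc).2 (Filter.Eventually.of_forall fun x hx =>
          hD x (Ioc_subset_Icc_self hx)))
    have hy : E (hφL.toLp φ) = y := by
      refine Lp.ext ?_
      filter_upwards [hEc _ hφL.coeFn_toLp, hyψ, ae_restrict_mem measurableSet_Ioc]
        with x h1 h2 hx
      rw [h1, h2, hφ x (Ioc_subset_Icc_self hx), hρσ']
    rw [← hy, ContinuousLinearEquiv.symm_apply_apply]
    exact memH1_of_isPrimitive hT.le hφp hφ' hφL.coeFn_toLp
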